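/- Conventions. French notation: rows are counted from bottom to top, columns from left to right, starting with 1. A semistandard hook tableau $B$ consists of a hook entry $H(B)=x$, a leg $L(B)=(\ell_1<\dots<\ell_p)$ with $x<\ell_1$, and an arm $A(B)=(a_1\le\dots\le a_q)$ with $x\le a_1$ ($p,q\ge 0$; all entries positive integers); its extended leg is $L^+(B)=(x,\ell_1,\dots,\ell_p)$. A hook-valued tableau $T$ of shape $\lambda$ (a partition) is a filling of the Young diagram of $\lambda$ with semistandard hook tableaux such that every entry of a cell is $\le$ every entry of any cell to its right in the same row and $<$ every entry of any cell above it in the same column. Its arm excess is the total number of arm entries; it is a set-valued tableau if the arm excess is $0$. A column-flagged increasing tableau of shape $\mu/\lambda$ (where $\lambda\subseteq\mu$ have the same number of rows) is a filling of $\mu/\lambda$ with positive integers, strictly increasing along rows (left to right) and columns (bottom to top), whose entries in column $j$ are at most $j-1$. Crystal operators. The reading word $R(T)$ is the concatenation, over the columns from left to right, of the words obtained by reading the extended legs of the cells from top to bottom (the cells from top to bottom, each extended leg from top to bottom) and then all arm entries of the column in weakly increasing order. For $i\ge1$, assign $-$ to each $i$ and $+$ to each $i+1$ in $R(T)$ and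 successively pair and remove adjacent $+-$. If there is no unpaired $-$, then $f_i(T)=0$. Otherwise let $B$ be the entry of the cell of the rightmost unpaired $-$. (M) If the cell above exists, with entry $B^\uparrow$, and contains $i+1$, then remove an $i$ from $A(B)$ and add $i+1$ to $A(B^\uparrow)$; (S) otherwise, if the cell to the right exists, with entry $B^\rightarrow$, and $i\in L^+(B^\rightarrow)$, remove this $i$ and add $i+1$ to $L(B)$; (N) otherwise change this $i$ in $B$ into $i+1$. The result is $f_i(T)$. If there is no unpaired $+$, then $e_i(T)=0$. Otherwise let $B$ be the entry of the cell of the leftmost unpaired $+$. (M) If the cell below exists, with entry $B^\downarrow$, and contains $i$, remove an $i+1$ from $A(B)$ and add $i$ to $A(B^\downarrow)$; (S) otherwise, if the cell to the left exists, with entry $B^\leftarrow$, and $i+1\in L(B^\leftarrow)$, remove this $i+1$ and add $i$ to $L^+(B)$; (N) otherwise change this $i+1$ in $B$ into $i$. The result is $e_i(T)$. Uncrowding. The bumping $\mathcal V_b(T)$ is $T$ if the arm excess is $0$. Otherwise let $c$ be the rightmost column containing a cell with nonempty arm, $(r,c)$ the topmost such cell in it, $a$ its largest arm entry, and $M$ the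 set of leg entries of $(r,c)$ that are $>a$. Let $k$ be the smallest number $\ge a$ in column $c+1$ and $(\tilde r,c+1)$ its cell; if there is none, attach an empty cell $(\tilde r,c+1)$ on top of column $c+1$ and let $k$ be empty. If $\tilde r\ne r$, remove $a$ from the arm of $(r,c)$, replace $k$ by $a$, and add $k$ to the arm of $(\tilde r,c+1)$. If $\tilde r=r$, remove $a$ from the arm and $M$ from the leg of $(r,c)$, insert $M$ into the leg of $(r,c+1)$, replace the hook entry of $(r,c+1)$ by $a$, and add $k$ to its arm. Let $\mathcal V(T)=\mathcal V_b^d(T)$ with $d\ge1$ minimal such that $\mathcal V_b^d(T)$ and $\mathcal V_b^{d-1}(T)$ have different shapes or are equal. For $T$ of shape $\lambda$ with arm excess $\alpha$, put $P_0=T$, let $Q_0$ be the empty filling of $\lambda/\lambda$, and for $0\le j<\alpha$ let $P_{j+1}=\mathcal V(P_j)$ and let $Q_{j+1}$ be $Q_j$ with the cell $\mathrm{shape}(P_{j+1})/\mathrm{shape}(P_j)$ appended and filled with $\tilde c-c$, where $\tilde c$ is the column of this cell and $c$ is the rightmost column of $P_j$ with a nonempty arm. Then $\mathcal U(T)=(P(T),Q(T)):=(P_\alpha,Q_\alpha)$.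 Theorem. Let $T$ be a hook-valued tableau of shape $\lambda$. Then $P(T)$ is a set-valued tableau of some shape $\mu\supseteq\lambda$ and $Q(T)$ is a column-flagged increasing tableau of shape $\mu/\lambda$. Moreover, for every $i\ge 1$: (1) if $f_i(T)\ne0$, then $f_i(T)$ is a hook-valued tableau of shape $\lambda$, $f_i(P(T))=P(f_i(T))$ and $Q(T)=Q(f_i(T))$; (2) if $e_i(T)\ne0$, then $e_i(T)$ is a hook-valued tableau of shape $\lambda$, $e_i(P(T))=P(e_i(T))$ and $Q(T)=Q(e_i(T))$; (3) if $f_i(T)=0$, then $f_i(P(T))=0$; if $e_i(T)=0$, then $e_i(P(T))=0$. In other words, $\mathcal U$ is a map from hook-valued tableaux to pairs (set-valued tableau, column-flagged increasing tableau) that intertwines with the crystal operators. -/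

import Mathlib

/-!
# Hook-valued tableaux, their crystal operators, and the arm-uncrowding map

French notation is used: cell `(r, c)` lies in row `r` and column `c`, both numbered from `0`;
row `r + 1` is directly above row `r`, column `c + 1` is directly to the right of column `c`.
-/

namespace HookValued

/-- A filling of a hook shape. The leg (strictly increasing upwards) is recorded as a finite set,
the arm (weakly increasing to the right) as a multiset. -/
@[ext]
structure Hook where
  /-- the hook entry `H` -/
  corner : ℕ
  /-- the leg `L` -/
  leg : Finset ℕ
  /-- the arm `A` -/
  arm : Multiset ℕ

namespace Hook

instance : Inhabited Hook := ⟨⟨0, ∅, 0⟩⟩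

/-- The extended leg `L⁺`: the leg together with the hook entry. -/
def extLeg (B : Hook) : Finset ℕ := insert B.corner B.leg

/-- All entries, with multiplicity. -/
def entries (B : Hook) : Multiset ℕ := B.corner ::ₘ (B.leg.val + B.arm)

/-- Semistandardness of a hook-shaped tableau with positive integer entries. -/
structure IsSemistandard (B : Hook) : Prop where
  pos : 0 < B.corner
  leg_gt : ∀ x ∈ B.leg, B.corner < x
  arm_ge : ∀ x ∈ B.arm, B.corner ≤ x

/-- The hook with extended leg `s` and arm `A`: its hook entry is the minimum of `s`
(only used for nonempty `s`). -/
def ofExtLeg (s : Finset ℕ) (A : Multiset ℕ) : Hook :=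
  let x := s.min.untopD 0
  ⟨x, s.erase x, A⟩

/-- Remove one `x` from the arm. -/
def removeArm (x : ℕ) (B : Hook) : Hook := { B with arm := B.arm.erase x }

/-- Add one `x` to the arm. -/
def addArm (x : ℕ) (B : Hook) : Hook := { B with arm := x ::ₘ B.arm }

/-- Remove `x` from the extended leg. -/
def removeExtLeg (x : ℕ) (B : Hook) : Hook := ofExtLeg (B.extLeg.erase x) B.arm

/-- Add `x` to the extended leg. -/
def addExtLeg (x : ℕ) (B : Hook) : Hook := ofExtLeg (insert x B.extLeg) B.arm

/-- Add `x` to the leg. -/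
def addLeg (x : ℕ) (B : Hook) : Hook := { B with leg := insert x B.leg }

/-- Replace an entry `x` of the extended leg by `y`. -/
def replaceExtLeg (x y : ℕ) (B : Hook) : Hook :=
  ofExtLeg (insert y (B.extLeg.erase x)) B.arm

/-- Replace one entry `x` of the arm by `y`. -/
def replaceArm (x y : ℕ) (B : Hook) : Hook := { B with arm := y ::ₘ B.arm.erase x }

end Hook

/-- A filling of a Young diagram with hook-shaped fillings. Outside the diagram, the function
`entry` takes a fixed default value, so that equality of fillings is equality of the shapes and
of the entries in all the cells. -/
@[ext]
structure Filling where
  shape : YoungDiagram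
  entry : ℕ → ℕ → Hook
  entry_outside : ∀ r c, (r, c) ∉ shape → entry r c = default

namespace Filling

/-- The filling of `μ` whose entry in each cell `(r, c)` of `μ` is `g r c`. -/
def ofFun (μ : YoungDiagram) (g : ℕ → ℕ → Hook) : Filling where
  shape := μ
  entry r c := if (r, c) ∈ μ then g r c else default
  entry_outside _ _ h := if_neg h

/-- Apply `g` to the entry in the cell `(r, c)`. -/
def modify (T : Filling) (r c : ℕ) (g : Hook → Hook) : Filling :=
  ofFun T.shape fun r' c' => if r' = r ∧ c' = c then g (T.entry r' c') else T.entry r' c'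

/-- Attach a new cell `(r, c)` with entry `B`. The new shape is the smallest Young diagram that
contains the old one and `(r, c)`, which is the old shape and this cell when `(r, c)` is an
addable cell. -/
def attach (T : Filling) (r c : ℕ) (B : Hook) : Filling :=
  ofFun (T.shape ⊔ ⟨Finset.Iic (r, c), by simpa using isLowerSet_Iic (r, c)⟩)
    fun r' c' => if r' = r ∧ c' = c then B else T.entry r' c'

/-- Semistandard hook-valued tableaux. -/
structure IsHVT (T : Filling) : Prop where
  cell : ∀ r c, (r, c) ∈ T.shape → (T.entry r c).IsSemistandard
  row : ∀ r c c', c < c' → (r, c') ∈ T.shape →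
    ∀ x ∈ (T.entry r c).entries, ∀ y ∈ (T.entry r c').entries, x ≤ y
  col : ∀ r r' c, r < r' → (r', c) ∈ T.shape →
    ∀ x ∈ (T.entry r c).entries, ∀ y ∈ (T.entry r' c).entries, x < y

/-- The arm excess: the total number of integers in the arms. -/
def armExcess (T : Filling) : ℕ := ∑ x ∈ T.shape.cells, (T.entry x.1 x.2).arm.card

/-- Set-valued tableaux: hook-valued tableaux with arm excess `0`. -/
def IsSVT (T : Filling) : Prop := T.IsHVT ∧ T.armExcess = 0

/-! ### Crystal operators -/

end Filling

/-- A letter of the reading word, together with the place that it is read from: its cell, and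
whether it lies in the arm or in the extended leg of the entry of this cell. -/
structure Letter where
  val : ℕ
  row : ℕ
  col : ℕ
  inArm : Bool

namespace Filling

/-- Column reading word of column `c`: the extended legs, each read from top to bottom, the cells
being taken from top to bottom, and then all the arm entries of the column in weakly increasing
order. -/
def columnWord (T : Filling) (c : ℕ) : List Letter :=
  ((List.range (T.shape.colLen c)).reverse.flatMap fun r =>
    ((T.entry r c).extLeg.sort (· ≥ ·)).map fun x => ⟨x, r, c, false⟩) ++
  ((List.range (T.shape.colLen c)).flatMap fun r =>
    ((T.entry r c).arm.sort (· ≤ ·)).map fun x =>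
      (⟨x, r, c, true⟩ : Letter)).insertionSort (fun x y => x.val ≤ y.val)

/-- Column reading word: the columns are read from left to right. -/
def readingWord (T : Filling) : List Letter :=
  (List.range (T.shape.rowLen 0)).flatMap T.columnWord

/-- One step of the pairing, read from left to right: `s` is the list of signs that are so far
unpaired, the last one first; a `-` (a letter `i`) that directly follows an unpaired `+`
(a letter `i + 1`) is paired with it, and both are removed. -/
def pairStep (i : ℕ) (s : List Letter) (x : Letter) : List Letter :=
  match s with
  | [] => [x]
  | y :: s' => if y.val = i + 1 ∧ x.val = i then s' else x :: y :: s'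

/-- The word of the unpaired letters `i` and `i + 1` of `w`. -/
def unpaired (i : ℕ) (w : List Letter) : List Letter :=
  ((w.filter fun x => x.val = i ∨ x.val = i + 1).foldl (pairStep i) []).reverse

/-- The crystal operator `f_i`; the value `none` stands for `0`. -/
def f (i : ℕ) (T : Filling) : Option Filling :=
  match ((unpaired i T.readingWord).filter fun x => x.val = i).getLast? with
  | none => none
  | some x =>
    let r := x.row
    let c := x.col
    if (r + 1, c) ∈ T.shape ∧ i + 1 ∈ (T.entry (r + 1) c).entries then
      some ((T.modify r c (Hook.removeArm i)).modify (r + 1) c (Hook.addArm (i + 1)))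
    else if (r, c + 1) ∈ T.shape ∧ i ∈ (T.entry r (c + 1)).extLeg then
      some ((T.modify r (c + 1) (Hook.removeExtLeg i)).modify r c (Hook.addLeg (i + 1)))
    else if x.inArm then
      some (T.modify r c (Hook.replaceArm i (i + 1)))
    else
      some (T.modify r c (Hook.replaceExtLeg i (i + 1)))

/-- The crystal operator `e_i`; the value `none` stands for `0`. -/
def e (i : ℕ) (T : Filling) : Option Filling :=
  match ((unpaired i T.readingWord).filter fun x => x.val = i + 1).head? with
  | none => none
  | some x =>
    let r := x.row
    let c := x.col
    if 0 < r ∧ i ∈ (T.entry (r - 1) c).entries then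
      some ((T.modify r c (Hook.removeArm (i + 1))).modify (r - 1) c (Hook.addArm i))
    else if 0 < c ∧ i + 1 ∈ (T.entry r (c - 1)).leg then
      some ((T.modify r (c - 1) fun B => { B with leg := B.leg.erase (i + 1) }).modify r c
        (Hook.addExtLeg i))
    else if x.inArm then
      some (T.modify r c (Hook.replaceArm (i + 1) i))
    else
      some (T.modify r c (Hook.replaceExtLeg (i + 1) i))

/-! ### The uncrowding map -/

/-- The cells with nonzero arm excess. -/
def armCells (T : Filling) : Finset (ℕ × ℕ) :=
  T.shape.cells.filter fun x => (T.entry x.1 x.2).arm ≠ 0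

/-- The index of the rightmost column that contains a cell with nonzero arm excess. -/
def armCol (T : Filling) : ℕ := T.armCells.sup Prod.snd

/-- The row index of the topmost cell with nonzero arm excess in the column `armCol`. -/
def armRow (T : Filling) : ℕ := (T.armCells.filter fun x => x.2 = T.armCol).sup Prod.fst

/-- The smallest number in column `c` that is at least `a`, if there is one. -/
def smallestGE (T : Filling) (c a : ℕ) : Option ℕ :=
  ((∑ r ∈ Finset.range (T.shape.colLen c),
    (T.entry r c).entries.filter fun x => a ≤ x).sort (· ≤ ·)).head?

/-- The index of the row in which column `c` contains the number `k`. -/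
def rowOf (T : Filling) (c k : ℕ) : ℕ :=
  ((Finset.range (T.shape.colLen c)).filter fun r => k ∈ (T.entry r c).entries).sup id

/-- The uncrowding bumping `𝒱_b`. Here `moved` is `(a, ℓ] ∩ L(r, c)`, where `ℓ` is the largest
leg entry of the cell `(r, c)`. -/
def bump (T : Filling) : Filling :=
  if T.armExcess = 0 then T else
    let c := T.armCol
    let r := T.armRow
    let a := (T.entry r c).arm.sup
    let moved := (T.entry r c).leg.filter fun x => a < x
    match T.smallestGE (c + 1) a with
    | none =>
      let r' := T.shape.colLen (c + 1)
      if r' ≠ r then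
        (T.modify r c (Hook.removeArm a)).attach r' (c + 1) ⟨a, ∅, 0⟩
      else
        (T.modify r c fun B => ⟨B.corner, B.leg \ moved, B.arm.erase a⟩).attach r' (c + 1)
          ⟨a, moved, 0⟩
    | some k =>
      let r' := T.rowOf (c + 1) k
      if r' ≠ r then
        (T.modify r c (Hook.removeArm a)).modify r' (c + 1)
          fun B => (B.replaceExtLeg k a).addArm k
      else
        (T.modify r c fun B => ⟨B.corner, B.leg \ moved, B.arm.erase a⟩).modify r' (c + 1)
          fun B => ⟨a, B.leg ∪ moved, k ::ₘ B.arm⟩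

/-- The uncrowding insertion `𝒱 T = 𝒱_b^d T`, where `d ≥ 1` is minimal such that the `d`-th bumping
changes the shape or does not change the tableau. -/
noncomputable def insertion (T : Filling) : Filling :=
  bump^[sInf {d : ℕ | (bump^[d + 1] T).shape ≠ (bump^[d] T).shape ∨
    bump^[d + 1] T = bump^[d] T} + 1] T

end Filling

/-- A filling of the skew shape `outer / inner` with natural numbers; the function `entry` is `0`
outside the skew shape. -/
@[ext]
structure SkewFilling where
  inner : YoungDiagram
  outer : YoungDiagram
  entry : ℕ → ℕ → ℕ
  entry_outside : ∀ r c, ¬((r, c) ∈ outer ∧ (r, c) ∉ inner) → entry r c = 0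

namespace SkewFilling

/-- The filling of the empty skew shape `μ / μ`. -/
def empty (μ : YoungDiagram) : SkewFilling := ⟨μ, μ, fun _ _ => 0, fun _ _ _ => rfl⟩

/-- Enlarge the outer shape to `μ` and fill each new cell `(r, c)` with `g r c`. -/
def append (Q : SkewFilling) (μ : YoungDiagram) (g : ℕ → ℕ → ℕ) : SkewFilling where
  inner := Q.inner
  outer := μ
  entry r c := if (r, c) ∈ μ ∧ (r, c) ∉ Q.inner then
    (if (r, c) ∈ Q.outer then Q.entry r c else g r c) else 0
  entry_outside _ _ h := if_neg h

/-- Column-flagged increasing tableaux: the rows and the columns strictly increase, the entries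
are positive, and the entries in the `j`-th column (`j` counted from `1`) are at most `j - 1`;
the inner and the outer shape have the same number of rows. -/
structure IsColumnFlaggedIncreasing (Q : SkewFilling) : Prop where
  le : Q.inner ≤ Q.outer
  colLen_zero : Q.inner.colLen 0 = Q.outer.colLen 0
  pos : ∀ r c, (r, c) ∈ Q.outer → (r, c) ∉ Q.inner → 0 < Q.entry r c
  flag : ∀ r c, (r, c) ∈ Q.outer → (r, c) ∉ Q.inner → Q.entry r c ≤ c
  row : ∀ r c c', c < c' → (r, c) ∉ Q.inner → (r, c') ∈ Q.outer → Q.entry r c < Q.entry r c'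
  col : ∀ r r' c, r < r' → (r, c) ∉ Q.inner → (r', c) ∈ Q.outer → Q.entry r c < Q.entry r' c

end SkewFilling

namespace Filling

/-- One step `(P_j, Q_j) ↦ (P_{j+1}, Q_{j+1})` of the uncrowding map: the new cell of
`P_{j+1} = 𝒱 P_j`, in column `c'`, is recorded with the number `c' - c`, where `c` is the
rightmost column of `P_j` with nonzero arm excess. -/
noncomputable def uncrowdStep (X : Filling × SkewFilling) : Filling × SkewFilling :=
  (X.1.insertion, X.2.append X.1.insertion.shape fun _ c' => c' - X.1.armCol)

/-- The uncrowding map `𝒰 T = (P T, Q T)`: as many steps as the arm excess of `T`, starting with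
`T` and the empty recording tableau. -/
noncomputable def uncrowd (T : Filling) : Filling × SkewFilling :=
  uncrowdStep^[T.armExcess] (T, SkewFilling.empty T.shape)

/-- The insertion tableau. -/
noncomputable def P (T : Filling) : Filling := T.uncrowd.1

/-- The recording tableau. -/
noncomputable def Q (T : Filling) : SkewFilling := T.uncrowd.2

end Filling

end HookValued

/-! Crystal side. In the reading word of one column the extended legs form a strictly decreasing
word and the arms a weakly increasing one. After cancellation the column therefore contributes a run
of letters `i` followed by a run of letters `i + 1`, whose lengths `colMinus` and `colPlus` depend
only on multiplicities. The column in which `f i` or `e i` acts is a function of these two sequences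
(`lastMinus`, `firstPlus`), and the cell is then determined, since a value occurs in only one row of
a column. Every rule moves a single entry, from arm to arm or from extended leg to extended leg
(`ArmMove`, `LegMove`); that the letter is unpaired is what keeps the tableau semistandard. Reading
a move backwards shows that `f i` and `e i` are inverse to each other (`IsHVT.e_of_f`,
`IsHVT.f_of_e`), so the commutation has to be proved for `f i` only.

One bumping. It affects two neighbouring columns, and the reduced signature of this pair, taken as
one block, does not change (`BumpResult.signature`). By `lastMinus_block`, vanishing of `f i` is
preserved, and otherwise `f i` selects the same column outside the pair before and after, or a
column of the pair both times. In the pair, a comparison of `i` with the bumped arm entry `a` and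
with the displaced entry `k` leaves a few configurations. The rule used by `f i` may differ before
and after the bumping, but the results agree (`IsHVT.bump_f`). As `f i` is injective and preserves
the shape, the arm excess and the rightmost column with a nonempty arm, the stopping times and the
recorded numbers agree too, and the statement passes to insertions and to the whole uncrowding by
induction.

Recording tableau. An insertion that starts with `a` in column `c` leaves behind a weakly increasing
chain of leg entries `≥ a`, one in each column from `c + 1` to that of the new cell (`Trail`). A
later insertion from the same column starts with an arm entry at most `a`, finds something to
displace in each of these columns, and so ends strictly further to the right (`Inserts.spec`). If
instead the starting column moves to the left, all recorded numbers become smaller than the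
distances to it. Both cases are carried by `UncrowdInvariant`, which gives strict growth along rows
and columns. -/

namespace HookValued

/-! ### Hooks as pairs of an extended leg and an arm -/

namespace Hook

/-- The hook entry is smaller than all leg entries, so that it is determined by the extended
leg. -/
def IsCanon (B : Hook) : Prop := ∀ x ∈ B.leg, B.corner < x

theorem mem_extLeg {B : Hook} {x : ℕ} : x ∈ B.extLeg ↔ x = B.corner ∨ x ∈ B.leg := by
  simp [extLeg]

theorem mem_entries {B : Hook} {x : ℕ} : x ∈ B.entries ↔ x ∈ B.extLeg ∨ x ∈ B.arm := by
  simp [entries, extLeg, or_assoc]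

/-- In a canonical hook the hook entry is the minimum of the extended leg. This permits all
operations to be described through extended legs and arms, without tracking which entry is the
corner. -/
theorem IsCanon.ext {B C : Hook} (hB : B.IsCanon) (hC : C.IsCanon) (h : B.extLeg = C.extLeg)
    (h' : B.arm = C.arm) : B = C := by
  have h1 : ∀ x, (x = B.corner ∨ x ∈ B.leg) ↔ (x = C.corner ∨ x ∈ C.leg) := fun x => by
    rw [← mem_extLeg, ← mem_extLeg, h]
  have hc : B.corner = C.corner := by
    rcases (h1 B.corner).1 (Or.inl rfl) with h2 | h2
    · exact h2
    · rcases (h1 C.corner).2 (Or.inl rfl) with h3 | h3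
      · exact h3.symm
      · exact absurd (hB _ h3) (not_lt.2 (hC _ h2).le)
  refine Hook.ext hc ?_ h'
  ext x
  have h2 := h1 x
  have h3 := hB x
  have h4 := hC x
  grind

theorem extLeg_ofExtLeg {s : Finset ℕ} (hs : s.Nonempty) (A : Multiset ℕ) :
    (ofExtLeg s A).extLeg = s := by
  have : s.min.untopD 0 = s.min' hs := by
    rw [← Finset.coe_min' hs]; rfl
  simp only [ofExtLeg, extLeg, this]
  exact Finset.insert_erase (Finset.min'_mem s hs)

theorem isCanon_ofExtLeg {s : Finset ℕ} (hs : s.Nonempty) (A : Multiset ℕ) :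
    (ofExtLeg s A).IsCanon := by
  have : s.min.untopD 0 = s.min' hs := by
    rw [← Finset.coe_min' hs]; rfl
  intro x hx
  simp only [ofExtLeg, this, Finset.mem_erase] at hx ⊢
  exact lt_of_le_of_ne (Finset.min'_le _ _ hx.2) (Ne.symm hx.1)

@[simp] theorem arm_ofExtLeg (s : Finset ℕ) (A : Multiset ℕ) : (ofExtLeg s A).arm = A := rfl

end Hook

/-! ### Entrywise description of fillings, and local inequalities -/

namespace Filling

/-- `x` belongs to the extended leg in the cell `(r, c)`. -/
def InLeg (T : Filling) (r c x : ℕ) : Prop := (r, c) ∈ T.shape ∧ x ∈ (T.entry r c).extLeg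

/-- The multiplicity of `x` in the arm in the cell `(r, c)`. -/
def armCount (T : Filling) (r c x : ℕ) : ℕ := (T.entry r c).arm.count x

/-- `x` is an entry of the cell `(r, c)`. -/
def In (T : Filling) (r c x : ℕ) : Prop := T.InLeg r c x ∨ 0 < T.armCount r c x

/-- All the hook entries are determined by the extended legs. -/
def IsCanon (T : Filling) : Prop := ∀ r c, (r, c) ∈ T.shape → (T.entry r c).IsCanon

/-- The inequalities that define a hook-valued tableau, for neighbouring cells only. -/
structure IsLocal (T : Filling) : Prop where
  pos : ∀ r c x, T.InLeg r c x → 0 < x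
  arm : ∀ r c x, 0 < T.armCount r c x → ∃ y, T.InLeg r c y ∧ y ≤ x
  row : ∀ r c x y, T.In r c x → T.InLeg r (c + 1) y → x ≤ y
  col : ∀ r c x y, T.In r c x → T.InLeg (r + 1) c y → x < y

theorem InLeg.mem {T : Filling} {r c x : ℕ} (h : T.InLeg r c x) : (r, c) ∈ T.shape := h.1

theorem mem_of_armCount {T : Filling} {r c x : ℕ} (h : 0 < T.armCount r c x) :
    (r, c) ∈ T.shape := by
  by_contra h'
  simp [armCount, T.entry_outside r c h', default] at h

theorem In.mem {T : Filling} {r c x : ℕ} (h : T.In r c x) : (r, c) ∈ T.shape :=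
  h.elim InLeg.mem mem_of_armCount

theorem InLeg.inn {T : Filling} {r c x : ℕ} (h : T.InLeg r c x) : T.In r c x := Or.inl h

theorem exists_inLeg {T : Filling} {r c : ℕ} (h : (r, c) ∈ T.shape) : ∃ x, T.InLeg r c x :=
  ⟨(T.entry r c).corner, h, by simp [Hook.extLeg]⟩

theorem in_iff {T : Filling} {r c x : ℕ} (h : (r, c) ∈ T.shape) :
    T.In r c x ↔ x ∈ (T.entry r c).entries := by
  simp [In, InLeg, armCount, Hook.mem_entries, h, Multiset.count_pos]

theorem in_iff' {T : Filling} {r c x : ℕ} :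
    T.In r c x ↔ (r, c) ∈ T.shape ∧ x ∈ (T.entry r c).entries :=
  ⟨fun h => ⟨h.mem, (in_iff h.mem).1 h⟩, fun h => (in_iff h.1).2 h.2⟩

theorem IsHVT.row_le {T : Filling} (hT : T.IsHVT) {r c c' x y : ℕ} (h : c < c')
    (hx : T.In r c x) (hy : T.In r c' y) : x ≤ y :=
  hT.row r c c' h hy.mem x ((in_iff hx.mem).1 hx) y ((in_iff hy.mem).1 hy)

theorem IsHVT.col_lt {T : Filling} (hT : T.IsHVT) {r r' c x y : ℕ} (h : r < r')
    (hx : T.In r c x) (hy : T.In r' c y) : x < y :=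
  hT.col r r' c h hy.mem x ((in_iff hx.mem).1 hx) y ((in_iff hy.mem).1 hy)

theorem IsHVT.row_eq {T : Filling} (hT : T.IsHVT) {r r' c x : ℕ}
    (hx : T.In r c x) (hy : T.In r' c x) : r = r' := by
  rcases lt_trichotomy r r' with h | h | h
  · exact absurd (hT.col_lt h hx hy) (lt_irrefl _)
  · exact h
  · exact absurd (hT.col_lt h hy hx) (lt_irrefl _)

theorem IsHVT.isCanon {T : Filling} (hT : T.IsHVT) : T.IsCanon :=
  fun r c h => (hT.cell r c h).leg_gt

theorem IsHVT.exists_le {T : Filling} (hT : T.IsHVT) {r c : ℕ} (h : (r, c) ∈ T.shape) :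
    ∃ y, T.InLeg r c y ∧ ∀ x, T.In r c x → y ≤ x := by
  refine ⟨(T.entry r c).corner, ⟨h, by simp [Hook.extLeg]⟩, fun x hx => ?_⟩
  rw [in_iff h, Hook.mem_entries, Hook.mem_extLeg] at hx
  rcases hx with (rfl | hx) | hx
  · exact le_rfl
  · exact ((hT.cell r c h).leg_gt x hx).le
  · exact (hT.cell r c h).arm_ge x hx

theorem IsHVT.isLocal {T : Filling} (hT : T.IsHVT) : T.IsLocal where
  pos r c x h := by
    rcases Hook.mem_extLeg.1 h.2 with rfl | h'
    · exact (hT.cell r c h.1).pos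
    · exact (hT.cell r c h.1).pos.trans ((hT.cell r c h.1).leg_gt x h')
  arm r c x h := by
    obtain ⟨y, hy, hy'⟩ := hT.exists_le (mem_of_armCount h)
    exact ⟨y, hy, hy' x (Or.inr h)⟩
  row r c x y hx hy := hT.row_le (Nat.lt_succ_self c) hx hy.inn
  col r c x y hx hy := hT.col_lt (Nat.lt_succ_self r) hx hy.inn

/-- Distant cells are compared through the cells in between, which are nonempty and belong to the
diagram. It suffices to bound extended legs from below, because each arm entry lies above some
extended leg entry of its own cell. -/
theorem IsLocal.isHVT {T : Filling} (h : T.IsLocal) (hc : T.IsCanon) : T.IsHVT := by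
  have hmin : ∀ {r c y}, T.In r c y → ∃ z, T.InLeg r c z ∧ z ≤ y := by
    intro r c y hy
    rcases hy with hy | hy
    · exact ⟨y, hy, le_rfl⟩
    · exact h.arm r c y hy
  refine ⟨fun r c hm => ⟨h.pos r c _ ⟨hm, by simp [Hook.extLeg]⟩, hc r c hm, fun x hx => ?_⟩,
    ?_, ?_⟩
  · obtain ⟨y, hy, hyx⟩ := h.arm r c x (Multiset.count_pos.2 hx)
    rcases Hook.mem_extLeg.1 hy.2 with rfl | h'
    · exact hyx
    · exact (hc r c hm y h').le.trans hyx
  · intro r c c' hcc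
    obtain ⟨d, rfl⟩ := Nat.exists_eq_add_of_lt hcc
    intro hm x hx y hy
    have hx' : T.In r c x := (in_iff (T.shape.up_left_mem le_rfl (by omega) hm)).2 hx
    replace hy : T.In r (c + d + 1) y := (in_iff hm).2 hy
    clear hcc hx
    induction d generalizing y with
    | zero =>
      obtain ⟨z, hz, hzy⟩ := hmin hy
      exact (h.row r c x z hx' hz).trans hzy
    | succ d ih =>
      obtain ⟨z, hz, hzy⟩ := hmin hy
      have hm' : (r, c + d + 1) ∈ T.shape := T.shape.up_left_mem le_rfl (by omega) hm
      obtain ⟨w, hw⟩ := exists_inLeg hm'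
      exact ((ih hm' w hw.inn).trans (h.row _ _ _ _ hw.inn hz)).trans hzy
  · intro r r' c hcc
    obtain ⟨d, rfl⟩ := Nat.exists_eq_add_of_lt hcc
    intro hm x hx y hy
    have hx' : T.In r c x := (in_iff (T.shape.up_left_mem (by omega) le_rfl hm)).2 hx
    replace hy : T.In (r + d + 1) c y := (in_iff hm).2 hy
    clear hcc hx
    induction d generalizing y with
    | zero =>
      obtain ⟨z, hz, hzy⟩ := hmin hy
      exact (h.col r c x z hx' hz).trans_le hzy
    | succ d ih =>
      obtain ⟨z, hz, hzy⟩ := hmin hy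
      have hm' : (r + d + 1, c) ∈ T.shape := T.shape.up_left_mem (by omega) le_rfl hm
      obtain ⟨w, hw⟩ := exists_inLeg hm'
      exact ((ih hm' w hw.inn).trans (h.col _ _ _ _ hw.inn hz)).trans_le hzy

/-- Two fillings with canonical hooks agree if they have the same extended legs and arms. -/
theorem IsCanon.ext {T T' : Filling} (h : T.IsCanon) (h' : T'.IsCanon) (hs : T.shape = T'.shape)
    (hE : ∀ r c x, T.InLeg r c x ↔ T'.InLeg r c x)
    (hA : ∀ r c x, T.armCount r c x = T'.armCount r c x) : T = T' := by
  refine Filling.ext hs ?_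
  funext r c
  by_cases hm : (r, c) ∈ T.shape
  · have hm' : (r, c) ∈ T'.shape := hs ▸ hm
    refine (h r c hm).ext (h' r c hm') ?_ (Multiset.ext.2 (hA r c))
    ext x
    have := hE r c x
    simpa [InLeg, hm, hm'] using this
  · rw [T.entry_outside r c hm, T'.entry_outside r c (hs ▸ hm)]

@[simp] theorem shape_modify (T : Filling) (r c : ℕ) (g : Hook → Hook) :
    (T.modify r c g).shape = T.shape := rfl

theorem entry_modify_self {T : Filling} {r c : ℕ} (h : (r, c) ∈ T.shape) (g : Hook → Hook) :
    (T.modify r c g).entry r c = g (T.entry r c) := by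
  simp [modify, ofFun, h]

theorem entry_modify_of_ne {T : Filling} {r c r' c' : ℕ} (g : Hook → Hook)
    (h : ¬(r' = r ∧ c' = c)) : (T.modify r c g).entry r' c' = T.entry r' c' := by
  by_cases hm : (r', c') ∈ T.shape
  · simp [modify, ofFun, h, hm]
  · simp [modify, ofFun, hm, T.entry_outside r' c' hm]

theorem IsCanon.modify {T : Filling} (hT : T.IsCanon) {r c : ℕ} {g : Hook → Hook}
    (h : (r, c) ∈ T.shape → (g (T.entry r c)).IsCanon) : (T.modify r c g).IsCanon := by
  intro r' c' hm
  by_cases h' : r' = r ∧ c' = c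
  · obtain ⟨rfl, rfl⟩ := h'
    rw [shape_modify] at hm
    rw [entry_modify_self hm]
    exact h hm
  · rw [entry_modify_of_ne g h']
    exact hT r' c' hm

theorem inLeg_modify {T : Filling} {r c : ℕ} {g : Hook → Hook} (r' c' x : ℕ) :
    (T.modify r c g).InLeg r' c' x ↔
      if r' = r ∧ c' = c then (r, c) ∈ T.shape ∧ x ∈ (g (T.entry r c)).extLeg
      else T.InLeg r' c' x := by
  split_ifs with h
  · obtain ⟨rfl, rfl⟩ := h
    rw [InLeg, shape_modify]
    exact and_congr_right fun hm => by rw [entry_modify_self hm]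
  · rw [InLeg, InLeg, shape_modify, entry_modify_of_ne g h]

theorem armCount_modify {T : Filling} {r c : ℕ} {g : Hook → Hook} (hm : (r, c) ∈ T.shape)
    (r' c' x : ℕ) :
    (T.modify r c g).armCount r' c' x =
      if r' = r ∧ c' = c then (g (T.entry r c)).arm.count x else T.armCount r' c' x := by
  split_ifs with h
  · obtain ⟨rfl, rfl⟩ := h
    rw [armCount, entry_modify_self hm]
  · rw [armCount, armCount, entry_modify_of_ne g h]

/-! ### Signatures of words and of concatenations -/

/-- One step of the pairing, where the unpaired letters `i` and the unpaired letters `i + 1` are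
kept in two separate lists. -/
def signStep (i : ℕ) (s : List Letter × List Letter) (x : Letter) : List Letter × List Letter :=
  if x.val = i then
    if s.2 = [] then (s.1 ++ [x], []) else (s.1, s.2.dropLast)
  else if x.val = i + 1 then (s.1, s.2 ++ [x]) else s

/-- The unpaired letters `i` and the unpaired letters `i + 1` of a word. -/
def signs (i : ℕ) (w : List Letter) : List Letter × List Letter := w.foldl (signStep i) ([], [])

theorem signs_concat (i : ℕ) (w : List Letter) (x : Letter) :
    signs i (w ++ [x]) = signStep i (signs i w) x := by
  simp [signs]

theorem signs_val (i : ℕ) (w : List Letter) :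
    (∀ x ∈ (signs i w).1, x.val = i ∧ x ∈ w) ∧ ∀ x ∈ (signs i w).2, x.val = i + 1 ∧ x ∈ w := by
  induction w using List.reverseRecOn with
  | nil => simp [signs]
  | append_singleton w x ih =>
    rw [signs_concat]
    unfold signStep
    have h3 : ∀ y ∈ (signs i w).2.dropLast, y ∈ (signs i w).2 := fun y => List.mem_of_mem_dropLast
    split_ifs <;> simp <;> grind

/-- No unpaired `i + 1` ever precedes an unpaired `i`, so the stack of unpaired signs always splits
into minuses followed by pluses; a new minus cancels the last plus if there is one. -/
theorem unpaired_eq (i : ℕ) (w : List Letter) :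
    unpaired i w = (signs i w).1 ++ (signs i w).2 := by
  induction w using List.reverseRecOn with
  | nil => simp [signs, unpaired]
  | append_singleton w x ih =>
    rw [signs_concat]
    have hv := signs_val i w
    simp only [unpaired] at ih ⊢
    rw [List.filter_append, List.foldl_append]
    generalize List.foldl (pairStep i) [] (List.filter _ w) = s at ih ⊢
    obtain rfl : s = ((signs i w).1 ++ (signs i w).2).reverse := by rw [← ih, List.reverse_reverse]
    generalize signs i w = t at hv ih
    obtain ⟨M, P⟩ := t
    unfold signStep
    by_cases h1 : x.val = i
    · rcases List.eq_nil_or_concat' P with rfl | ⟨P', y, rfl⟩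
      · rcases List.eq_nil_or_concat' M with rfl | ⟨M', y, rfl⟩
        · simp [h1, pairStep]
        · have := hv.1 y (by simp)
          simp [h1, pairStep, this]
      · have := hv.2 y (by simp)
        simp [h1, pairStep, this]
    · by_cases h2 : x.val = i + 1
      · generalize hs : M ++ P = s
        rcases List.eq_nil_or_concat' s with rfl | ⟨s', y, rfl⟩
        · simp at hs
          simp [h2, pairStep, hs]
        · simp [h2, pairStep, ← List.append_assoc, hs]
      · simp [h1, h2]

theorem filter_minus (i : ℕ) (w : List Letter) :
    (unpaired i w).filter (fun x => x.val = i) = (signs i w).1 := by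
  rw [unpaired_eq, List.filter_append, List.filter_eq_self.2, List.filter_eq_nil_iff.2,
    List.append_nil]
  · intro x hx
    simp [((signs_val i w).2 x hx).1]
  · intro x hx
    simp [((signs_val i w).1 x hx).1]

theorem filter_plus (i : ℕ) (w : List Letter) :
    (unpaired i w).filter (fun x => x.val = i + 1) = (signs i w).2 := by
  rw [unpaired_eq, List.filter_append, List.filter_eq_nil_iff.2, List.filter_eq_self.2,
    List.nil_append]
  · intro x hx
    simp [((signs_val i w).2 x hx).1]
  · intro x hx
    simp [((signs_val i w).1 x hx).1]

/-- Only the pluses of `v` and the minuses of `w` face each other: the first minuses of `w` cancel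
the last pluses of `v`, as many as there are on the shorter side. -/
theorem signs_append (i : ℕ) (v w : List Letter) :
    signs i (v ++ w) =
      ((signs i v).1 ++ (signs i w).1.drop (signs i v).2.length,
        (signs i v).2.take ((signs i v).2.length - (signs i w).1.length) ++ (signs i w).2) := by
  induction w using List.reverseRecOn with
  | nil => simp [signs]
  | append_singleton w x ih =>
    rw [← List.append_assoc, signs_concat, signs_concat, ih]
    generalize signs i v = s
    generalize signs i w = t
    obtain ⟨M, P⟩ := s
    obtain ⟨M', P'⟩ := t
    unfold signStep
    by_cases h1 : x.val = i
    · rcases List.eq_nil_or_concat' P' with rfl | ⟨P', y, rfl⟩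
      · simp only [h1, if_true, List.append_nil, List.length_append, List.length_cons,
          List.length_nil, zero_add]
        by_cases h3 : P.length ≤ M'.length
        · rw [Nat.sub_eq_zero_of_le h3, Nat.sub_eq_zero_of_le (by omega)]
          simp [List.drop_append_of_le_length h3]
        · have h4 : P.take (P.length - M'.length) ≠ [] := by
            intro h
            have := congrArg List.length h
            simp at this
            omega
          rw [if_neg h4, List.dropLast_eq_take, List.take_take, List.drop_eq_nil_of_le (by omega),
            List.drop_eq_nil_of_le (by simp; omega)]
          simp only [List.length_take, List.append_nil, Prod.mk.injEq, true_and]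
          congr 1
          omega
      · simp [h1, ← List.append_assoc]
    · by_cases h2 : x.val = i + 1
      · simp [h2]
      · simp [h1, h2]

theorem length_signs_append (i : ℕ) (v w : List Letter) :
    (signs i (v ++ w)).2.length =
      (signs i v).2.length - (signs i w).1.length + (signs i w).2.length := by
  rw [signs_append]
  simp

theorem getLast?_signs_append (i : ℕ) (v w : List Letter) :
    (signs i (v ++ w)).1.getLast? =
      if (signs i v).2.length < (signs i w).1.length then (signs i w).1.getLast?
      else (signs i v).1.getLast? := by
  rw [signs_append]
  split_ifs with h
  · simp only
    rw [List.getLast?_append_of_ne_nil, List.getLast?_drop, if_neg (by omega)]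
    intro h'
    have := congrArg List.length h'
    simp at this
    omega
  · rw [List.drop_eq_nil_of_le (by omega), List.append_nil]

theorem head?_signs_append (i : ℕ) (v w : List Letter) :
    (signs i (v ++ w)).2.head? =
      if (signs i w).1.length < (signs i v).2.length then (signs i v).2.head?
      else (signs i w).2.head? := by
  rw [signs_append]
  split_ifs with h
  · simp only [List.head?_append, List.head?_take]
    rw [if_neg (by omega)]
    cases h' : (signs i v).2 with
    | nil => simp [h'] at h
    | cons y s => simp
  · rw [Nat.sub_eq_zero_of_le (by omega)]
    simp

/-! ### The signature rule for a sequence of columns -/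

/-- The number of unpaired letters `i + 1` after the first `n` columns, where column `j`
contributes `p j` unpaired letters `i` followed by `q j` unpaired letters `i + 1`. -/
def plusCount (p q : ℕ → ℕ) : ℕ → ℕ
  | 0 => 0
  | n + 1 => plusCount p q n - p n + q n

/-- The column of the rightmost unpaired letter `i` in the first `n` columns. -/
def lastMinus (p q : ℕ → ℕ) : ℕ → Option ℕ
  | 0 => none
  | n + 1 => if plusCount p q n < p n then some n else lastMinus p q n

/-- The column of the leftmost unpaired letter `i + 1` in the first `n` columns. -/
def firstPlus (p q : ℕ → ℕ) : ℕ → Option ℕ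
  | 0 => none
  | n + 1 => if p n < plusCount p q n then firstPlus p q n else if 0 < q n then some n else none

theorem plusCount_succ (p q : ℕ → ℕ) (n : ℕ) :
    plusCount p q (n + 1) = plusCount p q n - p n + q n := rfl

theorem lastMinus_succ (p q : ℕ → ℕ) (n : ℕ) : lastMinus p q (n + 1) =
    if plusCount p q n < p n then some n else lastMinus p q n := rfl

theorem firstPlus_succ (p q : ℕ → ℕ) (n : ℕ) : firstPlus p q (n + 1) =
    if p n < plusCount p q n then firstPlus p q n else if 0 < q n then some n else none := rfl

theorem lastMinus_eq_some {p q : ℕ → ℕ} {n c : ℕ} :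
    lastMinus p q n = some c ↔ c < n ∧ plusCount p q c < p c ∧
      ∀ j, c < j → j < n → p j ≤ plusCount p q j := by
  induction n with
  | zero => simp [lastMinus]
  | succ n ih =>
    simp only [lastMinus]
    split_ifs with h
    · simp only [Option.some.injEq]
      constructor
      · rintro rfl
        exact ⟨by omega, h, fun j h1 h2 => by omega⟩
      · rintro ⟨h1, h2, h3⟩
        by_contra hne
        have := h3 n (by omega) (by omega)
        omega
    · rw [ih]
      constructor
      · rintro ⟨h1, h2, h3⟩
        refine ⟨by omega, h2, fun j h4 h5 => ?_⟩
        by_cases hj : j = n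
        · subst hj; omega
        · exact h3 j h4 (by omega)
      · rintro ⟨h1, h2, h3⟩
        have : c ≠ n := by rintro rfl; omega
        exact ⟨by omega, h2, fun j h4 h5 => h3 j h4 (by omega)⟩

theorem firstPlus_eq_some {p q : ℕ → ℕ} {n c : ℕ} :
    firstPlus p q n = some c ↔ c < n ∧ plusCount p q c ≤ p c ∧ 0 < q c ∧
      ∀ j, c < j → j < n → p j < plusCount p q j := by
  induction n with
  | zero => simp [firstPlus]
  | succ n ih =>
    simp only [firstPlus]
    split_ifs with h h'
    · rw [ih]
      constructor
      · rintro ⟨h1, h2, h0, h3⟩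
        refine ⟨by omega, h2, h0, fun j h4 h5 => ?_⟩
        by_cases hj : j = n
        · subst hj; omega
        · exact h3 j h4 (by omega)
      · rintro ⟨h1, h2, h0, h3⟩
        have : c ≠ n := by rintro rfl; omega
        exact ⟨by omega, h2, h0, fun j h4 h5 => h3 j h4 (by omega)⟩
    · simp only [Option.some.injEq]
      constructor
      · rintro rfl
        exact ⟨by omega, by omega, h', fun j h1 h2 => by omega⟩
      · rintro ⟨h1, h2, h0, h3⟩
        by_contra hne
        have := h3 n (by omega) (by omega)
        omega
    · constructor
      · simp
      · rintro ⟨h1, h2, h0, h3⟩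
        by_cases hj : c = n
        · subst hj; omega
        · have := h3 n (by omega) (by omega)
          omega

/-- Vanishing of `e i` is thereby a statement about the final count of pluses alone, a quantity that
`lastMinus_block` shows to be preserved. -/
theorem firstPlus_eq_none {p q : ℕ → ℕ} {n : ℕ} :
    firstPlus p q n = none ↔ plusCount p q n = 0 := by
  induction n with
  | zero => simp [firstPlus, plusCount]
  | succ n ih =>
    simp only [firstPlus, plusCount]
    split_ifs with h h'
    · rw [ih]; omega
    · simp; omega
    · simp; omega

theorem plusCount_congr {p q p' q' : ℕ → ℕ} {n : ℕ} (hp : ∀ j < n, p j = p' j)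
    (hq : ∀ j < n, q j = q' j) : plusCount p q n = plusCount p' q' n := by
  induction n with
  | zero => rfl
  | succ n ih =>
    simp only [plusCount]
    rw [ih (fun j hj => hp j (by omega)) (fun j hj => hq j (by omega)), hp n (by omega),
      hq n (by omega)]

/-- Replacing two neighbouring columns by two columns with the same combined signature does not
change the selection of a column, up to the choice among the two columns. -/
theorem lastMinus_block {p q p' q' : ℕ → ℕ} {c n : ℕ} (hn : c + 2 ≤ n)
    (hp : ∀ j, j ≠ c → j ≠ c + 1 → p j = p' j) (hq : ∀ j, j ≠ c → j ≠ c + 1 → q j = q' j)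
    (hP : p c + (p (c + 1) - q c) = p' c + (p' (c + 1) - q' c))
    (hQ : q (c + 1) + (q c - p (c + 1)) = q' (c + 1) + (q' c - p' (c + 1))) :
    plusCount p q n = plusCount p' q' n ∧
    ((lastMinus p q n = none ∧ lastMinus p' q' n = none) ∨
      (∃ j, j ≠ c ∧ j ≠ c + 1 ∧ lastMinus p q n = some j ∧ lastMinus p' q' n = some j) ∨
      (lastMinus p q n = some (if q c < p (c + 1) then c + 1 else c) ∧
        lastMinus p' q' n = some (if q' c < p' (c + 1) then c + 1 else c))) := by
  -- The induction is on the number `d` of columns to the right of the block; the base case treats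
  -- the block itself.
  obtain ⟨d, rfl⟩ := Nat.exists_eq_add_of_le hn
  clear hn
  induction d with
  | zero =>
    have h1 : plusCount p q c = plusCount p' q' c :=
      plusCount_congr (fun j hj => hp j (by omega) (by omega))
        (fun j hj => hq j (by omega) (by omega))
    have h2 : lastMinus p q c = lastMinus p' q' c := by
      have : ∀ m ≤ c, lastMinus p q m = lastMinus p' q' m := by
        intro m hm
        induction m with
        | zero => rfl
        | succ m ih =>
          simp only [lastMinus]
          rw [ih (by omega), hp m (by omega) (by omega),
            plusCount_congr (fun j hj => hp j (by omega) (by omega))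
              (fun j hj => hq j (by omega) (by omega))]
      exact this c le_rfl
    have h3 : ∀ j, lastMinus p' q' c = some j → j < c := fun j hj => (lastMinus_eq_some.1 hj).1
    have s1 := plusCount_succ p q c
    have s2 := plusCount_succ p' q' c
    have s3 := plusCount_succ p q (c + 1)
    have s4 := plusCount_succ p' q' (c + 1)
    rw [show c + 2 + 0 = c + 1 + 1 from rfl, lastMinus_succ, lastMinus_succ, lastMinus_succ,
      lastMinus_succ, h2]
    refine ⟨by omega, ?_⟩
    generalize plusCount p' q' c = Q at *
    cases hl : lastMinus p' q' c with
    | none =>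
      -- `Q` pluses arrive from the left, and the block as a whole presents `p c + (p (c + 1) - q
      -- c)` minuses. The selected column lies in the block exactly if a minus is left over.
      by_cases hb : Q < p c + (p (c + 1) - q c)
      · right; right
        constructor
        · split_ifs <;> first | rfl | omega
        · split_ifs <;> first | rfl | omega
      · left
        constructor
        · rw [if_neg (by omega), if_neg (by omega)]
        · rw [if_neg (by omega), if_neg (by omega)]
    | some j =>
      have := h3 j hl
      by_cases hb : Q < p c + (p (c + 1) - q c)
      · right; right
        constructor
        · split_ifs <;> first | rfl | omega
        · split_ifs <;> first | rfl | omega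
      · right; left
        refine ⟨j, by omega, by omega, ?_, ?_⟩
        · rw [if_neg (by omega), if_neg (by omega)]
        · rw [if_neg (by omega), if_neg (by omega)]
  | succ d ih =>
    rw [show c + 2 + (d + 1) = c + 2 + d + 1 by ring]
    rw [plusCount_succ, plusCount_succ, lastMinus_succ, lastMinus_succ]
    rw [ih.1, hp (c + 2 + d) (by omega) (by omega), hq (c + 2 + d) (by omega) (by omega)]
    refine ⟨rfl, ?_⟩
    by_cases h : plusCount p' q' (c + 2 + d) < p' (c + 2 + d)
    · rw [if_pos h, if_pos h]
      exact Or.inr (Or.inl ⟨c + 2 + d, by omega, by omega, rfl, rfl⟩)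
    · rw [if_neg h, if_neg h]
      exact ih.2

/-! ### The signature of a column reading word -/

theorem length_filter_le_one {w : List Letter} (hw : w.Pairwise fun x y => y.val < x.val) (v : ℕ) :
    (w.filter fun x => x.val = v).length ≤ 1 := by
  have h := hw.filter (fun x => decide (x.val = v))
  have h' : ∀ x ∈ w.filter (fun x => decide (x.val = v)), x.val = v := by simp
  generalize w.filter (fun x => decide (x.val = v)) = l at h h'
  match l with
  | [] => simp
  | [_] => simp
  | x :: y :: l =>
    have h1 := h' x (by simp)
    have h2 := h' y (by simp)
    simp only [List.pairwise_cons, List.mem_cons, forall_eq_or_imp] at h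
    omega

/-- Each of the letters `i` and `i + 1` occurs at most once, and `i + 1` comes first, so they cancel
if both occur. -/
theorem signs_of_pairwise_gt (i : ℕ) {w : List Letter}
    (hw : w.Pairwise fun x y => y.val < x.val) :
    signs i w =
      (if ∃ y ∈ w, y.val = i + 1 then [] else w.filter fun x => x.val = i,
       if ∃ y ∈ w, y.val = i then [] else w.filter fun x => x.val = i + 1) := by
  induction w using List.reverseRecOn with
  | nil => simp [signs]
  | append_singleton w x ih =>
    have h1 := length_filter_le_one (List.pairwise_append.1 hw).1 (i + 1)
    have hx : ∀ y ∈ w, x.val < y.val := by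
      have := (List.pairwise_append.1 hw).2.2
      simpa using this
    rw [signs_concat, ih (List.pairwise_append.1 hw).1]
    unfold signStep
    by_cases h2 : x.val = i
    · have h3 : ¬∃ y ∈ w, y.val = i := by
        rintro ⟨y, hy, hy'⟩
        have := hx y hy
        omega
      have h4 : w.filter (fun x => decide (x.val = i)) = [] := by
        rw [List.filter_eq_nil_iff]
        intro y hy
        simpa using fun h => h3 ⟨y, hy, h⟩
      by_cases h5 : ∃ y ∈ w, y.val = i + 1
      · have h6 : w.filter (fun x => decide (x.val = i + 1)) ≠ [] := by
          obtain ⟨y, hy, hy'⟩ := h5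
          exact List.ne_nil_of_mem (List.mem_filter.2 ⟨hy, by simpa using hy'⟩)
        have h7 : (w.filter (fun x => decide (x.val = i + 1))).dropLast = [] := by
          rw [← List.length_eq_zero_iff, List.length_dropLast]
          omega
        have h8 : ∃ y ∈ w ++ [x], y.val = i + 1 := by
          obtain ⟨y, hy, hy'⟩ := h5
          exact ⟨y, by simp [hy], hy'⟩
        rw [if_pos h2, if_pos h5, if_neg h3, if_neg h6, if_pos h8,
          if_pos ⟨x, by simp, h2⟩, h7]
      · have h6 : w.filter (fun x => decide (x.val = i + 1)) = [] := by
          rw [List.filter_eq_nil_iff]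
          intro y hy
          simpa using fun h => h5 ⟨y, hy, h⟩
        have h8 : ¬∃ y ∈ w ++ [x], y.val = i + 1 := by
          rintro ⟨y, hy, hy'⟩
          rcases List.mem_append.1 hy with hy | hy
          · exact h5 ⟨y, hy, hy'⟩
          · simp at hy; subst hy; omega
        rw [if_pos h2, if_neg h5, if_neg h3, h4, h6, if_pos rfl, if_neg h8,
          if_pos ⟨x, by simp, h2⟩, List.filter_append, h4]
        simp [h2]
    · by_cases h2' : x.val = i + 1
      · have h3 : ¬∃ y ∈ w, y.val = i + 1 := by
          rintro ⟨y, hy, hy'⟩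
          have := hx y hy
          omega
        have h3' : ¬∃ y ∈ w, y.val = i := by
          rintro ⟨y, hy, hy'⟩
          have := hx y hy
          omega
        have h4 : w.filter (fun x => decide (x.val = i)) = [] := by
          rw [List.filter_eq_nil_iff]
          intro y hy
          simpa using fun h => h3' ⟨y, hy, h⟩
        have h8 : ¬∃ y ∈ w ++ [x], y.val = i := by
          rintro ⟨y, hy, hy'⟩
          rcases List.mem_append.1 hy with hy | hy
          · exact h3' ⟨y, hy, hy'⟩
          · simp at hy; subst hy; omega
        rw [if_neg h2, if_pos h2', if_neg h3, if_neg h3', if_pos ⟨x, by simp, h2'⟩, if_neg h8, h4,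
          List.filter_append]
        simp [h2']
      · simp [h2, h2', or_and_right, exists_or]

/-- All letters `i` precede all letters `i + 1`, so nothing pairs. -/
theorem signs_of_pairwise_le (i : ℕ) {w : List Letter}
    (hw : w.Pairwise fun x y => x.val ≤ y.val) :
    signs i w = (w.filter fun x => x.val = i, w.filter fun x => x.val = i + 1) := by
  induction w using List.reverseRecOn with
  | nil => simp [signs]
  | append_singleton w x ih =>
    have hx : ∀ y ∈ w, y.val ≤ x.val := by
      have := (List.pairwise_append.1 hw).2.2
      simpa using this
    rw [signs_concat, ih (List.pairwise_append.1 hw).1]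
    unfold signStep
    by_cases h2 : x.val = i
    · have h6 : w.filter (fun x => decide (x.val = i + 1)) = [] := by
        rw [List.filter_eq_nil_iff]
        intro y hy
        have := hx y hy
        simp; omega
      rw [if_pos h2, if_pos h6, List.filter_append, List.filter_append, h6]
      simp [h2]
    · by_cases h2' : x.val = i + 1
      · simp [h2']
      · simp [h2, h2']

open Classical in
/-- `1` if `x` lies in an extended leg in column `c`, and `0` otherwise. -/
noncomputable def legCount (T : Filling) (c x : ℕ) : ℕ := if ∃ r, T.InLeg r c x then 1 else 0

/-- The number of times that `x` lies in an arm in column `c`. -/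
def colArm (T : Filling) (c x : ℕ) : ℕ := ∑ r ∈ Finset.range (T.shape.colLen c), T.armCount r c x

/-- The number of unpaired letters `i` of the reading word of column `c`. -/
noncomputable def colMinus (i : ℕ) (T : Filling) (c : ℕ) : ℕ :=
  T.legCount c i + T.colArm c i - T.legCount c (i + 1)

/-- The number of unpaired letters `i + 1` of the reading word of column `c`. -/
noncomputable def colPlus (i : ℕ) (T : Filling) (c : ℕ) : ℕ :=
  T.colArm c (i + 1) + (T.legCount c (i + 1) - (T.legCount c i + T.colArm c i))

/-- The letters in the extended legs of column `c`. -/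
def legWord (T : Filling) (c : ℕ) : List Letter :=
  (List.range (T.shape.colLen c)).reverse.flatMap fun r =>
    ((T.entry r c).extLeg.sort (· ≥ ·)).map fun x => ⟨x, r, c, false⟩

/-- The letters in the arms of column `c`. -/
def armWord (T : Filling) (c : ℕ) : List Letter :=
  ((List.range (T.shape.colLen c)).flatMap fun r =>
    ((T.entry r c).arm.sort (· ≤ ·)).map fun x =>
      (⟨x, r, c, true⟩ : Letter)).insertionSort (fun x y => x.val ≤ y.val)

theorem mem_legWord {T : Filling} {c : ℕ} {x : Letter} :
    x ∈ T.legWord c ↔ T.InLeg x.row c x.val ∧ x.col = c ∧ x.inArm = false := by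
  obtain ⟨v, r, c', b⟩ := x
  simp only [legWord, List.mem_flatMap, List.mem_reverse, List.mem_range, List.mem_map,
    Finset.mem_sort, InLeg, YoungDiagram.mem_iff_lt_colLen, Letter.mk.injEq]
  constructor
  · rintro ⟨r', h1, y, h2, rfl, rfl, rfl, rfl⟩
    exact ⟨⟨h1, h2⟩, rfl, rfl⟩
  · rintro ⟨⟨h1, h2⟩, rfl, rfl⟩
    exact ⟨r, h1, v, h2, rfl, rfl, rfl, rfl⟩

theorem mem_armWord {T : Filling} {c : ℕ} {x : Letter} :
    x ∈ T.armWord c ↔ 0 < T.armCount x.row c x.val ∧ x.col = c ∧ x.inArm = true := by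
  obtain ⟨v, r, c', b⟩ := x
  simp only [armWord, List.mem_insertionSort, List.mem_flatMap, List.mem_range, List.mem_map,
    Multiset.mem_sort, Letter.mk.injEq]
  constructor
  · rintro ⟨r', h1, y, h2, rfl, rfl, rfl, rfl⟩
    exact ⟨Multiset.count_pos.2 h2, rfl, rfl⟩
  · rintro ⟨h, rfl, rfl⟩
    exact ⟨r, YoungDiagram.mem_iff_lt_colLen.1 (mem_of_armCount h), v, Multiset.count_pos.1 h,
      rfl, rfl, rfl, rfl⟩

theorem pairwise_legWord {T : Filling} (hT : T.IsHVT) (c : ℕ) :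
    (T.legWord c).Pairwise fun x y => y.val < x.val := by
  rw [legWord, List.pairwise_flatMap]
  constructor
  · intro r _
    rw [List.pairwise_map]
    exact (Finset.sortedGT_sort _).pairwise
  · rw [List.pairwise_reverse]
    refine List.pairwise_lt_range.imp_of_mem ?_
    intro r r' hr hr' hlt x hx y hy
    simp only [List.mem_range, ← YoungDiagram.mem_iff_lt_colLen] at hr hr'
    simp only [List.mem_map, Finset.mem_sort] at hx hy
    obtain ⟨u, hu, rfl⟩ := hx
    obtain ⟨v, hv, rfl⟩ := hy
    exact hT.col_lt (c := c) hlt (Or.inl ⟨hr, hv⟩) (Or.inl ⟨hr', hu⟩)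

theorem pairwise_armWord (T : Filling) (c : ℕ) :
    (T.armWord c).Pairwise fun x y => x.val ≤ y.val := by
  have : Std.Total fun x y : Letter => x.val ≤ y.val := ⟨fun x y => le_total x.val y.val⟩
  have : IsTrans Letter fun x y : Letter => x.val ≤ y.val := ⟨fun _ _ _ h h' => le_trans h h'⟩
  exact List.pairwise_insertionSort _ _

theorem length_filter_armWord (T : Filling) (c v : ℕ) :
    ((T.armWord c).filter fun x => x.val = v).length = T.colArm c v := by
  rw [← List.countP_eq_length_filter, armWord, (List.perm_insertionSort _ _).countP_eq,
    List.countP_flatMap, colArm]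
  change _ = (Multiset.map (fun r => T.armCount r c v) (Multiset.range _)).sum
  rw [Multiset.range, Multiset.map_coe, Multiset.sum_coe]
  congr 1
  refine List.map_congr_left fun r _ => ?_
  simp only [Function.comp, List.countP_map, armCount]
  conv_rhs => rw [← Multiset.sort_eq (T.entry r c).arm (· ≤ ·), Multiset.coe_count]
  rw [List.count_eq_countP]
  congr 1

theorem legCount_le_one (T : Filling) (c x : ℕ) : T.legCount c x ≤ 1 := by
  unfold legCount
  split_ifs <;> simp

theorem legCount_eq_one {T : Filling} {c x : ℕ} : T.legCount c x = 1 ↔ ∃ r, T.InLeg r c x := by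
  unfold legCount
  split_ifs with h <;> simp [h]

theorem legCount_eq_zero {T : Filling} {c x : ℕ} : T.legCount c x = 0 ↔ ∀ r, ¬T.InLeg r c x := by
  unfold legCount
  split_ifs with h
  · simpa using h
  · simpa using h

theorem length_filter_legWord {T : Filling} (hT : T.IsHVT) (c v : ℕ) :
    ((T.legWord c).filter fun x => x.val = v).length = T.legCount c v := by
  have h := length_filter_le_one (pairwise_legWord hT c) v
  by_cases h' : ∃ r, T.InLeg r c v
  · rw [legCount_eq_one.2 h']
    obtain ⟨r, hr⟩ := h'
    have : (⟨v, r, c, false⟩ : Letter) ∈ (T.legWord c).filter fun x => x.val = v := by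
      simp [mem_legWord, hr]
    have := List.length_pos_of_mem this
    omega
  · rw [legCount_eq_zero.2 (by simpa using h'), List.length_eq_zero_iff, List.filter_eq_nil_iff]
    intro x hx hx'
    simp only [decide_eq_true_eq] at hx'
    subst hx'
    exact h' ⟨_, (mem_legWord.1 hx).1⟩

theorem IsHVT.colArm_eq {T : Filling} (hT : T.IsHVT) {r c x : ℕ} (h : T.In r c x) :
    T.colArm c x = T.armCount r c x := by
  rw [colArm, Finset.sum_eq_single r]
  · intro r' _ hne
    by_contra h0
    exact hne (hT.row_eq (Or.inr (Nat.pos_of_ne_zero h0)) h)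
  · intro hr
    exact absurd (YoungDiagram.mem_iff_lt_colLen.1 h.mem) (by simpa using hr)

theorem colArm_eq_zero {T : Filling} {c x : ℕ} : T.colArm c x = 0 ↔ ∀ r, T.armCount r c x = 0 := by
  rw [colArm, Finset.sum_eq_zero_iff]
  refine ⟨fun h r => ?_, fun h r _ => h r⟩
  by_contra h0
  exact h0 (h r (Finset.mem_range.2
    (YoungDiagram.mem_iff_lt_colLen.1 (mem_of_armCount (Nat.pos_of_ne_zero h0)))))

theorem exists_mem_legWord {T : Filling} {c v : ℕ} :
    (∃ y ∈ T.legWord c, y.val = v) ↔ T.legCount c v = 1 := by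
  rw [legCount_eq_one]
  constructor
  · rintro ⟨y, hy, rfl⟩
    exact ⟨_, (mem_legWord.1 hy).1⟩
  · rintro ⟨r, hr⟩
    exact ⟨⟨v, r, c, false⟩, by simp [mem_legWord, hr], rfl⟩

theorem columnWord_eq (T : Filling) (c : ℕ) : T.columnWord c = T.legWord c ++ T.armWord c := rfl

theorem length_signs_legWord {T : Filling} (hT : T.IsHVT) (i c : ℕ) :
    (signs i (T.legWord c)).1.length = T.legCount c i - T.legCount c (i + 1) ∧
    (signs i (T.legWord c)).2.length = T.legCount c (i + 1) - T.legCount c i := by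
  have h1 := T.legCount_le_one c i
  have h2 := T.legCount_le_one c (i + 1)
  rw [signs_of_pairwise_gt i (pairwise_legWord hT c)]
  simp only [exists_mem_legWord]
  constructor
  · split_ifs with h
    · simp [h]; omega
    · rw [length_filter_legWord hT]; omega
  · split_ifs with h
    · simp [h]; omega
    · rw [length_filter_legWord hT]; omega

theorem length_signs_columnWord {T : Filling} (hT : T.IsHVT) (i c : ℕ) :
    (signs i (T.columnWord c)).1.length = colMinus i T c ∧
    (signs i (T.columnWord c)).2.length = colPlus i T c := by
  have h1 := T.legCount_le_one c i
  have h2 := T.legCount_le_one c (i + 1)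
  have h3 := length_signs_legWord hT i c
  rw [columnWord_eq, signs_append, signs_of_pairwise_le i (pairwise_armWord T c)]
  simp only [List.length_append, List.length_drop, List.length_take, length_filter_armWord, h3,
    colMinus, colPlus]
  omega

/-- The arms are read after the legs, so the rightmost unpaired `i` of the column is an arm letter
as soon as the arm of its cell contains `i`. A leg letter is selected only if that arm has none. -/
theorem getLast?_signs_columnWord {T : Filling} (hT : T.IsHVT) {i c : ℕ}
    (h : 0 < colMinus i T c) : ∃ r, T.In r c i ∧
      (signs i (T.columnWord c)).1.getLast? = some ⟨i, r, c, decide (0 < T.armCount r c i)⟩ := by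
  obtain ⟨x, hx⟩ : ∃ x, (signs i (T.columnWord c)).1.getLast? = some x := by
    cases h' : (signs i (T.columnWord c)).1.getLast? with
    | none =>
      rw [List.getLast?_eq_none_iff] at h'
      have := (length_signs_columnWord hT i c).1
      rw [h'] at this
      simp at this
      omega
    | some x => exact ⟨x, rfl⟩
  have h1 := T.legCount_le_one c i
  have h2 := T.legCount_le_one c (i + 1)
  have h3 := length_signs_legWord hT i c
  have hx' := hx
  rw [columnWord_eq, getLast?_signs_append, signs_of_pairwise_le i (pairwise_armWord T c)] at hx'
  simp only [length_filter_armWord, h3] at hx'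
  obtain ⟨v, r, c', b⟩ := x
  unfold colMinus at h
  refine ⟨r, ?_⟩
  rw [hx]
  split_ifs at hx' with h4
  · have h5 := List.mem_of_getLast? hx'
    simp only [List.mem_filter, mem_armWord, decide_eq_true_eq] at h5
    obtain ⟨⟨h5, rfl, rfl⟩, rfl⟩ := h5
    exact ⟨Or.inr h5, by simp [h5]⟩
  · have h5 := (signs_val i _).1 _ (List.mem_of_getLast? hx')
    rw [mem_legWord] at h5
    obtain ⟨rfl, h5, rfl, rfl⟩ := h5
    refine ⟨Or.inl h5, ?_⟩
    dsimp only at *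
    have h6 := hT.colArm_eq (Or.inl h5)
    have h7 := legCount_eq_one.2 ⟨r, h5⟩
    have : T.armCount r c' v = 0 := by omega
    simp [this]

/-- A leg letter `i + 1` comes before the arms, so it is the leftmost unpaired one if it survives;
it survives exactly if the column contains no `i` to pair with it. Otherwise an arm letter is
selected, even when the leg of the column contains `i + 1`. -/
theorem head?_signs_columnWord {T : Filling} (hT : T.IsHVT) {i c : ℕ}
    (h : 0 < colPlus i T c) : ∃ r, T.In r c (i + 1) ∧
      (signs i (T.columnWord c)).2.head? =
        some ⟨i + 1, r, c, decide (T.legCount c (i + 1) ≤ T.legCount c i + T.colArm c i)⟩ := by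
  obtain ⟨x, hx⟩ : ∃ x, (signs i (T.columnWord c)).2.head? = some x := by
    cases h' : (signs i (T.columnWord c)).2.head? with
    | none =>
      rw [List.head?_eq_none_iff] at h'
      have := (length_signs_columnWord hT i c).2
      rw [h'] at this
      simp at this
      omega
    | some x => exact ⟨x, rfl⟩
  have h1 := T.legCount_le_one c i
  have h2 := T.legCount_le_one c (i + 1)
  have h3 := length_signs_legWord hT i c
  have hx' := hx
  rw [columnWord_eq, head?_signs_append, signs_of_pairwise_le i (pairwise_armWord T c)] at hx'
  simp only [length_filter_armWord, h3] at hx'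
  obtain ⟨v, r, c', b⟩ := x
  refine ⟨r, ?_⟩
  rw [hx]
  split_ifs at hx' with h4
  · have h5 := (signs_val i _).2 _ (List.mem_of_head? hx')
    rw [mem_legWord] at h5
    obtain ⟨rfl, h5, rfl, rfl⟩ := h5
    refine ⟨Or.inl h5, ?_⟩
    dsimp only at *
    simp; omega
  · have h5 := List.mem_of_head? hx'
    simp only [List.mem_filter, mem_armWord, decide_eq_true_eq] at h5
    obtain ⟨⟨h5, rfl, rfl⟩, rfl⟩ := h5
    refine ⟨Or.inr h5, ?_⟩
    simp; omega

/-- Empty columns contribute nothing. The freedom in `n` allows two tableaux with different numbers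
of columns, as before and after a bumping, to be compared over the same range. -/
theorem readingWord_eq (T : Filling) {n : ℕ} (hn : T.shape.rowLen 0 ≤ n) :
    T.readingWord = (List.range n).flatMap T.columnWord := by
  obtain ⟨d, rfl⟩ := Nat.exists_eq_add_of_le hn
  clear hn
  induction d with
  | zero => rfl
  | succ d ih =>
    rw [ih, ← Nat.add_assoc, List.range_succ, List.flatMap_append]
    have : T.shape.colLen (T.shape.rowLen 0 + d) = 0 := by
      by_contra h
      have h1 := YoungDiagram.mem_iff_lt_colLen.2 (Nat.pos_of_ne_zero h)
      have h2 := YoungDiagram.mem_iff_lt_rowLen.1 h1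
      omega
    simp [columnWord, this]

theorem signs_columns {T : Filling} (hT : T.IsHVT) (i n : ℕ) :
    let w := (List.range n).flatMap T.columnWord
    (signs i w).2.length = plusCount (colMinus i T) (colPlus i T) n ∧
    (signs i w).1.getLast? = (lastMinus (colMinus i T) (colPlus i T) n).bind
      (fun c => (signs i (T.columnWord c)).1.getLast?) ∧
    (signs i w).2.head? = (firstPlus (colMinus i T) (colPlus i T) n).bind
      (fun c => (signs i (T.columnWord c)).2.head?) := by
  induction n with
  | zero => simp [signs, plusCount, lastMinus, firstPlus]
  | succ n ih =>
    simp only at ih ⊢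
    rw [List.range_succ, List.flatMap_append, List.flatMap_singleton, length_signs_append,
      getLast?_signs_append, head?_signs_append, ih.1, ih.2.1, ih.2.2, plusCount_succ,
      lastMinus_succ, firstPlus_succ, (length_signs_columnWord hT i n).1,
      (length_signs_columnWord hT i n).2]
    refine ⟨rfl, ?_, ?_⟩
    · split_ifs <;> rfl
    · split_ifs with h1 h2
      · rfl
      · rfl
      · have := (length_signs_columnWord hT i n).2
        rw [Nat.eq_zero_of_not_pos h2, List.length_eq_zero_iff] at this
        simp [this]

/-! ### The operators `f` as moves of one entry -/

/-- The effect of `f i` on `T` when the letter selected by the signature rule lies in the cell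
`(r, c)`, in the arm if `b` holds. -/
def fAct (i : ℕ) (T : Filling) (r c : ℕ) (b : Bool) : Filling :=
  if (r + 1, c) ∈ T.shape ∧ i + 1 ∈ (T.entry (r + 1) c).entries then
    (T.modify r c (Hook.removeArm i)).modify (r + 1) c (Hook.addArm (i + 1))
  else if (r, c + 1) ∈ T.shape ∧ i ∈ (T.entry r (c + 1)).extLeg then
    (T.modify r (c + 1) (Hook.removeExtLeg i)).modify r c (Hook.addLeg (i + 1))
  else if b then T.modify r c (Hook.replaceArm i (i + 1))
  else T.modify r c (Hook.replaceExtLeg i (i + 1))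

/-- The effect of `e i` on `T` when the letter selected by the signature rule lies in the cell
`(r, c)`, in the arm if `b` holds. -/
def eAct (i : ℕ) (T : Filling) (r c : ℕ) (b : Bool) : Filling :=
  if 0 < r ∧ i ∈ (T.entry (r - 1) c).entries then
    (T.modify r c (Hook.removeArm (i + 1))).modify (r - 1) c (Hook.addArm i)
  else if 0 < c ∧ i + 1 ∈ (T.entry r (c - 1)).leg then
    (T.modify r (c - 1) fun B => { B with leg := B.leg.erase (i + 1) }).modify r c
        (Hook.addExtLeg i)
  else if b then T.modify r c (Hook.replaceArm (i + 1) i)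
  else T.modify r c (Hook.replaceExtLeg (i + 1) i)

theorem IsHVT.f_eq_none {T : Filling} (hT : T.IsHVT) {i n : ℕ} (hn : T.shape.rowLen 0 ≤ n)
    (h : lastMinus (colMinus i T) (colPlus i T) n = none) : T.f i = none := by
  have := (signs_columns hT i n).2.1
  simp only [h, ← readingWord_eq T hn, Option.bind_none] at this
  simp only [f, filter_minus, this]

theorem IsHVT.f_eq_some {T : Filling} (hT : T.IsHVT) {i n c : ℕ} (hn : T.shape.rowLen 0 ≤ n)
    (h : lastMinus (colMinus i T) (colPlus i T) n = some c) :
    ∃ r, T.In r c i ∧ T.f i = some (fAct i T r c (decide (0 < T.armCount r c i))) := by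
  have := (signs_columns hT i n).2.1
  simp only [h, ← readingWord_eq T hn, Option.bind_some] at this
  have h0 : 0 < colMinus i T c := by
    have := (lastMinus_eq_some.1 h).2.1
    omega
  obtain ⟨r, hr, hr'⟩ := getLast?_signs_columnWord hT h0
  rw [hr'] at this
  refine ⟨r, hr, ?_⟩
  simp only [f, filter_minus, this, fAct]
  split_ifs <;> rfl

theorem IsHVT.e_eq_none {T : Filling} (hT : T.IsHVT) {i n : ℕ} (hn : T.shape.rowLen 0 ≤ n)
    (h : firstPlus (colMinus i T) (colPlus i T) n = none) : T.e i = none := by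
  have := (signs_columns hT i n).2.2
  simp only [h, ← readingWord_eq T hn, Option.bind_none] at this
  simp only [e, filter_plus, this]

theorem IsHVT.e_eq_some {T : Filling} (hT : T.IsHVT) {i n c : ℕ} (hn : T.shape.rowLen 0 ≤ n)
    (h : firstPlus (colMinus i T) (colPlus i T) n = some c) :
    ∃ r, T.In r c (i + 1) ∧ T.e i = some (eAct i T r c
      (decide (T.legCount c (i + 1) ≤ T.legCount c i + T.colArm c i))) := by
  have := (signs_columns hT i n).2.2
  simp only [h, ← readingWord_eq T hn, Option.bind_some] at this
  obtain ⟨r, hr, hr'⟩ := head?_signs_columnWord hT (firstPlus_eq_some.1 h).2.2.1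
  rw [hr'] at this
  refine ⟨r, hr, ?_⟩
  simp only [e, filter_plus, this, eAct]
  split_ifs <;> rfl

/-- `T'` arises from `T` by moving the arm entry `x` of the cell `(r, c)` to the arm of the cell
`(r', c')`, where it becomes `x'`. -/
structure ArmMove (T : Filling) (r c x r' c' x' : ℕ) (T' : Filling) : Prop where
  shape : T'.shape = T.shape
  leg : ∀ r₀ c₀ y, T'.InLeg r₀ c₀ y ↔ T.InLeg r₀ c₀ y
  arm : ∀ r₀ c₀ y, T'.armCount r₀ c₀ y =
    T.armCount r₀ c₀ y - (if r₀ = r ∧ c₀ = c ∧ y = x then 1 else 0) +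
      (if r₀ = r' ∧ c₀ = c' ∧ y = x' then 1 else 0)

/-- `T'` arises from `T` by moving the entry `x` of the extended leg of the cell `(r, c)` to the
extended leg of the cell `(r', c')`, where it becomes `x'`. -/
structure LegMove (T : Filling) (r c x r' c' x' : ℕ) (T' : Filling) : Prop where
  shape : T'.shape = T.shape
  leg : ∀ r₀ c₀ y, T'.InLeg r₀ c₀ y ↔
    (T.InLeg r₀ c₀ y ∧ ¬(r₀ = r ∧ c₀ = c ∧ y = x)) ∨ (r₀ = r' ∧ c₀ = c' ∧ y = x')
  arm : ∀ r₀ c₀ y, T'.armCount r₀ c₀ y = T.armCount r₀ c₀ y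

theorem ArmMove.in_of_in {T T' : Filling} {r c x r' c' x' : ℕ} (h : ArmMove T r c x r' c' x' T')
    {r₀ c₀ y : ℕ} (hy : T'.In r₀ c₀ y) : T.In r₀ c₀ y ∨ (r₀ = r' ∧ c₀ = c' ∧ y = x') := by
  refine or_iff_not_imp_right.2 fun h1 => ?_
  rcases hy with hy | hy
  · exact Or.inl ((h.leg _ _ _).1 hy)
  · rw [h.arm, if_neg h1] at hy
    exact Or.inr (by omega)

theorem LegMove.in_of_in {T T' : Filling} {r c x r' c' x' : ℕ} (h : LegMove T r c x r' c' x' T')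
    {r₀ c₀ y : ℕ} (hy : T'.In r₀ c₀ y) : T.In r₀ c₀ y ∨ (r₀ = r' ∧ c₀ = c' ∧ y = x') := by
  rcases hy with hy | hy
  · rcases (h.leg _ _ _).1 hy with hy | hy
    · exact Or.inl (Or.inl hy.1)
    · exact Or.inr hy
  · rw [h.arm] at hy
    exact Or.inl (Or.inr hy)

/-- The possible effects of `f i` when the selected letter lies in the cell `(r, c)`. -/
inductive FStep (i : ℕ) (T : Filling) (r c : ℕ) (T' : Filling) : Prop
  | up (h : T.In (r + 1) c (i + 1)) (h' : ArmMove T r c i (r + 1) c (i + 1) T')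
  | left (h : ¬T.In (r + 1) c (i + 1)) (hr : T.InLeg r (c + 1) i)
      (h' : LegMove T r (c + 1) i r c (i + 1) T')
  | arm (h : ¬T.In (r + 1) c (i + 1)) (hr : ¬T.InLeg r (c + 1) i) (ha : 0 < T.armCount r c i)
      (h' : ArmMove T r c i r c (i + 1) T')
  | leg (h : ¬T.In (r + 1) c (i + 1)) (hr : ¬T.InLeg r (c + 1) i) (ha : T.armCount r c i = 0)
      (h' : LegMove T r c i r c (i + 1) T')

/-- Columns increase strictly, so there is no room for a cell between `i` and `i + 1`; if `i + 1`
lies in the next cell, it is the minimum of that cell and hence belongs to its extended leg. -/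
theorem IsHVT.succ_row {T : Filling} (hT : T.IsHVT) {i r r' c : ℕ} (h : T.In r c i)
    (h' : T.In r' c (i + 1)) : r' = r ∨ (r' = r + 1 ∧ T.InLeg (r + 1) c (i + 1)) := by
  rcases lt_trichotomy r' r with h1 | h1 | h1
  · have := hT.col_lt h1 h' h
    omega
  · exact Or.inl h1
  · right
    have h2 : r' = r + 1 := by
      by_contra h3
      have hm : (r + 1, c) ∈ T.shape := T.shape.up_left_mem (by omega) le_rfl h'.mem
      obtain ⟨y, hy⟩ := exists_inLeg hm
      have h4 := hT.col_lt (Nat.lt_succ_self r) h hy.inn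
      have h5 := hT.col_lt (by omega : r + 1 < r') hy.inn h'
      omega
    subst h2
    refine ⟨rfl, ?_⟩
    obtain ⟨y, hy, hy'⟩ := hT.exists_le h'.mem
    have h4 := hT.col_lt h1 h hy.inn
    have h5 := hy' _ h'
    obtain rfl : y = i + 1 := by omega
    exact hy

theorem IsHVT.colMinus_eq {T : Filling} (hT : T.IsHVT) {i r c : ℕ} (h : T.In r c i) :
    colMinus i T c = T.legCount c i + T.armCount r c i - T.legCount c (i + 1) := by
  rw [colMinus, hT.colArm_eq h]

theorem IsHVT.legCount_eq {T : Filling} (hT : T.IsHVT) {x r c : ℕ} (h : T.In r c x)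
    [Decidable (T.InLeg r c x)] :
    T.legCount c x = if T.InLeg r c x then 1 else 0 := by
  split_ifs with h'
  · exact legCount_eq_one.2 ⟨r, h'⟩
  · refine legCount_eq_zero.2 fun r' hr => h' ?_
    rwa [hT.row_eq h hr.inn]

/-- The `i + 1` above belongs to an extended leg and uses up one `i` of the column. For an unpaired
`i` to remain, the cell must contain `i` at least twice, and the extended leg accounts for at most
one of these. -/
theorem IsHVT.up_facts {T : Filling} (hT : T.IsHVT) {i r c : ℕ} (h : T.In r c i)
    (hp : 0 < colMinus i T c) (hu : T.In (r + 1) c (i + 1)) :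
    0 < T.armCount r c i ∧ T.InLeg (r + 1) c (i + 1) ∧ ¬T.In r c (i + 1) ∧
      (T.InLeg r c i ∨ 2 ≤ T.armCount r c i) := by
  classical
  have h1 : T.InLeg (r + 1) c (i + 1) := by
    rcases hT.succ_row h hu with h1 | h1
    · omega
    · exact h1.2
  rw [hT.colMinus_eq h, hT.legCount_eq h, legCount_eq_one.2 ⟨_, h1⟩] at hp
  refine ⟨?_, h1, fun h2 => ?_, ?_⟩
  · split_ifs at hp <;> omega
  · have := hT.row_eq h2 hu
    omega
  · by_cases h3 : T.InLeg r c i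
    · exact Or.inl h3
    · rw [if_neg h3] at hp
      omega

/-- The row inequality excludes `i + 1` from the selected cell, so column `c` has no `i + 1` and
hence no unpaired plus. By `hq`, column `c + 1` has no unpaired `i`, so its leg letter `i` is paired
with a leg letter `i + 1` of the same column and the arm has no `i`. This `i + 1` lies in the same
cell: one row higher it would force an `i + 1` above the selected cell. -/
theorem IsHVT.left_facts {T : Filling} (hT : T.IsHVT) {i r c : ℕ} (h : T.In r c i)
    (hq : colMinus i T (c + 1) ≤ colPlus i T c)
    (hu : ¬T.In (r + 1) c (i + 1)) (hr : T.InLeg r (c + 1) i) :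
    T.InLeg r (c + 1) (i + 1) ∧ ¬T.In r c (i + 1) ∧ T.armCount r (c + 1) i = 0 ∧
      (∀ r', ¬T.In r' c (i + 1)) := by
  have h0 : ¬T.In r c (i + 1) := fun h1 => by
    have := hT.row_le (Nat.lt_succ_self c) h1 hr.inn
    omega
  have h1 : ∀ r', ¬T.In r' c (i + 1) := by
    intro r' h1
    rcases hT.succ_row h h1 with rfl | ⟨rfl, _⟩
    · exact h0 h1
    · exact hu h1
  have h2 : T.colArm c (i + 1) = 0 :=
    colArm_eq_zero.2 fun r' => Nat.eq_zero_of_not_pos fun h2 => h1 r' (Or.inr h2)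
  have h3 : T.legCount c (i + 1) = 0 := legCount_eq_zero.2 fun r' h2 => h1 r' (Or.inl h2)
  have h4 : colPlus i T c = 0 := by rw [colPlus, h2, h3]; omega
  rw [hT.colMinus_eq hr.inn, legCount_eq_one.2 ⟨_, hr⟩] at hq
  have h5 := T.legCount_le_one (c + 1) (i + 1)
  have h6 : T.armCount r (c + 1) i = 0 := by omega
  have h7 : T.legCount (c + 1) (i + 1) = 1 := by omega
  obtain ⟨r', h8⟩ := legCount_eq_one.1 h7
  refine ⟨?_, h0, h6, h1⟩
  rcases hT.succ_row hr.inn h8.inn with rfl | ⟨rfl, _⟩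
  · exact h8
  · exfalso
    have hm : (r + 1, c) ∈ T.shape := T.shape.up_left_mem le_rfl (by omega) h8.1
    obtain ⟨y, hy⟩ := exists_inLeg hm
    have h9 := hT.row_le (Nat.lt_succ_self c) hy.inn h8.inn
    have h10 := hT.col_lt (Nat.lt_succ_self r) h hy.inn
    obtain rfl : y = i + 1 := by omega
    exact hu hy.inn

/-- Without arm letters the only `i` of the column is the one in the extended leg, and an `i + 1` in
a leg of the column would pair with it. -/
theorem IsHVT.leg_facts {T : Filling} (hT : T.IsHVT) {i r c : ℕ} (h : T.In r c i)
    (hp : 0 < colMinus i T c) (ha : T.armCount r c i = 0) :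
    T.InLeg r c i ∧ ∀ r', ¬T.InLeg r' c (i + 1) := by
  classical
  rw [hT.colMinus_eq h, hT.legCount_eq h, ha] at hp
  split_ifs at hp with h1
  · exact ⟨h1, legCount_eq_zero.1 (by omega)⟩
  · omega

/-- The pairing facts make the operations on hooks honest moves: the arm letter that is erased is
present, and an extended leg that loses `i` stays nonempty because it retains `i + 1`. -/
theorem IsHVT.fAct_step {T : Filling} (hT : T.IsHVT) {i r c : ℕ} (h : T.In r c i)
    (hp : 0 < colMinus i T c) (hq : colMinus i T (c + 1) ≤ colPlus i T c) :
    FStep i T r c (fAct i T r c (decide (0 < T.armCount r c i))) ∧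
      (fAct i T r c (decide (0 < T.armCount r c i))).IsCanon := by
  unfold fAct
  split_ifs with h1 h2 h3
  · have hu : T.In (r + 1) c (i + 1) := (in_iff h1.1).2 h1.2
    have hf := hT.up_facts h hp hu
    refine ⟨FStep.up hu ⟨rfl, fun r₀ c₀ y => ?_, fun r₀ c₀ y => ?_⟩, ?_⟩
    · rw [inLeg_modify, inLeg_modify]
      split_ifs with h4 h5
      · obtain ⟨rfl, rfl⟩ := h4
        rw [entry_modify_of_ne _ (by omega)]; rfl
      · obtain ⟨rfl, rfl⟩ := h5
        rfl
      · rfl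
    · rw [armCount_modify (by exact h1.1), armCount_modify h.mem]
      split_ifs with h4 h5 h6 h7 h8 h9 h10 <;>
        simp_all [Hook.removeArm, Hook.addArm, entry_modify_of_ne, armCount,
          Multiset.count_erase_of_ne, Multiset.count_cons_of_ne]
    · refine (hT.isCanon.modify fun hm => ?_).modify fun hm => ?_
      · exact hT.isCanon _ _ hm
      · rw [entry_modify_of_ne _ (by omega)]
        exact hT.isCanon _ _ hm
  · have hu : ¬T.In (r + 1) c (i + 1) := fun hu => h1 (in_iff'.1 hu)
    have hf := hT.left_facts h hq hu h2
    have hne : (T.entry r (c + 1)).extLeg.erase i |>.Nonempty :=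
      ⟨i + 1, Finset.mem_erase.2 ⟨by omega, hf.1.2⟩⟩
    refine ⟨FStep.left hu h2 ⟨rfl, fun r₀ c₀ y => ?_, fun r₀ c₀ y => ?_⟩, ?_⟩
    · rw [inLeg_modify, inLeg_modify, shape_modify]
      split_ifs with h4 h5
      · obtain ⟨rfl, rfl⟩ := h4
        rw [entry_modify_of_ne _ (by omega)]
        have := h.mem
        simp [InLeg, this, Hook.addLeg, Hook.extLeg, or_comm, or_left_comm]
      · obtain ⟨rfl, rfl⟩ := h5
        have := h2.1
        simp [InLeg, this, Hook.removeExtLeg, Hook.extLeg_ofExtLeg hne, and_comm]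
      · exact ⟨fun hh => Or.inl ⟨hh, fun h6 => h5 ⟨h6.1, h6.2.1⟩⟩,
          fun hh => hh.elim And.left fun h6 => absurd ⟨h6.1, h6.2.1⟩ h4⟩
    · rw [armCount_modify (by exact h.mem), armCount_modify h2.1]
      split_ifs with h4 h5 <;>
        simp_all [Hook.removeExtLeg, Hook.addLeg, entry_modify_of_ne, armCount]
    · refine (hT.isCanon.modify fun hm => ?_).modify fun hm => ?_
      · exact Hook.isCanon_ofExtLeg hne _
      · rw [entry_modify_of_ne _ (by omega)]
        intro x hx
        simp only [Hook.addLeg, Finset.mem_insert] at hx ⊢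
        rcases hx with rfl | hx
        · obtain ⟨y, hy, hy'⟩ := hT.exists_le h.mem
          have := hT.cell r c h.mem
          have h3 := (in_iff h.mem).1 h
          rw [Hook.mem_entries, Hook.mem_extLeg] at h3
          rcases h3 with (h3 | h3) | h3
          · omega
          · have := this.leg_gt _ h3
            omega
          · have := this.arm_ge _ h3
            omega
        · exact hT.isCanon r c h.mem x hx
  · have hu : ¬T.In (r + 1) c (i + 1) := fun hu => h1 (in_iff'.1 hu)
    have hr : ¬T.InLeg r (c + 1) i := h2
    simp only [decide_eq_true_eq] at h3
    refine ⟨FStep.arm hu hr h3 ⟨rfl, fun r₀ c₀ y => ?_, fun r₀ c₀ y => ?_⟩, ?_⟩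
    · rw [inLeg_modify]
      split_ifs with h4
      · obtain ⟨rfl, rfl⟩ := h4
        rfl
      · rfl
    · rw [armCount_modify h.mem]
      split_ifs with h4 h5 h6 h7 h8 h9 h10 <;>
        simp_all [Hook.replaceArm, armCount,
          Multiset.count_erase_of_ne, Multiset.count_cons_of_ne]
    · exact hT.isCanon.modify fun hm => hT.isCanon _ _ hm
  · have hu : ¬T.In (r + 1) c (i + 1) := fun hu => h1 (in_iff'.1 hu)
    have hr : ¬T.InLeg r (c + 1) i := h2
    have h4 : T.armCount r c i = 0 := by simpa using h3
    have hne : (insert (i + 1) ((T.entry r c).extLeg.erase i)).Nonempty := ⟨i + 1, by simp⟩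
    refine ⟨FStep.leg hu hr h4 ⟨rfl, fun r₀ c₀ y => ?_, fun r₀ c₀ y => ?_⟩, ?_⟩
    · rw [inLeg_modify]
      split_ifs with h5
      · obtain ⟨rfl, rfl⟩ := h5
        have := h.mem
        simp [InLeg, this, Hook.replaceExtLeg, Hook.extLeg_ofExtLeg hne, or_comm, and_comm]
      · exact ⟨fun hh => Or.inl ⟨hh, fun h6 => h5 ⟨h6.1, h6.2.1⟩⟩,
          fun hh => hh.elim And.left fun h6 => absurd ⟨h6.1, h6.2.1⟩ h5⟩
    · rw [armCount_modify h.mem]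
      split_ifs with h5
      · obtain ⟨rfl, rfl⟩ := h5
        rfl
      · rfl
    · exact hT.isCanon.modify fun hm => Hook.isCanon_ofExtLeg hne _

/-- Raising `i` to `i + 1` can only violate inequalities towards an `i` on the right or an `i + 1`
above. The conditions of the rules exclude these or replace the step by a move into the neighbouring
cell. -/
theorem IsHVT.fStep_isLocal {T T' : Filling} (hT : T.IsHVT) {i r c : ℕ} (h : T.In r c i)
    (hp : 0 < colMinus i T c) (hq : colMinus i T (c + 1) ≤ colPlus i T c)
    (hs : FStep i T r c T') : T'.IsLocal := by
  have hL := hT.isLocal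
  have hmin : ∀ {r c y}, T.In r c y → ∃ z, T.InLeg r c z ∧ z ≤ y := by
    intro r c y hy
    rcases hy with hy | hy
    · exact ⟨y, hy, le_rfl⟩
    · exact hL.arm r c y hy
  obtain ⟨z, hz, hz'⟩ := hmin h
  have hz0 := hL.pos _ _ _ hz
  rcases hs with ⟨hu, hm⟩ | ⟨hu, hr, hm⟩ | ⟨hu, hr, ha, hm⟩ | ⟨hu, hr, ha, hm⟩
  · have hf := hT.up_facts h hp hu
    have hIn : ∀ r₀ c₀ y, T'.In r₀ c₀ y → T.In r₀ c₀ y := by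
      intro r₀ c₀ y hy
      rcases hm.in_of_in hy with hy | ⟨rfl, rfl, rfl⟩
      · exact hy
      · exact hu
    refine ⟨fun r₀ c₀ y hy => hL.pos r₀ c₀ y ((hm.leg _ _ _).1 hy), fun r₀ c₀ y hy => ?_,
      fun r₀ c₀ x y hx hy => hL.row r₀ c₀ x y (hIn _ _ _ hx) ((hm.leg _ _ _).1 hy),
      fun r₀ c₀ x y hx hy => hL.col r₀ c₀ x y (hIn _ _ _ hx) ((hm.leg _ _ _).1 hy)⟩
    obtain ⟨w, hw, hw'⟩ := hmin (hIn _ _ _ (Or.inr hy))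
    exact ⟨w, (hm.leg _ _ _).2 hw, hw'⟩
  · have hf := hT.left_facts h hq hu hr
    have hIn : ∀ r₀ c₀ y, T'.In r₀ c₀ y → (T.In r₀ c₀ y ∧ ¬(r₀ = r ∧ c₀ = c + 1 ∧ y = i)) ∨
        (r₀ = r ∧ c₀ = c ∧ y = i + 1) := by
      intro r₀ c₀ y hy
      rcases hm.in_of_in hy with h1 | h1
      · refine or_iff_not_imp_right.2 fun h2 => ⟨h1, ?_⟩
        rintro ⟨rfl, rfl, rfl⟩
        rcases hy with hy | hy
        · have := (hm.leg _ _ _).1 hy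
          tauto
        · rw [hm.arm] at hy
          omega
      · exact Or.inr h1
    refine ⟨fun r₀ c₀ y hy => ?_, fun r₀ c₀ y hy => ?_, fun r₀ c₀ x y hx hy => ?_,
      fun r₀ c₀ x y hx hy => ?_⟩
    · have := hL.pos r₀ c₀ y
      have := hm.leg r₀ c₀ y
      grind
    · rw [hm.arm] at hy
      obtain ⟨w, hw, hw'⟩ := hmin (Or.inr hy)
      -- If the removed `i` was the lower bound for an arm entry of its cell, the remaining `i + 1`
      -- takes its place, since that arm contains no `i`.
      by_cases h1 : r₀ = r ∧ c₀ = c + 1 ∧ w = i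
      · obtain ⟨rfl, rfl, rfl⟩ := h1
        refine ⟨w + 1, (hm.leg _ _ _).2 (Or.inl ⟨hf.1, by omega⟩), ?_⟩
        rcases eq_or_lt_of_le hw' with rfl | h2
        · omega
        · exact h2
      · exact ⟨w, (hm.leg _ _ _).2 (Or.inl ⟨hw, h1⟩), hw'⟩
    · have h1 := hL.row r₀ c₀ x y
      have h2 := hL.row r₀ c₀ i y
      have h3 := hL.row r₀ c₀ x z
      have := hIn _ _ _ hx
      have := hm.leg r₀ (c₀ + 1) y
      grind
    · have h1 := hL.col r₀ c₀ x y
      have h2 := hL.col r₀ c₀ i y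
      have h3 := hL.col r₀ c₀ x z
      have := hIn _ _ _ hx
      have := hm.leg (r₀ + 1) c₀ y
      have h4 : T.InLeg (r + 1) c (i + 1) → T.In (r + 1) c (i + 1) := InLeg.inn
      grind
  · have hIn : ∀ r₀ c₀ y, T'.In r₀ c₀ y → T.In r₀ c₀ y ∨ (r₀ = r ∧ c₀ = c ∧ y = i + 1) :=
      fun _ _ _ => hm.in_of_in
    refine ⟨fun r₀ c₀ y hy => hL.pos r₀ c₀ y ((hm.leg _ _ _).1 hy), fun r₀ c₀ y hy => ?_,
      fun r₀ c₀ x y hx hy => ?_, fun r₀ c₀ x y hx hy => ?_⟩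
    · rcases hIn _ _ _ (Or.inr hy) with h1 | ⟨rfl, rfl, rfl⟩
      · obtain ⟨w, hw, hw'⟩ := hmin h1
        exact ⟨w, (hm.leg _ _ _).2 hw, hw'⟩
      · exact ⟨z, (hm.leg _ _ _).2 hz, by omega⟩
    · rw [hm.leg] at hy
      rcases hIn _ _ _ hx with h1 | ⟨rfl, rfl, rfl⟩
      · exact hL.row _ _ _ _ h1 hy
      · have := hL.row _ _ _ _ h hy
        grind
    · rw [hm.leg] at hy
      rcases hIn _ _ _ hx with h1 | ⟨rfl, rfl, rfl⟩
      · exact hL.col _ _ _ _ h1 hy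
      · have := hL.col _ _ _ _ h hy
        have h4 : T.InLeg (r₀ + 1) c₀ (i + 1) → T.In (r₀ + 1) c₀ (i + 1) := InLeg.inn
        grind
  · have hf := hT.leg_facts h hp ha
    have hIn : ∀ r₀ c₀ y, T'.In r₀ c₀ y → (T.In r₀ c₀ y ∧ ¬(r₀ = r ∧ c₀ = c ∧ y = i)) ∨
        (r₀ = r ∧ c₀ = c ∧ y = i + 1) := by
      intro r₀ c₀ y hy
      rcases hm.in_of_in hy with h1 | h1
      · refine or_iff_not_imp_right.2 fun h2 => ⟨h1, ?_⟩
        rintro ⟨rfl, rfl, rfl⟩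
        rcases hy with hy | hy
        · have := (hm.leg _ _ _).1 hy
          tauto
        · rw [hm.arm] at hy
          omega
      · exact Or.inr h1
    refine ⟨fun r₀ c₀ y hy => ?_, fun r₀ c₀ y hy => ?_, fun r₀ c₀ x y hx hy => ?_,
      fun r₀ c₀ x y hx hy => ?_⟩
    · have := hL.pos r₀ c₀ y
      have := hm.leg r₀ c₀ y
      grind
    · rw [hm.arm] at hy
      obtain ⟨w, hw, hw'⟩ := hmin (Or.inr hy)
      by_cases h1 : r₀ = r ∧ c₀ = c ∧ w = i
      · obtain ⟨rfl, rfl, rfl⟩ := h1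
        refine ⟨w + 1, (hm.leg _ _ _).2 (Or.inr ⟨rfl, rfl, rfl⟩), ?_⟩
        rcases eq_or_lt_of_le hw' with rfl | h2
        · omega
        · exact h2
      · exact ⟨w, (hm.leg _ _ _).2 (Or.inl ⟨hw, h1⟩), hw'⟩
    · have h1 := hL.row r₀ c₀ x y
      have h2 := hL.row r₀ c₀ i y
      have h3 := hL.row r₀ c₀ x z
      have := hIn _ _ _ hx
      have := hm.leg r₀ (c₀ + 1) y
      grind
    · have h1 := hL.col r₀ c₀ x y
      have h2 := hL.col r₀ c₀ i y
      have h3 := hL.col r₀ c₀ x z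
      have := hIn _ _ _ hx
      have := hm.leg (r₀ + 1) c₀ y
      have h4 : T.InLeg (r + 1) c (i + 1) → T.In (r + 1) c (i + 1) := InLeg.inn
      grind

theorem FStep.shape {T T' : Filling} {i r c : ℕ} (hs : FStep i T r c T') :
    T'.shape = T.shape := by
  rcases hs with ⟨_, hm⟩ | ⟨_, _, hm⟩ | ⟨_, _, _, hm⟩ | ⟨_, _, _, hm⟩ <;> exact hm.shape

/-- At the selected column no plus from the left survives, so the minuses of the next column face
only the pluses of `c`; they are all paired because nothing further right is selected. These two
inequalities are all that the local analysis of `f i` needs. -/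
theorem lastMinus_facts {p q : ℕ → ℕ} {n c : ℕ} (h : lastMinus p q n = some c)
    (hn : p n = 0) : 0 < p c ∧ p (c + 1) ≤ q c := by
  obtain ⟨h1, h2, h3⟩ := lastMinus_eq_some.1 h
  refine ⟨by omega, ?_⟩
  by_cases h4 : c + 1 = n
  · rw [h4, hn]; omega
  · have := h3 (c + 1) (by omega) (by omega)
    rw [plusCount_succ] at this
    omega

theorem colMinus_eq_zero {T : Filling} {n : ℕ} (i : ℕ) (hn : T.shape.rowLen 0 ≤ n) :
    colMinus i T n = 0 := by
  have h0 : ∀ r, (r, n) ∉ T.shape := fun r hr => by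
    have := YoungDiagram.mem_iff_lt_rowLen.1 (T.shape.up_left_mem (Nat.zero_le r) le_rfl hr)
    omega
  rw [colMinus, legCount_eq_zero.2 fun r hr => h0 r hr.1, colArm_eq_zero.2 fun r =>
    Nat.eq_zero_of_not_pos fun hr => h0 r (mem_of_armCount hr)]
  omega

/-- The description of `f i` on hook-valued tableaux, when it is nonzero. -/
theorem IsHVT.f_spec {T : Filling} (hT : T.IsHVT) {i n c : ℕ} (hn : T.shape.rowLen 0 ≤ n)
    (h : lastMinus (colMinus i T) (colPlus i T) n = some c) :
    ∃ r T', T.In r c i ∧ 0 < colMinus i T c ∧ colMinus i T (c + 1) ≤ colPlus i T c ∧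
      FStep i T r c T' ∧ T'.IsHVT ∧ T.f i = some T' := by
  obtain ⟨h1, h2⟩ := lastMinus_facts h (colMinus_eq_zero i hn)
  obtain ⟨r, hr, hf⟩ := hT.f_eq_some hn h
  obtain ⟨h3, h4⟩ := hT.fAct_step hr h1 h2
  exact ⟨r, _, hr, h1, h2, h3, (hT.fStep_isLocal hr h1 h2 h3).isHVT h4, hf⟩

/-- The rule for `e i` tests the leg rather than the extended leg; here this is expressed without
mentioning the corner, as being a non-minimal element of the extended leg. -/
theorem IsHVT.mem_leg_iff {T : Filling} (hT : T.IsHVT) {r c x : ℕ} (h : (r, c) ∈ T.shape) :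
    x ∈ (T.entry r c).leg ↔ T.InLeg r c x ∧ ∃ y < x, T.InLeg r c y := by
  have hc := hT.isCanon r c h
  simp only [InLeg, h, true_and, Hook.mem_extLeg]
  constructor
  · intro hx
    exact ⟨Or.inr hx, _, hc x hx, Or.inl rfl⟩
  · rintro ⟨hx | hx, y, hy, hy'⟩
    · rcases hy' with rfl | hy'
      · omega
      · have := hc y hy'
        omega
    · exact hx

/-! ### The operators `e` as moves of one entry -/

/-- The possible effects of `e i` when the selected letter lies in the cell `(r, c)`. -/
inductive EStep (i : ℕ) (T : Filling) (r c : ℕ) (T' : Filling) : Prop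
  | down (hr : 0 < r) (h : T.In (r - 1) c i) (h' : ArmMove T r c (i + 1) (r - 1) c i T')
  | right (h : ¬(0 < r ∧ T.In (r - 1) c i)) (hc : 0 < c) (hl : T.InLeg r (c - 1) (i + 1))
      (hl' : ∃ y < i + 1, T.InLeg r (c - 1) y) (h' : LegMove T r (c - 1) (i + 1) r c i T')
  | arm (h : ¬(0 < r ∧ T.In (r - 1) c i))
      (hl : ¬(0 < c ∧ T.InLeg r (c - 1) (i + 1) ∧ ∃ y < i + 1, T.InLeg r (c - 1) y))
      (ha : T.legCount c (i + 1) ≤ T.legCount c i + T.colArm c i)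
      (h' : ArmMove T r c (i + 1) r c i T')
  | leg (h : ¬(0 < r ∧ T.In (r - 1) c i))
      (hl : ¬(0 < c ∧ T.InLeg r (c - 1) (i + 1) ∧ ∃ y < i + 1, T.InLeg r (c - 1) y))
      (ha : T.legCount c i + T.colArm c i < T.legCount c (i + 1))
      (h' : LegMove T r c (i + 1) r c i T')

theorem EStep.shape {T T' : Filling} {i r c : ℕ} (hs : EStep i T r c T') :
    T'.shape = T.shape := by
  rcases hs with ⟨_, _, hm⟩ | ⟨_, _, _, _, hm⟩ | ⟨_, _, _, hm⟩ | ⟨_, _, _, hm⟩ <;> exact hm.shape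

theorem no_col {T : Filling} {c x : ℕ} (h : T.legCount c x + T.colArm c x = 0) (r : ℕ) :
    ¬T.In r c x := by
  rintro (h1 | h1)
  · exact legCount_eq_zero.1 (by omega) r h1
  · have := colArm_eq_zero.1 (by omega : T.colArm c x = 0) r
    omega

theorem col_pos {T : Filling} {c x : ℕ} (h : 0 < T.legCount c x + T.colArm c x) :
    ∃ r, T.In r c x := by
  by_contra h1
  push Not at h1
  have h2 : T.legCount c x = 0 := legCount_eq_zero.2 fun r hr => h1 r (Or.inl hr)
  have h3 : T.colArm c x = 0 :=
    colArm_eq_zero.2 fun r => Nat.eq_zero_of_not_pos fun hr => h1 r (Or.inr hr)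
  omega

theorem col_eq_zero {T : Filling} {c x : ℕ} (h : ∀ r, ¬T.In r c x) :
    T.legCount c x = 0 ∧ T.colArm c x = 0 := by
  refine ⟨legCount_eq_zero.2 fun r hr => h r (Or.inl hr),
    colArm_eq_zero.2 fun r => Nat.eq_zero_of_not_pos fun hr => h r (Or.inr hr)⟩

theorem pos_of_in {T : Filling} {r c x : ℕ} (h : T.In r c x) :
    0 < T.legCount c x + T.colArm c x := by
  by_contra h1
  exact no_col (by omega) r h

/-- The `i` below cancels a possible leg letter `i + 1` of the column, so an unpaired `i + 1` has to
come from an arm. Being next to `i`, the number `i + 1` is also the minimum of its cell. -/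
theorem IsHVT.down_facts {T : Filling} (hT : T.IsHVT) {i r c : ℕ} (h : T.In r c (i + 1))
    (hq : 0 < colPlus i T c) (hr : 0 < r) (hd : T.In (r - 1) c i) :
    0 < T.armCount r c (i + 1) ∧ T.InLeg r c (i + 1) := by
  have h1 := pos_of_in hd
  have h2 := T.legCount_le_one c (i + 1)
  have h3 := hT.colArm_eq h
  refine ⟨by unfold colPlus at hq; omega, ?_⟩
  rcases hT.succ_row hd h with h4 | ⟨h4, h5⟩
  · omega
  · rwa [← h4] at h5

/-- If `i + 1` lies to the left of the cell selected by `e i` and `i` does not lie below it,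
then `i` and `i + 1` both lie in the extended leg or the arm of the cell to the left. -/
theorem IsHVT.right_facts {T : Filling} (hT : T.IsHVT) {i r c : ℕ} (h : T.In r (c + 1) (i + 1))
    (hp : colPlus i T c ≤ colMinus i T (c + 1))
    (hd : ¬(0 < r ∧ T.In (r - 1) (c + 1) i)) (hl : T.In r c (i + 1)) :
    T.InLeg r (c + 1) (i + 1) ∧ (∀ r', ¬T.In r' (c + 1) i) ∧ T.InLeg r c (i + 1) ∧
      T.colArm c (i + 1) = 0 ∧ T.In r c i := by
  have h1 : ∀ r', ¬T.In r' (c + 1) i := by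
    intro r' h1
    rcases hT.succ_row h1 h with rfl | ⟨rfl, _⟩
    · have := hT.row_le (Nat.lt_succ_self c) hl h1
      omega
    · exact hd ⟨by omega, by simpa using h1⟩
  have h2 := col_eq_zero h1
  have h3 : colMinus i T (c + 1) = 0 := by rw [colMinus, h2.1, h2.2]; omega
  have h4 : T.colArm c (i + 1) = 0 := by unfold colPlus at hp; omega
  have h5 : T.InLeg r c (i + 1) := by
    rcases hl with hl | hl
    · exact hl
    · have := hT.colArm_eq (Or.inr hl)
      omega
  have h6 := legCount_eq_one.2 ⟨r, h5⟩
  have h7 : 0 < T.legCount c i + T.colArm c i := by unfold colPlus at hp; omega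
  obtain ⟨r', h8⟩ := col_pos h7
  refine ⟨?_, h1, h5, h4, ?_⟩
  · obtain ⟨y, hy, hy'⟩ := hT.exists_le h.mem
    have h9 := hT.row_le (Nat.lt_succ_self c) hl hy.inn
    have h10 := hy' _ h
    obtain rfl : y = i + 1 := by omega
    exact hy
  · rcases hT.succ_row h8 hl with rfl | ⟨rfl, _⟩
    · exact h8
    · exfalso
      obtain ⟨y, hy⟩ := exists_inLeg (T.shape.up_left_mem (by omega : r' ≤ r' + 1) le_rfl h.mem)
      have h9 := hT.row_le (Nat.lt_succ_self c) h8 hy.inn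
      have h10 := hT.col_lt (Nat.lt_succ_self r') hy.inn h
      obtain rfl : y = i := by omega
      exact h1 _ hy.inn

/-- An `i + 1` on the left would be accompanied by an `i` in the same cell, so it could not be the
hook entry and the rule (S) would apply. -/
theorem IsHVT.not_left {T : Filling} (hT : T.IsHVT) {i r c : ℕ} (h : T.In r (c + 1) (i + 1))
    (hp : colPlus i T c ≤ colMinus i T (c + 1))
    (hd : ¬(0 < r ∧ T.In (r - 1) (c + 1) i))
    (hl : ¬(T.InLeg r c (i + 1) ∧ ∃ y < i + 1, T.InLeg r c y)) : ¬T.In r c (i + 1) := by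
  intro h1
  have hf := hT.right_facts h hp hd h1
  obtain ⟨y, hy, hy'⟩ := hT.exists_le h1.mem
  exact hl ⟨hf.2.2.1, y, by have := hy' _ hf.2.2.2.2; omega, hy⟩

/-- The counterpart of `IsHVT.fAct_step`: for the rule (M) the erased arm letter exists by
`IsHVT.down_facts`, and for a replacement in the arm because the unpaired plus then comes from an
arm. -/
theorem IsHVT.eAct_step {T : Filling} (hT : T.IsHVT) {i r c : ℕ} (h : T.In r c (i + 1))
    (hq : 0 < colPlus i T c) :
    EStep i T r c (eAct i T r c (decide (T.legCount c (i + 1) ≤ T.legCount c i + T.colArm c i))) ∧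
      (eAct i T r c
        (decide (T.legCount c (i + 1) ≤ T.legCount c i + T.colArm c i))).IsCanon := by
  have hdown : (0 < r ∧ i ∈ (T.entry (r - 1) c).entries) ↔ (0 < r ∧ T.In (r - 1) c i) := by
    rw [in_iff (T.shape.up_left_mem (by omega) le_rfl h.mem)]
  have hright : (0 < c ∧ i + 1 ∈ (T.entry r (c - 1)).leg) ↔
      (0 < c ∧ T.InLeg r (c - 1) (i + 1) ∧ ∃ y < i + 1, T.InLeg r (c - 1) y) := by
    rw [hT.mem_leg_iff (T.shape.up_left_mem le_rfl (by omega) h.mem)]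
  unfold eAct
  split_ifs with h1 h2 h3
  · have hd := hdown.1 h1
    have hf := hT.down_facts h hq hd.1 hd.2
    refine ⟨EStep.down hd.1 hd.2 ⟨rfl, fun r₀ c₀ y => ?_, fun r₀ c₀ y => ?_⟩, ?_⟩
    · rw [inLeg_modify, inLeg_modify]
      split_ifs with h4 h5
      · obtain ⟨rfl, rfl⟩ := h4
        rw [entry_modify_of_ne _ (by omega)]; rfl
      · obtain ⟨rfl, rfl⟩ := h5
        rfl
      · rfl
    · obtain ⟨ρ, rfl⟩ : ∃ ρ, r = ρ + 1 := ⟨r - 1, by omega⟩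
      simp only [Nat.add_sub_cancel] at *
      clear hright hdown h1
      rw [armCount_modify (by exact hd.2.mem), armCount_modify h.mem]
      split_ifs with h4 h5 h6 h7 h8 h9 h10 <;>
        simp_all [Hook.removeArm, Hook.addArm, entry_modify_of_ne, armCount,
          Multiset.count_erase_of_ne, Multiset.count_cons_of_ne]
    · refine (hT.isCanon.modify fun hm => ?_).modify fun hm => ?_
      · exact hT.isCanon _ _ hm
      · rw [entry_modify_of_ne _ (by omega)]
        exact hT.isCanon _ _ hm
  · have hd := fun hd => h1 (hdown.2 hd)
    have hr := hright.1 h2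
    have hne : (insert i (T.entry r c).extLeg).Nonempty := ⟨i, by simp⟩
    refine ⟨EStep.right hd hr.1 hr.2.1 hr.2.2 ⟨rfl, fun r₀ c₀ y => ?_, fun r₀ c₀ y => ?_⟩, ?_⟩
    · have hcn := hT.isCanon r (c - 1) hr.2.1.1 (i + 1) h2.2
      rw [inLeg_modify, inLeg_modify, shape_modify]
      split_ifs with h4 h5
      · obtain ⟨rfl, rfl⟩ := h4
        rw [entry_modify_of_ne _ (by omega)]
        have := h.mem
        simp only [this, Hook.addExtLeg, Hook.extLeg_ofExtLeg hne, Finset.mem_insert, true_and,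
          InLeg]
        rw [or_comm]
        have : ¬c₀ = c₀ - 1 := by omega
        simp [this]
      · obtain ⟨rfl, rfl⟩ := h5
        have := hr.2.1.1
        simp only [InLeg, this, Hook.extLeg, Finset.mem_insert, Finset.mem_erase, true_and]
        grind
      · exact ⟨fun hh => Or.inl ⟨hh, fun h6 => h5 ⟨h6.1, h6.2.1⟩⟩,
          fun hh => hh.elim And.left fun h6 => absurd ⟨h6.1, h6.2.1⟩ h4⟩
    · rw [armCount_modify (by exact h.mem), armCount_modify hr.2.1.1]
      split_ifs with h4 h5
      · rw [h4.1, h4.2, entry_modify_of_ne _ (by omega)]; rfl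
      · rw [h5.1, h5.2]; rfl
      · rfl
    · refine (hT.isCanon.modify fun hm => ?_).modify fun hm => ?_
      · exact fun x hx => hT.isCanon _ _ hm x (Finset.mem_of_mem_erase hx)
      · rw [entry_modify_of_ne _ (by omega)]
        exact Hook.isCanon_ofExtLeg hne _
  · have hd := fun hd => h1 (hdown.2 hd)
    have hr := fun hr => h2 (hright.2 hr)
    simp only [decide_eq_true_eq] at h3
    refine ⟨EStep.arm hd hr h3 ⟨rfl, fun r₀ c₀ y => ?_, fun r₀ c₀ y => ?_⟩, ?_⟩
    · rw [inLeg_modify]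
      split_ifs with h4
      · obtain ⟨rfl, rfl⟩ := h4
        rfl
      · rfl
    · have hp : 0 < T.armCount r c (i + 1) := by
        rw [← hT.colArm_eq h]
        clear hd hr hright hdown h1 h2
        unfold colPlus at hq
        omega
      rw [armCount_modify h.mem]
      split_ifs with h4 h5 h6 h7 h8 h9 h10 <;>
        simp_all [Hook.replaceArm, armCount,
          Multiset.count_erase_of_ne, Multiset.count_cons_of_ne]
    · exact hT.isCanon.modify fun hm => hT.isCanon _ _ hm
  · have hd := fun hd => h1 (hdown.2 hd)
    have hr := fun hr => h2 (hright.2 hr)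
    have h4 : T.legCount c i + T.colArm c i < T.legCount c (i + 1) := by simpa using h3
    have hne : (insert i ((T.entry r c).extLeg.erase (i + 1))).Nonempty := ⟨i, by simp⟩
    refine ⟨EStep.leg hd hr h4 ⟨rfl, fun r₀ c₀ y => ?_, fun r₀ c₀ y => ?_⟩, ?_⟩
    · rw [inLeg_modify]
      split_ifs with h5
      · obtain ⟨rfl, rfl⟩ := h5
        have := h.mem
        simp [InLeg, this, Hook.replaceExtLeg, Hook.extLeg_ofExtLeg hne, or_comm, and_comm]
      · exact ⟨fun hh => Or.inl ⟨hh, fun h6 => h5 ⟨h6.1, h6.2.1⟩⟩,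
          fun hh => hh.elim And.left fun h6 => absurd ⟨h6.1, h6.2.1⟩ h5⟩
    · rw [armCount_modify h.mem]
      split_ifs with h5
      · obtain ⟨rfl, rfl⟩ := h5
        rfl
      · rfl
    · exact hT.isCanon.modify fun hm => Hook.isCanon_ofExtLeg hne _

/-! ### Effect of a move on the signature -/

theorem ArmMove.legCount {T T' : Filling} {r c x r' c' x' : ℕ}
    (h : ArmMove T r c x r' c' x' T') (c₀ y : ℕ) : T'.legCount c₀ y = T.legCount c₀ y := by
  unfold Filling.legCount
  congr 1
  exact propext (exists_congr fun r₀ => h.leg r₀ c₀ y)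

theorem ArmMove.colArm {T T' : Filling} {r c x r' c' x' : ℕ}
    (h : ArmMove T r c x r' c' x' T') (hx : 0 < T.armCount r c x) (hm : (r', c') ∈ T.shape)
    (c₀ y : ℕ) : T'.colArm c₀ y + (if c₀ = c ∧ y = x then 1 else 0) =
      T.colArm c₀ y + (if c₀ = c' ∧ y = x' then 1 else 0) := by
  have h1 : ∀ c₁ b, (b, c₁) ∈ T.shape → ∀ z : ℕ, (if c₀ = c₁ ∧ y = z then 1 else 0) =
      ∑ r₀ ∈ Finset.range (T.shape.colLen c₀), if r₀ = b ∧ c₀ = c₁ ∧ y = z then 1 else 0 := by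
    intro c₁ b hb z
    by_cases h2 : c₀ = c₁ ∧ y = z
    · obtain ⟨rfl, rfl⟩ := h2
      simp [YoungDiagram.mem_iff_lt_colLen.1 hb]
    · simp [h2]
  rw [h1 c r (mem_of_armCount hx) x, h1 c' r' hm x', Filling.colArm, Filling.colArm, h.shape,
    ← Finset.sum_add_distrib, ← Finset.sum_add_distrib]
  refine Finset.sum_congr rfl fun r₀ _ => ?_
  rw [h.arm]
  by_cases h2 : r₀ = r ∧ c₀ = c ∧ y = x
  · rw [if_pos h2]
    obtain ⟨rfl, rfl, rfl⟩ := h2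
    omega
  · rw [if_neg h2]
    omega

theorem LegMove.colArm {T T' : Filling} {r c x r' c' x' : ℕ}
    (h : LegMove T r c x r' c' x' T') (c₀ y : ℕ) : T'.colArm c₀ y = T.colArm c₀ y := by
  simp only [Filling.colArm, h.arm, h.shape]

theorem LegMove.legCount {T T' : Filling} (hT : T.IsHVT) {r c x r' c' x' : ℕ}
    (h : LegMove T r c x r' c' x' T') (hx : T.InLeg r c x) (c₀ y : ℕ) :
    T'.legCount c₀ y = if c₀ = c' ∧ y = x' then 1 else
      if c₀ = c ∧ y = x then 0 else T.legCount c₀ y := by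
  split_ifs with h1 h2
  · exact legCount_eq_one.2 ⟨r', (h.leg _ _ _).2 (Or.inr ⟨rfl, h1⟩)⟩
  · obtain ⟨rfl, rfl⟩ := h2
    refine legCount_eq_zero.2 fun r₀ h3 => ?_
    rcases (h.leg _ _ _).1 h3 with h4 | h4
    · exact h4.2 ⟨hT.row_eq h4.1.inn hx.inn, rfl, rfl⟩
    · exact h1 h4.2
  · unfold Filling.legCount
    congr 1
    refine propext (exists_congr fun r₀ => ?_)
    rw [h.leg]
    exact ⟨fun h3 => h3.elim And.left fun h4 => absurd h4.2 h1,
      fun h3 => Or.inl ⟨h3, fun h4 => h2 h4.2⟩⟩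

/-- Turning the rightmost unpaired letter `i` into `i + 1`, inside a column. -/
theorem lastMinus_iff_firstPlus {p q p' q' : ℕ → ℕ} {c n : ℕ}
    (hp : ∀ j, j ≠ c → p' j = p j) (hq : ∀ j, j ≠ c → q' j = q j)
    (hpc : p c = p' c + 1) (hqc : q' c = q c + 1) :
    lastMinus p q n = some c ↔ firstPlus p' q' n = some c := by
  rw [lastMinus_eq_some, firstPlus_eq_some]
  have h1 : plusCount p' q' c = plusCount p q c :=
    plusCount_congr (fun j hj => hp j (by omega)) (fun j hj => hq j (by omega))
  refine and_congr_right fun _ => ?_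
  by_cases h2 : plusCount p q c < p c
  swap
  · constructor <;> rintro ⟨h3, h4⟩ <;> omega
  -- Past column `c` the new word carries exactly one more unpaired plus, as long as all minuses are
  -- absorbed. So the condition `p j ≤ plusCount` for the old word is the same as `p' j < plusCount`
  -- for the new one; `h3'` is the same count under the second condition.
  have h3 : ∀ m, c < m → (∀ j, c < j → j < m → p j ≤ plusCount p q j) →
      plusCount p' q' m = plusCount p q m + 1 := by
    intro m hm
    induction m with
    | zero => omega
    | succ m ih =>
      intro h4
      rw [plusCount_succ, plusCount_succ]
      rcases Nat.lt_or_ge c m with h5 | h5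
      · rw [ih h5 fun j h6 h7 => h4 j h6 (by omega), hp m (by omega), hq m (by omega)]
        have := h4 m h5 (by omega)
        omega
      · obtain rfl : m = c := by omega
        rw [h1]
        omega
  have h3' : ∀ m, c < m → (∀ j, c < j → j < m → p' j < plusCount p' q' j) →
      plusCount p' q' m = plusCount p q m + 1 := by
    intro m hm
    induction m with
    | zero => omega
    | succ m ih =>
      intro h4
      rw [plusCount_succ, plusCount_succ]
      rcases Nat.lt_or_ge c m with h5 | h5
      · have h7 := ih h5 fun j h6 h7 => h4 j h6 (by omega)
        have := h4 m h5 (by omega)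
        rw [hp m (by omega), hq m (by omega)]
        rw [hp m (by omega)] at this
        omega
      · obtain rfl : m = c := by omega
        rw [h1]
        omega
  constructor
  · rintro ⟨_, h4⟩
    refine ⟨by omega, by omega, fun j h5 h6 => ?_⟩
    rw [h3 j h5 fun k h7 h8 => h4 k h7 (by omega), hp j (by omega)]
    have := h4 j h5 h6
    omega
  · rintro ⟨_, _, h4⟩
    refine ⟨by omega, fun j h5 h6 => ?_⟩
    have h7 := h3' j h5 fun k h7 h8 => h4 k h7 (by omega)
    have := h4 j h5 h6
    rw [hp j (by omega)] at this
    omega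

/-- The rightmost unpaired letter `i` becomes the leftmost unpaired letter `i + 1`, when a letter
moves to the next column. -/
theorem lastMinus_iff_firstPlus_succ {p q p' q' : ℕ → ℕ} {c n : ℕ} (hn : c + 1 < n)
    (hp : ∀ j, j ≠ c → p' j = p j) (hq : ∀ j, j ≠ c + 1 → q' j = q j)
    (hpc : p c = p' c + 1) (hqc : q c = 0) (hpc' : p (c + 1) = 0)
    (hqc' : q' (c + 1) = q (c + 1) + 1) :
    lastMinus p q n = some c ↔ firstPlus p' q' n = some (c + 1) := by
  have h1 : plusCount p' q' c = plusCount p q c :=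
    plusCount_congr (fun j hj => hp j (by omega)) (fun j hj => hq j (by omega))
  have h0 := plusCount_succ p q c
  have h0' := plusCount_succ p' q' c
  have hq0 := hq c (by omega)
  have hp0 := hp (c + 1) (by omega)
  -- compare with the sequences where the changed letter stays in column `c`
  let q'' : ℕ → ℕ := fun j => if j = c then 1 else q j
  have h2 : lastMinus p q n = some c ↔ firstPlus p' q'' n = some c :=
    lastMinus_iff_firstPlus hp (fun j hj => by simp [q'', hj]) hpc (by simp [q'', hqc])
  rw [h2, firstPlus_eq_some, firstPlus_eq_some]
  have hc : plusCount p' q'' c = plusCount p q c :=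
    plusCount_congr (fun j hj => hp j (by omega)) (fun j hj => if_neg (by omega))
  have h0'' := plusCount_succ p' q'' c
  have hqq : q'' c = 1 := by simp [q'']
  by_cases h4 : plusCount p q c ≤ p' c
  swap
  · constructor <;> rintro ⟨h5, h6, h7⟩ <;> omega
  have h3 : ∀ m, c + 1 < m → plusCount p' q'' m = plusCount p' q' m := by
    intro m hm
    induction m with
    | zero => omega
    | succ m ih =>
      rw [plusCount_succ, plusCount_succ]
      rcases Nat.lt_or_ge (c + 1) m with h5 | h5
      · rw [ih h5, hq m (by omega)]
        rw [show q'' m = q m from if_neg (by omega)]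
      · obtain rfl : m = c + 1 := by omega
        have : q'' (c + 1) = q (c + 1) := by simp [q'']
        omega
  constructor
  · rintro ⟨_, _, _, h8⟩
    refine ⟨hn, by omega, by omega, fun j h5 h6 => ?_⟩
    rw [← h3 j h5]
    exact h8 j (by omega) h6
  · rintro ⟨_, _, _, h8⟩
    refine ⟨by omega, by omega, by omega, fun j h5 h6 => ?_⟩
    rcases Nat.lt_or_ge (c + 1) j with h7 | h7
    · rw [h3 j h7]
      exact h8 j h7 h6
    · obtain rfl : j = c + 1 := by omega
      omega

/-- The dangerous neighbours are now an `i` below and an `i + 1` on the left; the rules (M) and (S)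
take care of them, with `hp` supplying what is needed on the left. The hypothesis `1 ≤ i` keeps the
entries positive. -/
theorem IsHVT.eStep_isLocal {T T' : Filling} (hT : T.IsHVT) {i r c : ℕ} (hi : 1 ≤ i)
    (h : T.In r c (i + 1))
    (hq : 0 < colPlus i T c) (hp : ∀ γ, c = γ + 1 → colPlus i T γ ≤ colMinus i T c)
    (hs : EStep i T r c T') : T'.IsLocal := by
  have hL := hT.isLocal
  have hmin : ∀ {r c y}, T.In r c y → ∃ z, T.InLeg r c z ∧ z ≤ y := by
    intro r c y hy
    rcases hy with hy | hy
    · exact ⟨y, hy, le_rfl⟩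
    · exact hL.arm r c y hy
  rcases hs with ⟨hr, hd, hm⟩ | ⟨hd, hc, hl, hl', hm⟩ | ⟨hd, hl, ha, hm⟩ | ⟨hd, hl, ha, hm⟩
  · have hIn : ∀ r₀ c₀ y, T'.In r₀ c₀ y → T.In r₀ c₀ y := by
      intro r₀ c₀ y hy
      rcases hm.in_of_in hy with hy | ⟨rfl, rfl, rfl⟩
      · exact hy
      · exact hd
    refine ⟨fun r₀ c₀ y hy => hL.pos r₀ c₀ y ((hm.leg _ _ _).1 hy), fun r₀ c₀ y hy => ?_,
      fun r₀ c₀ x y hx hy => hL.row r₀ c₀ x y (hIn _ _ _ hx) ((hm.leg _ _ _).1 hy),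
      fun r₀ c₀ x y hx hy => hL.col r₀ c₀ x y (hIn _ _ _ hx) ((hm.leg _ _ _).1 hy)⟩
    obtain ⟨w, hw, hw'⟩ := hmin (hIn _ _ _ (Or.inr hy))
    exact ⟨w, (hm.leg _ _ _).2 hw, hw'⟩
  · obtain ⟨γ, rfl⟩ : ∃ γ, c = γ + 1 := ⟨c - 1, by omega⟩
    simp only [Nat.add_sub_cancel] at *
    obtain ⟨hf1, hf2, hf3, hf4, hf5⟩ := hT.right_facts h (hp γ rfl) hd hl.inn
    have hIn : ∀ r₀ c₀ y, T'.In r₀ c₀ y → (T.In r₀ c₀ y ∧ ¬(r₀ = r ∧ c₀ = γ ∧ y = i + 1)) ∨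
        (r₀ = r ∧ c₀ = γ + 1 ∧ y = i) := by
      intro r₀ c₀ y hy
      rcases hm.in_of_in hy with h1 | h1
      · refine or_iff_not_imp_right.2 fun h2 => ⟨h1, ?_⟩
        rintro ⟨rfl, rfl, rfl⟩
        rcases hy with hy | hy
        · rcases (hm.leg _ _ _).1 hy with h3 | h3
          · exact h3.2 ⟨rfl, rfl, rfl⟩
          · exact h2 h3
        · rw [hm.arm] at hy
          have := colArm_eq_zero.1 hf4 r₀
          omega
      · exact Or.inr h1
    refine ⟨fun r₀ c₀ y hy => ?_, fun r₀ c₀ y hy => ?_, fun r₀ c₀ x y hx hy => ?_,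
      fun r₀ c₀ x y hx hy => ?_⟩
    · rcases (hm.leg _ _ _).1 hy with h1 | h1
      · exact hL.pos _ _ _ h1.1
      · omega
    · rw [hm.arm] at hy
      obtain ⟨w, hw, hw'⟩ := hmin (Or.inr hy)
      by_cases h1 : r₀ = r ∧ c₀ = γ ∧ w = i + 1
      · obtain ⟨rfl, rfl, rfl⟩ := h1
        obtain ⟨z, hz, hz'⟩ := hl'
        exact ⟨z, (hm.leg _ _ _).2 (Or.inl ⟨hz', by omega⟩), by omega⟩
      · exact ⟨w, (hm.leg _ _ _).2 (Or.inl ⟨hw, h1⟩), hw'⟩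
    · have h1 := hL.row r₀ c₀ x y
      have h2 := hL.row r₀ c₀ (i + 1) y
      have h3 := hL.row r₀ c₀ x (i + 1)
      have := hIn _ _ _ hx
      have := hm.leg r₀ (c₀ + 1) y
      grind
    · have h1 := hL.col r₀ c₀ x y
      have h2 := hL.col r₀ c₀ (i + 1) y
      have h3 := hL.col r₀ c₀ x (i + 1)
      have := hIn _ _ _ hx
      have := hm.leg (r₀ + 1) c₀ y
      grind
  -- The new arm entry `i` needs a leg entry at most `i`. If the minimum of the cell were `i + 1`,
  -- then `ha` would give an `i` in the column, which lies in the same cell or directly below, and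
  -- the latter is excluded by `hd`.
  · have hI : ∃ z, T.InLeg r c z ∧ z ≤ i := by
      obtain ⟨z, hz, hz'⟩ := hmin h
      by_cases h1 : z = i + 1
      · subst h1
        have h2 := legCount_eq_one.2 ⟨r, hz⟩
        obtain ⟨r', h3⟩ := col_pos (by omega : 0 < T.legCount c i + T.colArm c i)
        rcases hT.succ_row h3 h with rfl | ⟨rfl, _⟩
        · exact hmin h3
        · exact absurd ⟨by omega, by simpa using h3⟩ hd
      · exact ⟨z, hz, by omega⟩
    have hIn : ∀ r₀ c₀ y, T'.In r₀ c₀ y → T.In r₀ c₀ y ∨ (r₀ = r ∧ c₀ = c ∧ y = i) :=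
      fun _ _ _ => hm.in_of_in
    refine ⟨fun r₀ c₀ y hy => hL.pos r₀ c₀ y ((hm.leg _ _ _).1 hy), fun r₀ c₀ y hy => ?_,
      fun r₀ c₀ x y hx hy => ?_, fun r₀ c₀ x y hx hy => ?_⟩
    · rcases hIn _ _ _ (Or.inr hy) with h1 | ⟨rfl, rfl, rfl⟩
      · obtain ⟨w, hw, hw'⟩ := hmin h1
        exact ⟨w, (hm.leg _ _ _).2 hw, hw'⟩
      · obtain ⟨z, hz, hz'⟩ := hI
        exact ⟨z, (hm.leg _ _ _).2 hz, hz'⟩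
    · rw [hm.leg] at hy
      rcases hIn _ _ _ hx with h1 | ⟨rfl, rfl, rfl⟩
      · exact hL.row _ _ _ _ h1 hy
      · have := hL.row _ _ _ _ h hy
        omega
    · rw [hm.leg] at hy
      rcases hIn _ _ _ hx with h1 | ⟨rfl, rfl, rfl⟩
      · exact hL.col _ _ _ _ h1 hy
      · have := hL.col _ _ _ _ h hy
        omega
  · have h1 := T.legCount_le_one c (i + 1)
    have hno := no_col (by omega : T.legCount c i + T.colArm c i = 0)
    have hleg : T.InLeg r c (i + 1) := by
      obtain ⟨r', hr'⟩ := legCount_eq_one.1 (by omega : T.legCount c (i + 1) = 1)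
      rwa [hT.row_eq h hr'.inn]
    have hnl : ∀ γ, c = γ + 1 → ¬T.In r γ (i + 1) := by
      rintro γ rfl
      exact hT.not_left h (hp γ rfl) hd fun h2 => hl ⟨by omega, by simpa using h2⟩
    refine ⟨fun r₀ c₀ y hy => ?_, fun r₀ c₀ y hy => ?_, fun r₀ c₀ x y hx hy => ?_,
      fun r₀ c₀ x y hx hy => ?_⟩
    · rcases (hm.leg _ _ _).1 hy with h1 | h1
      · exact hL.pos _ _ _ h1.1
      · omega
    · rw [hm.arm] at hy
      obtain ⟨w, hw, hw'⟩ := hmin (Or.inr hy)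
      by_cases h1 : r₀ = r ∧ c₀ = c ∧ w = i + 1
      · obtain ⟨rfl, rfl, rfl⟩ := h1
        exact ⟨i, (hm.leg _ _ _).2 (Or.inr ⟨rfl, rfl, rfl⟩), by omega⟩
      · exact ⟨w, (hm.leg _ _ _).2 (Or.inl ⟨hw, h1⟩), hw'⟩
    · have h1 := hL.row r₀ c₀ x y
      have h2 := hL.row r₀ c₀ (i + 1) y
      have h3 := hL.row r₀ c₀ x (i + 1)
      have := hm.in_of_in hx
      have := hm.leg r₀ (c₀ + 1) y
      grind
    · have h1 := hL.col r₀ c₀ x y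
      have h2 := hL.col r₀ c₀ (i + 1) y
      have h3 := hL.col r₀ c₀ x (i + 1)
      have := hm.in_of_in hx
      have := hm.leg (r₀ + 1) c₀ y
      grind

/-! ### The operators `f` and `e` are inverse to each other -/

theorem ArmMove.symm {T T' : Filling} {r c x r' c' x' : ℕ} (h : ArmMove T r c x r' c' x' T')
    (hx : 0 < T.armCount r c x) : ArmMove T' r' c' x' r c x T := by
  refine ⟨h.shape.symm, fun r₀ c₀ y => (h.leg r₀ c₀ y).symm, fun r₀ c₀ y => ?_⟩
  rw [h.arm]
  by_cases h1 : r₀ = r ∧ c₀ = c ∧ y = x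
  · obtain ⟨rfl, rfl, rfl⟩ := h1
    simp only [and_self, if_true]
    omega
  · simp only [if_neg h1]
    omega

/-- Extended legs are sets, so the move is reversible only if its target was absent before. -/
theorem LegMove.symm {T T' : Filling} {r c x r' c' x' : ℕ} (h : LegMove T r c x r' c' x' T')
    (hx : T.InLeg r c x) (hx' : ¬T.InLeg r' c' x') : LegMove T' r' c' x' r c x T := by
  refine ⟨h.shape.symm, fun r₀ c₀ y => ?_, fun r₀ c₀ y => (h.arm r₀ c₀ y).symm⟩
  rw [h.leg]
  by_cases h1 : r₀ = r ∧ c₀ = c ∧ y = x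
  · obtain ⟨rfl, rfl, rfl⟩ := h1
    simp [hx]
  · by_cases h2 : r₀ = r' ∧ c₀ = c' ∧ y = x'
    · obtain ⟨rfl, rfl, rfl⟩ := h2
      simp only [h1, hx']
      simp
    · simp only [h1, h2]
      simp

theorem ArmMove.unique {T T₁ T₂ : Filling} {r c x r' c' x' : ℕ}
    (h₁ : ArmMove T r c x r' c' x' T₁) (h₂ : ArmMove T r c x r' c' x' T₂) (hc₁ : T₁.IsCanon)
    (hc₂ : T₂.IsCanon) : T₁ = T₂ :=
  hc₁.ext hc₂ (h₁.shape.trans h₂.shape.symm)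
    (fun _ _ _ => (h₁.leg _ _ _).trans (h₂.leg _ _ _).symm)
    (fun _ _ _ => (h₁.arm _ _ _).trans (h₂.arm _ _ _).symm)

theorem LegMove.unique {T T₁ T₂ : Filling} {r c x r' c' x' : ℕ}
    (h₁ : LegMove T r c x r' c' x' T₁) (h₂ : LegMove T r c x r' c' x' T₂) (hc₁ : T₁.IsCanon)
    (hc₂ : T₂.IsCanon) : T₁ = T₂ :=
  hc₁.ext hc₂ (h₁.shape.trans h₂.shape.symm)
    (fun _ _ _ => (h₁.leg _ _ _).trans (h₂.leg _ _ _).symm)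
    (fun _ _ _ => (h₁.arm _ _ _).trans (h₂.arm _ _ _).symm)

/-- The column loses one unpaired `i` and gains one unpaired `i + 1`; by `hp` there is an unpaired
`i` to lose. -/
theorem ArmMove.select {T T' : Filling} {i r r' c n : ℕ}
    (h : ArmMove T r c i r' c (i + 1) T') (hx : 0 < T.armCount r c i) (hm : (r', c) ∈ T.shape)
    (hp : T.legCount c (i + 1) < T.legCount c i + T.colArm c i) :
    lastMinus (colMinus i T) (colPlus i T) n = some c ↔
      firstPlus (colMinus i T') (colPlus i T') n = some c := by
  have h1 := h.colArm hx hm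
  have h2 := h.legCount
  have h3 := h1 c i
  have h4 := h1 c (i + 1)
  simp at h3 h4
  refine lastMinus_iff_firstPlus (fun j hj => ?_) (fun j hj => ?_) ?_ ?_
  · have := h1 j i
    simp [hj] at this
    simp only [colMinus, h2, this]
  · have := h1 j i
    have h5 := h1 j (i + 1)
    simp [hj] at this h5
    simp only [colPlus, h2, this, h5]
  · simp only [colMinus, h2]
    omega
  · simp only [colPlus, h2]
    omega

theorem LegMove.select {T T' : Filling} (hT : T.IsHVT) {i r c n : ℕ}
    (h : LegMove T r c i r c (i + 1) T') (hx : T.InLeg r c i)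
    (hx' : T.legCount c (i + 1) = 0) (ha : T.colArm c i = 0) :
    lastMinus (colMinus i T) (colPlus i T) n = some c ↔
      firstPlus (colMinus i T') (colPlus i T') n = some c := by
  have h1 := h.legCount hT hx
  have h2 := h.colArm
  have h3 := legCount_eq_one.2 ⟨r, hx⟩
  refine lastMinus_iff_firstPlus (fun j hj => ?_) (fun j hj => ?_) ?_ ?_
  · simp only [colMinus, h2, h1, hj, false_and, if_false]
  · simp only [colPlus, h2, h1, hj, false_and, if_false]
  · simp [colMinus, h2, h1, h3, hx', ha]
  · simp [colPlus, h2, h1, h3, hx', ha]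

/-- The `i + 1` that arrives in column `c` pairs with an `i` there, while the removal of `i` from
column `c + 1` frees the `i + 1` that it was paired with. So the minus disappears from one column
and the plus appears in the next. -/
theorem LegMove.select_succ {T T' : Filling} (hT : T.IsHVT) {i r c n : ℕ} (hn : c + 1 < n)
    (h : LegMove T r (c + 1) i r c (i + 1) T') (hx : T.InLeg r (c + 1) i)
    (hl : T.InLeg r (c + 1) (i + 1)) (ha : T.colArm (c + 1) i = 0)
    (h0 : ∀ r', ¬T.In r' c (i + 1)) (h0' : 0 < T.legCount c i + T.colArm c i) :
    lastMinus (colMinus i T) (colPlus i T) n = some c ↔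
      firstPlus (colMinus i T') (colPlus i T') n = some (c + 1) := by
  have h1 := h.legCount hT hx
  have h2 := h.colArm
  have h3 := legCount_eq_one.2 ⟨r, hx⟩
  have h4 := legCount_eq_one.2 ⟨r, hl⟩
  obtain ⟨h5, h6⟩ := col_eq_zero h0
  refine lastMinus_iff_firstPlus_succ hn (fun j hj => ?_) (fun j hj => ?_) ?_ ?_ ?_ ?_
  · by_cases hj' : j = c + 1
    · subst hj'
      simp [colMinus, h2, h1, h3, h4, ha]
    · simp [colMinus, h2, h1, hj, hj']
  · by_cases hj' : j = c
    · subst hj'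
      simp [colPlus, h2, h1, h5, h6]
      omega
    · simp [colPlus, h2, h1, hj, hj']
  · simp [colMinus, h2, h1, h5]
    omega
  · simp [colPlus, h5, h6]
  · simp [colMinus, h3, h4, ha]
  · simp [colPlus, h2, h1, h3, h4, ha]

theorem IsHVT.f_cases {T T' : Filling} (hT : T.IsHVT) {i : ℕ} (h : T.f i = some T') :
    ∃ r c, lastMinus (colMinus i T) (colPlus i T) (T.shape.rowLen 0) = some c ∧
      T.In r c i ∧ 0 < colMinus i T c ∧ colMinus i T (c + 1) ≤ colPlus i T c ∧
      FStep i T r c T' ∧ T'.IsHVT := by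
  cases hl : lastMinus (colMinus i T) (colPlus i T) (T.shape.rowLen 0) with
  | none => simp [hT.f_eq_none le_rfl hl] at h
  | some c =>
    obtain ⟨r, T'', h1, h2, h3, h4, h5, h6⟩ := hT.f_spec le_rfl hl
    obtain rfl : T'' = T' := by simpa [h] using h6.symm
    exact ⟨r, c, rfl, h1, h2, h3, h4, h5⟩

theorem firstPlus_facts {p q : ℕ → ℕ} {n c : ℕ} (h : firstPlus p q n = some c) :
    0 < q c ∧ ∀ γ, c = γ + 1 → q γ ≤ p c := by
  obtain ⟨h1, h2, h3, _⟩ := firstPlus_eq_some.1 h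
  refine ⟨h3, ?_⟩
  rintro γ rfl
  rw [plusCount_succ] at h2
  omega

theorem IsHVT.e_spec {T : Filling} (hT : T.IsHVT) {i c : ℕ} (hi : 1 ≤ i)
    (h : firstPlus (colMinus i T) (colPlus i T) (T.shape.rowLen 0) = some c) :
    ∃ r T', T.In r c (i + 1) ∧ 0 < colPlus i T c ∧
      (∀ γ, c = γ + 1 → colPlus i T γ ≤ colMinus i T c) ∧
      EStep i T r c T' ∧ T'.IsHVT ∧ T.e i = some T' := by
  obtain ⟨h1, h2⟩ := firstPlus_facts h
  obtain ⟨r, hr, hf⟩ := hT.e_eq_some le_rfl h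
  obtain ⟨h3, h4⟩ := hT.eAct_step hr h1
  exact ⟨r, _, hr, h1, h2, h3, (hT.eStep_isLocal hi hr h1 h2 h3).isHVT h4, hf⟩

theorem IsHVT.e_cases {T T' : Filling} (hT : T.IsHVT) {i : ℕ} (hi : 1 ≤ i) (h : T.e i = some T') :
    ∃ r c, firstPlus (colMinus i T) (colPlus i T) (T.shape.rowLen 0) = some c ∧
      T.In r c (i + 1) ∧ 0 < colPlus i T c ∧
      (∀ γ, c = γ + 1 → colPlus i T γ ≤ colMinus i T c) ∧ EStep i T r c T' ∧ T'.IsHVT := by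
  cases hl : firstPlus (colMinus i T) (colPlus i T) (T.shape.rowLen 0) with
  | none => simp [hT.e_eq_none le_rfl hl] at h
  | some c =>
    obtain ⟨r, T'', h1, h2, h3, h4, h5, h6⟩ := hT.e_spec hi hl
    obtain rfl : T'' = T' := by simpa [h] using h6.symm
    exact ⟨r, c, rfl, h1, h2, h3, h4, h5⟩

/-- For each rule of `f i`, the comparison of signatures identifies the column selected by `e i` in
`T'`, and the position of `i + 1` in this column identifies the cell. The conditions of the other
rules of `e i` are refuted, so `e i` performs the reverse move, which determines a canonical
filling. -/
theorem IsHVT.e_of_f {T T' : Filling} (hT : T.IsHVT) {i : ℕ} (hi : 1 ≤ i)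
    (hf : T.f i = some T') : T'.e i = some T := by
  obtain ⟨r, c, hsel, h, hp, hq, hs, hT'⟩ := hT.f_cases hf
  have hN : T.legCount c (i + 1) < T.legCount c i + T.colArm c i := by
    unfold colMinus at hp; omega
  rcases hs with ⟨hu, hm⟩ | ⟨hu, hr, hm⟩ | ⟨hu, hr, ha, hm⟩ | ⟨hu, hr, ha, hm⟩
  · obtain ⟨hf1, hf2, hf3, hf4⟩ := hT.up_facts h hp hu
    rw [hm.select hf1 hu.mem hN, ← hm.shape] at hsel
    obtain ⟨r₂, T₂, h1, h2, h3, h4, h5, h6⟩ := hT'.e_spec hi hsel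
    have hin : T'.In (r + 1) c (i + 1) := Or.inl ((hm.leg _ _ _).2 hf2)
    obtain rfl := hT'.row_eq hin h1
    have hin' : T'.In r c i := by
      rcases hf4 with h7 | h7
      · exact Or.inl ((hm.leg _ _ _).2 h7)
      · right
        rw [hm.arm]
        simp
        omega
    rw [h6]
    congr 1
    rcases h4 with ⟨_, _, hm'⟩ | ⟨hd, _, _, _, hm'⟩ | ⟨hd, _, _, hm'⟩ | ⟨hd, _, _, hm'⟩
    · exact hm'.unique (hm.symm hf1) h5.isCanon hT.isCanon
    all_goals exact absurd ⟨by omega, by simpa using hin'⟩ hd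
  · obtain ⟨hf1, hf2, hf3, hf4⟩ := hT.left_facts h hq hu hr
    have hn : c + 1 < T.shape.rowLen 0 := YoungDiagram.mem_iff_lt_rowLen.1
      (T.shape.up_left_mem (Nat.zero_le r) le_rfl hr.1)
    rw [hm.select_succ hT hn hr hf1 ((hT.colArm_eq hr.inn).trans hf3) hf4 (by omega),
      ← hm.shape] at hsel
    obtain ⟨r₂, T₂, h1, h2, h3, h4, h5, h6⟩ := hT'.e_spec hi hsel
    have hin : T'.In r (c + 1) (i + 1) := Or.inl ((hm.leg _ _ _).2 (Or.inl ⟨hf1, by omega⟩))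
    obtain rfl := hT'.row_eq hin h1
    have hnd : ¬(0 < r ∧ T'.In (r - 1) (c + 1) i) := by
      rintro ⟨h7, h8⟩
      rcases hm.in_of_in h8 with h9 | h9
      · have := hT.row_eq hr.inn h9
        omega
      · omega
    have hlg : T'.InLeg r (c + 1 - 1) (i + 1) ∧ ∃ y < i + 1, T'.InLeg r (c + 1 - 1) y := by
      obtain ⟨y, hy, hy'⟩ := hT.exists_le h.mem
      have := hy' _ h
      exact ⟨(hm.leg _ _ _).2 (Or.inr ⟨rfl, rfl, rfl⟩), y, by omega,
        (hm.leg _ _ _).2 (Or.inl ⟨hy, by omega⟩)⟩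
    rw [h6]
    congr 1
    rcases h4 with ⟨h7, hd, hm'⟩ | ⟨hd, _, _, _, hm'⟩ | ⟨_, hl, _, hm'⟩ | ⟨_, hl, _, hm'⟩
    · exact absurd ⟨h7, hd⟩ hnd
    · exact hm'.unique (hm.symm hr fun h7 => hf2 h7.inn) h5.isCanon hT.isCanon
    all_goals exact absurd ⟨by omega, hlg⟩ hl
  · rw [hm.select ha h.mem hN, ← hm.shape] at hsel
    obtain ⟨r₂, T₂, h1, h2, h3, h4, h5, h6⟩ := hT'.e_spec hi hsel
    have hin : T'.In r c (i + 1) := by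
      right
      rw [hm.arm]
      simp
    obtain rfl := hT'.row_eq hin h1
    have hnd : ¬(0 < r ∧ T'.In (r - 1) c i) := by
      rintro ⟨h7, h8⟩
      rcases hm.in_of_in h8 with h9 | h9
      · have := hT.row_eq h h9
        omega
      · omega
    have hnl : ¬(0 < c ∧ T'.InLeg r (c - 1) (i + 1)) := by
      rintro ⟨h7, h8⟩
      have := hT.row_le (by omega) ((hm.leg _ _ _).1 h8).inn h
      omega
    have hcl := hm.colArm ha h.mem c i
    rw [h6]
    congr 1
    rcases h4 with ⟨h7, hd, hm'⟩ | ⟨hd, h7, h8, _, hm'⟩ | ⟨_, hl, _, hm'⟩ | ⟨_, hl, h7, hm'⟩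
    · exact absurd ⟨h7, hd⟩ hnd
    · exact absurd ⟨h7, h8⟩ hnl
    · exact hm'.unique (hm.symm ha) h5.isCanon hT.isCanon
    · rw [hm.legCount, hm.legCount] at h7
      simp at hcl
      omega
  · obtain ⟨hf1, hf2⟩ := hT.leg_facts h hp ha
    have ha' : T.colArm c i = 0 := (hT.colArm_eq h).trans ha
    have hf3 := legCount_eq_zero.2 hf2
    rw [hm.select hT hf1 hf3 ha', ← hm.shape] at hsel
    obtain ⟨r₂, T₂, h1, h2, h3, h4, h5, h6⟩ := hT'.e_spec hi hsel
    have hin : T'.In r c (i + 1) := Or.inl ((hm.leg _ _ _).2 (Or.inr ⟨rfl, rfl, rfl⟩))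
    obtain rfl := hT'.row_eq hin h1
    have hnd : ¬(0 < r ∧ T'.In (r - 1) c i) := by
      rintro ⟨h7, h8⟩
      rcases hm.in_of_in h8 with h9 | h9
      · have := hT.row_eq h h9
        omega
      · omega
    have hnl : ¬(0 < c ∧ T'.InLeg r (c - 1) (i + 1)) := by
      rintro ⟨h7, h8⟩
      rcases (hm.leg _ _ _).1 h8 with h9 | h9
      · have := hT.row_le (by omega) h9.1.inn h
        omega
      · omega
    rw [h6]
    congr 1
    rcases h4 with ⟨h7, hd, hm'⟩ | ⟨hd, h7, h8, _, hm'⟩ | ⟨_, hl, h7, hm'⟩ | ⟨_, hl, _, hm'⟩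
    · exact absurd ⟨h7, hd⟩ hnd
    · exact absurd ⟨h7, h8⟩ hnl
    · rw [hm.legCount hT hf1, hm.legCount hT hf1, hm.colArm, ha'] at h7
      simp at h7
    · exact hm'.unique (hm.symm hf1 (hf2 r)) h5.isCanon hT.isCanon

/-- The same comparison of signatures, applied to the reversed move, locates the cell in which `f i`
acts on `T'`, and again only the matching rule is possible. -/
theorem IsHVT.f_of_e {T T' : Filling} (hT : T.IsHVT) {i : ℕ} (hi : 1 ≤ i)
    (he : T.e i = some T') : T'.f i = some T := by
  obtain ⟨r, c, hsel, h, hq, hp, hs, hT'⟩ := hT.e_cases hi he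
  rcases hs with ⟨hr, hd, hm⟩ | ⟨hd, hc, hl, hl', hm⟩ | ⟨hd, hl, ha, hm⟩ | ⟨hd, hl, ha, hm⟩
  · obtain ⟨ρ, rfl⟩ : ∃ ρ, r = ρ + 1 := ⟨r - 1, by omega⟩
    simp only [Nat.add_sub_cancel] at *
    obtain ⟨hf1, hf2⟩ := hT.down_facts h hq hr hd
    have hm2 := hm.symm hf1
    have hcl := hm.colArm hf1 hd.mem c i
    simp at hcl
    have h1 := T.legCount_le_one c (i + 1)
    have h2 := pos_of_in hd
    have hlast := (hm2.select (n := T.shape.rowLen 0) (by rw [hm.arm]; simp)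
      (by rw [hm.shape]; exact h.mem)
      (by rw [hm.legCount, hm.legCount]; omega)).2 hsel
    rw [← hm.shape] at hlast
    obtain ⟨r₂, T₂, h1, h2, h3, h4, h5, h6⟩ := hT'.f_spec le_rfl hlast
    have hin : T'.In ρ c i := by
      right
      rw [hm.arm]
      simp
    obtain rfl := hT'.row_eq hin h1
    rw [h6]
    congr 1
    rcases h4 with ⟨_, hm'⟩ | ⟨hu, _, hm'⟩ | ⟨hu, _, _, hm'⟩ | ⟨hu, _, _, hm'⟩
    · exact hm'.unique hm2 h5.isCanon hT.isCanon
    all_goals exact absurd (Or.inl ((hm.leg _ _ _).2 hf2)) hu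
  · obtain ⟨γ, rfl⟩ : ∃ γ, c = γ + 1 := ⟨c - 1, by omega⟩
    simp only [Nat.add_sub_cancel] at *
    obtain ⟨hf1, hf2, hf3, hf4, hf5⟩ := hT.right_facts h (hp γ rfl) hd hl.inn
    have hm2 := hm.symm hl fun h1 => hf2 _ h1.inn
    have hn : γ + 1 < T.shape.rowLen 0 := YoungDiagram.mem_iff_lt_rowLen.1
      (T.shape.up_left_mem (Nat.zero_le r) le_rfl h.mem)
    have h0 : ∀ r', ¬T'.In r' γ (i + 1) := by
      rintro r' (h1 | h1)
      · rcases (hm.leg _ _ _).1 h1 with h1 | h1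
        · exact h1.2 ⟨hT.row_eq h1.1.inn hl.inn, rfl, rfl⟩
        · omega
      · rw [hm.arm, colArm_eq_zero.1 hf4] at h1
        omega
    have hlr : T'.InLeg r (γ + 1) i := (hm.leg _ _ _).2 (Or.inr ⟨rfl, rfl, rfl⟩)
    have h1 := pos_of_in hf5
    have hlast := (hm2.select_succ hT' hn hlr
      ((hm.leg _ _ _).2 (Or.inl ⟨hf1, by omega⟩))
      (by rw [hm.colArm]; exact (col_eq_zero hf2).2) h0
      (by rw [hm.legCount hT hl, hm.colArm]; simpa using h1)).2 hsel
    rw [← hm.shape] at hlast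
    obtain ⟨r₂, T₂, h1, h2, h3, h4, h5, h6⟩ := hT'.f_spec le_rfl hlast
    have hin : T'.In r γ i := by
      rcases hf5 with h7 | h7
      · exact Or.inl ((hm.leg _ _ _).2 (Or.inl ⟨h7, by omega⟩))
      · exact Or.inr (by rwa [hm.arm])
    obtain rfl := hT'.row_eq hin h1
    rw [h6]
    congr 1
    rcases h4 with ⟨hu, _⟩ | ⟨_, _, hm'⟩ | ⟨_, hr, _, hm'⟩ | ⟨_, hr, _, hm'⟩
    · exact absurd hu (h0 _)
    · exact hm'.unique hm2 h5.isCanon hT.isCanon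
    all_goals exact absurd hlr hr
  · have hf1 : 0 < T.armCount r c (i + 1) := by
      rw [← hT.colArm_eq h]; unfold colPlus at hq; omega
    have hm2 := hm.symm hf1
    have hcl := hm.colArm hf1 h.mem c i
    simp at hcl
    have ha' : 0 < T'.armCount r c i := by rw [hm.arm]; simp
    have hlast := (hm2.select (n := T.shape.rowLen 0) ha'
      (by rw [hm.shape]; exact h.mem) (by rw [hm.legCount, hm.legCount]; omega)).2 hsel
    rw [← hm.shape] at hlast
    obtain ⟨r₂, T₂, h1, h2, h3, h4, h5, h6⟩ := hT'.f_spec le_rfl hlast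
    obtain rfl := hT'.row_eq (Or.inr ha') h1
    rw [h6]
    congr 1
    rcases h4 with ⟨hu, _⟩ | ⟨_, hr, _⟩ | ⟨_, _, _, hm'⟩ | ⟨_, _, h7, _⟩
    · rcases hm.in_of_in hu with h7 | h7
      · have := hT.row_eq h h7
        omega
      · omega
    · have := hT.row_le (Nat.lt_succ_self c) h ((hm.leg _ _ _).1 hr).inn
      omega
    · exact hm'.unique hm2 h5.isCanon hT.isCanon
    · omega
  · have hx := T.legCount_le_one c (i + 1)
    have hno := no_col (by omega : T.legCount c i + T.colArm c i = 0)
    have hleg : T.InLeg r c (i + 1) := by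
      obtain ⟨r', hr'⟩ := legCount_eq_one.1 (by omega : T.legCount c (i + 1) = 1)
      rwa [hT.row_eq h hr'.inn]
    have hm2 := hm.symm hleg fun h1 => hno _ h1.inn
    have hleg' : T'.InLeg r c i := (hm.leg _ _ _).2 (Or.inr ⟨rfl, rfl, rfl⟩)
    have ha0 : T'.armCount r c i = 0 := by
      rw [hm.arm]
      exact colArm_eq_zero.1 (by omega) r
    have hlast := (hm2.select (n := T.shape.rowLen 0) hT' hleg'
      (by rw [hm.legCount hT hleg]; simp) (by rw [hm.colArm]; omega)).2 hsel
    rw [← hm.shape] at hlast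
    obtain ⟨r₂, T₂, h1, h2, h3, h4, h5, h6⟩ := hT'.f_spec le_rfl hlast
    obtain rfl := hT'.row_eq (Or.inl hleg') h1
    rw [h6]
    congr 1
    rcases h4 with ⟨hu, _⟩ | ⟨_, hr, _⟩ | ⟨_, _, h7, _⟩ | ⟨_, _, _, hm'⟩
    · rcases hm.in_of_in hu with h7 | h7
      · have := hT.row_eq h h7
        omega
      · omega
    · rcases (hm.leg _ _ _).1 hr with h7 | h7
      · have := hT.row_le (Nat.lt_succ_self c) h h7.1.inn
        omega
      · omega
    · omega
    · exact hm'.unique hm2 h5.isCanon hT.isCanon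

/-! ### One uncrowding bumping: data, result and semistandardness -/

/-- The data that determine the uncrowding bumping of `T`: the largest arm entry `a` of the
rightmost column `c` with nonzero arm excess lies in row `r`, and `K` is the smallest number `≥ a`
in column `c + 1`, which lies in row `r'`, where `r'` is the first free row if there is none. -/
structure BumpData (T : Filling) (c r a : ℕ) (K : Option ℕ) (r' : ℕ) : Prop where
  pos : 0 < T.armCount r c a
  max : ∀ r₀ x, 0 < T.armCount r₀ c x → x ≤ a
  right : ∀ r₀ c₀ x, c < c₀ → T.armCount r₀ c₀ x = 0
  some : ∀ k, K = Option.some k → T.InLeg r' (c + 1) k ∧ a ≤ k ∧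
    ∀ r₀ y, T.InLeg r₀ (c + 1) y → a ≤ y → k ≤ y
  none : K = Option.none → r' = T.shape.colLen (c + 1) ∧ ∀ r₀ y, T.InLeg r₀ (c + 1) y → y < a

/-- `X` is the result of the uncrowding bumping of `T` with the given data. -/
structure BumpResult (T : Filling) (c r a : ℕ) (K : Option ℕ) (r' : ℕ) (X : Filling) : Prop where
  shape : ∀ r₀ c₀, (r₀, c₀) ∈ X.shape ↔ (r₀, c₀) ∈ T.shape ∨ (r₀ = r' ∧ c₀ = c + 1)
  leg : ∀ r₀ c₀ x, X.InLeg r₀ c₀ x ↔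
    (T.InLeg r₀ c₀ x ∧ ¬(r₀ = r' ∧ c₀ = c + 1 ∧ K = some x) ∧
      ¬(r' = r ∧ r₀ = r ∧ c₀ = c ∧ a < x)) ∨
    (r₀ = r' ∧ c₀ = c + 1 ∧ (x = a ∨ (r' = r ∧ T.InLeg r c x ∧ a < x)))
  arm : ∀ r₀ c₀ x, X.armCount r₀ c₀ x =
    T.armCount r₀ c₀ x - (if r₀ = r ∧ c₀ = c ∧ x = a then 1 else 0) +
      (if r₀ = r' ∧ c₀ = c + 1 ∧ K = some x then 1 else 0)

theorem BumpData.mem {T : Filling} {c r a : ℕ} {K : Option ℕ} {r' : ℕ}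
    (h : BumpData T c r a K r') : T.In r c a := Or.inr h.pos

/-- If `r'` were above `r`, the cell to the right of the bumped letter would exist and contain some
`y ≥ a`, which is smaller than `k` by the column inequality, or contradicts the absence of `k`. In
particular an attached cell has its left neighbour in the diagram. -/
theorem BumpData.row_le {T : Filling} (hT : T.IsHVT) {c r a : ℕ} {K : Option ℕ} {r' : ℕ}
    (h : BumpData T c r a K r') : r' ≤ r := by
  by_contra h1
  have hm : (r, c + 1) ∈ T.shape := by
    cases hK : K with
    | none =>
      have := (h.none hK).1
      exact YoungDiagram.mem_iff_lt_colLen.2 (by omega)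
    | some k => exact T.shape.up_left_mem (by omega) le_rfl (h.some k hK).1.1
  obtain ⟨y, hy⟩ := exists_inLeg hm
  have h2 := hT.row_le (Nat.lt_succ_self c) h.mem hy.inn
  cases hK : K with
  | none =>
    have := (h.none hK).2 r y hy
    omega
  | some k =>
    have h3 := (h.some k hK).2.2 r y hy h2
    have h4 := hT.col_lt (by omega : r < r') hy.inn (h.some k hK).1.inn
    omega

theorem sort_head? (S : Multiset ℕ) :
    ((S.sort (· ≤ ·)).head? = none → S = 0) ∧
    ∀ k, (S.sort (· ≤ ·)).head? = some k → k ∈ S ∧ ∀ y ∈ S, k ≤ y := by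
  have h := Multiset.pairwise_sort S (· ≤ ·)
  have h' : ∀ y, y ∈ S.sort (· ≤ ·) ↔ y ∈ S := fun y => Multiset.mem_sort _
  constructor
  · intro h1
    rw [List.head?_eq_none_iff] at h1
    rw [Multiset.eq_zero_iff_forall_notMem]
    intro y hy
    rw [← h', h1] at hy
    simp at hy
  · intro k hk
    obtain ⟨l, hl⟩ : ∃ l, S.sort (· ≤ ·) = k :: l := by
      cases hs : S.sort (· ≤ ·) with
      | nil => simp [hs] at hk
      | cons y l => simp [hs] at hk; exact ⟨l, by rw [hk]⟩
    rw [hl] at h h'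
    refine ⟨(h' k).1 (by simp), fun y hy => ?_⟩
    rcases List.mem_cons.1 ((h' y).2 hy) with rfl | h1
    · exact le_rfl
    · exact (List.pairwise_cons.1 h).1 y h1

theorem sup_mem {m : Multiset ℕ} (h : m ≠ 0) : m.sup ∈ m ∧ ∀ x ∈ m, x ≤ m.sup := by
  refine ⟨?_, fun x hx => Multiset.le_sup hx⟩
  induction m using Multiset.induction_on with
  | empty => exact absurd rfl h
  | cons x s ih =>
    rw [Multiset.sup_cons]
    by_cases hs : s = 0
    · subst hs; simp
    · rcases le_total x s.sup with h1 | h1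
      · rw [sup_eq_right.2 h1]; exact Multiset.mem_cons_of_mem (ih hs)
      · rw [sup_eq_left.2 h1]; simp

theorem mem_armCells {T : Filling} {r c : ℕ} :
    (r, c) ∈ T.armCells ↔ ∃ x, 0 < T.armCount r c x := by
  simp only [armCells, Finset.mem_filter, YoungDiagram.mem_cells, ne_eq, armCount,
    Multiset.count_pos]
  constructor
  · rintro ⟨_, h⟩
    exact Multiset.exists_mem_of_ne_zero h
  · rintro ⟨x, hx⟩
    refine ⟨mem_of_armCount (Multiset.count_pos.2 hx), ?_⟩
    rintro h
    simp [h] at hx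

theorem armExcess_eq_zero {T : Filling} :
    T.armExcess = 0 ↔ ∀ r c x, T.armCount r c x = 0 := by
  rw [armExcess, Finset.sum_eq_zero_iff]
  constructor
  · intro h r c x
    by_contra h1
    have h2 := h (r, c) (mem_of_armCount (Nat.pos_of_ne_zero h1))
    simp only [Multiset.card_eq_zero] at h2
    simp [armCount, h2] at h1
  · intro h x _
    rw [Multiset.card_eq_zero, Multiset.eq_zero_iff_forall_notMem]
    intro y hy
    have := h x.1 x.2 y
    rw [armCount, Multiset.count_eq_zero] at this
    exact this hy

theorem armCol_eq {T : Filling} {r c a : ℕ} (h : 0 < T.armCount r c a)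
    (h' : ∀ r₀ c₀ x, c < c₀ → T.armCount r₀ c₀ x = 0) : T.armCol = c := by
  apply le_antisymm
  · refine Finset.sup_le fun y hy => ?_
    obtain ⟨x, hx⟩ := mem_armCells.1 (show (y.1, y.2) ∈ T.armCells from hy)
    by_contra h1
    have := h' y.1 y.2 x (by omega)
    omega
  · exact Finset.le_sup (f := Prod.snd) (mem_armCells.2 ⟨a, h⟩)

theorem BumpData.armCol {T : Filling} {c r a : ℕ} {K : Option ℕ} {r' : ℕ}
    (h : BumpData T c r a K r') : T.armCol = c := armCol_eq h.pos h.right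

/-- Since columns increase strictly, the largest arm entry of a column lies in the topmost cell with
a nonempty arm. -/
theorem BumpData.armRow {T : Filling} (hT : T.IsHVT) {c r a : ℕ} {K : Option ℕ} {r' : ℕ}
    (h : BumpData T c r a K r') : T.armRow = r := by
  rw [Filling.armRow, h.armCol]
  apply le_antisymm
  · refine Finset.sup_le fun y hy => ?_
    obtain ⟨y1, y2⟩ := y
    simp only [Finset.mem_filter] at hy
    obtain ⟨hy, rfl⟩ := hy
    obtain ⟨x, hx⟩ := mem_armCells.1 hy
    by_contra h1
    have h2 := hT.col_lt (by simpa using h1) h.mem (Or.inr hx)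
    have h3 := h.max _ _ hx
    omega
  · have hm : (r, c) ∈ T.armCells.filter fun x => x.2 = c :=
      Finset.mem_filter.2 ⟨mem_armCells.2 ⟨a, h.pos⟩, rfl⟩
    exact Finset.le_sup (f := Prod.fst) hm

theorem BumpData.sup_eq {T : Filling} {c r a : ℕ} {K : Option ℕ} {r' : ℕ}
    (h : BumpData T c r a K r') : (T.entry r c).arm.sup = a := by
  apply le_antisymm
  · exact Multiset.sup_le.2 fun x hx => h.max r x (Multiset.count_pos.2 hx)
  · exact Multiset.le_sup (Multiset.count_pos.1 h.pos)

theorem mem_column {T : Filling} {c a x : ℕ} :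
    (x ∈ ∑ r ∈ Finset.range (T.shape.colLen c), (T.entry r c).entries.filter fun x => a ≤ x) ↔
      (∃ r, T.In r c x) ∧ a ≤ x := by
  rw [Multiset.mem_sum]
  constructor
  · rintro ⟨r, hr, hx⟩
    rw [Multiset.mem_filter] at hx
    exact ⟨⟨r, in_iff'.2 ⟨YoungDiagram.mem_iff_lt_colLen.2 (Finset.mem_range.1 hr), hx.1⟩⟩, hx.2⟩
  · rintro ⟨⟨r, hr⟩, hx⟩
    rw [in_iff'] at hr
    exact ⟨r, Finset.mem_range.2 (YoungDiagram.mem_iff_lt_colLen.1 hr.1),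
      Multiset.mem_filter.2 ⟨hr.2, hx⟩⟩

/-- The arms in column `c + 1` are empty, so the search among all entries is a search among extended
legs. -/
theorem BumpData.smallestGE {T : Filling} {c r a : ℕ} {K : Option ℕ} {r' : ℕ}
    (h : BumpData T c r a K r') : T.smallestGE (c + 1) a = K := by
  have hIn : ∀ r₀ y, T.In r₀ (c + 1) y → T.InLeg r₀ (c + 1) y := by
    rintro r₀ y (h1 | h1)
    · exact h1
    · have := h.right r₀ (c + 1) y (by omega)
      omega
  obtain ⟨h1, h2⟩ := sort_head? (∑ r ∈ Finset.range (T.shape.colLen (c + 1)),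
    (T.entry r (c + 1)).entries.filter fun x => a ≤ x)
  unfold Filling.smallestGE
  cases hs : ((∑ r ∈ Finset.range (T.shape.colLen (c + 1)),
    (T.entry r (c + 1)).entries.filter fun x => a ≤ x).sort (· ≤ ·)).head? with
  | none =>
    cases hK : K with
    | none => rfl
    | some k =>
      have h3 := mem_column.2 ⟨⟨r', (h.some k hK).1.inn⟩, (h.some k hK).2.1⟩
      rw [h1 hs] at h3
      simp at h3
  | some k' =>
    obtain ⟨h3, h4⟩ := h2 k' hs
    obtain ⟨⟨r₀, h5⟩, h6⟩ := mem_column.1 h3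
    cases hK : K with
    | none =>
      have := (h.none hK).2 _ _ (hIn _ _ h5)
      omega
    | some k =>
      have h7 := h4 k (mem_column.2 ⟨⟨r', (h.some k hK).1.inn⟩, (h.some k hK).2.1⟩)
      have h8 := (h.some k hK).2.2 _ _ (hIn _ _ h5) h6
      congr 1
      omega

theorem BumpData.rowOf {T : Filling} (hT : T.IsHVT) {c r a k : ℕ} {r' : ℕ}
    (h : BumpData T c r a (Option.some k) r') : T.rowOf (c + 1) k = r' := by
  have h1 := (h.some k rfl).1
  have : (Finset.range (T.shape.colLen (c + 1))).filter
      (fun r => k ∈ (T.entry r (c + 1)).entries) = {r'} := by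
    ext r₀
    simp only [Finset.mem_filter, Finset.mem_range, ← YoungDiagram.mem_iff_lt_colLen,
      Finset.mem_singleton, ← in_iff']
    exact ⟨fun h2 => hT.row_eq h2 h1.inn, fun h2 => h2 ▸ h1.inn⟩
  rw [Filling.rowOf, this]
  simp

theorem exists_bumpData {T : Filling} (h : T.armExcess ≠ 0) :
    ∃ c r a K r', BumpData T c r a K r' := by
  have hne : T.armCells.Nonempty := by
    by_contra h1
    refine h (armExcess_eq_zero.2 fun r c x => ?_)
    by_contra h2
    exact h1 ⟨(r, c), mem_armCells.2 ⟨x, Nat.pos_of_ne_zero h2⟩⟩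
  obtain ⟨⟨r₁, c⟩, h1, h2⟩ := Finset.exists_mem_eq_sup _ hne Prod.snd
  have hright : ∀ r₀ c₀ x, c < c₀ → T.armCount r₀ c₀ x = 0 := by
    intro r₀ c₀ x h3
    by_contra h4
    have h5 := Finset.le_sup (f := Prod.snd) (mem_armCells.2 ⟨x, Nat.pos_of_ne_zero h4⟩)
    rw [h2] at h5
    simp at h5
    omega
  obtain ⟨x₁, hx₁⟩ := mem_armCells.1 h1
  obtain ⟨⟨r, a⟩, h3, h4⟩ : ∃ p : ℕ × ℕ, 0 < T.armCount p.1 c p.2 ∧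
      ∀ r₀ x, 0 < T.armCount r₀ c x → x ≤ p.2 := by
    let S : Multiset ℕ := ∑ r ∈ Finset.range (T.shape.colLen c), (T.entry r c).arm
    have hS : ∀ x, x ∈ S ↔ ∃ r, 0 < T.armCount r c x := by
      intro x
      simp only [S, Multiset.mem_sum, armCount, Multiset.count_pos, Finset.mem_range]
      exact ⟨fun ⟨r, _, hr⟩ => ⟨r, hr⟩, fun ⟨r, hr⟩ => ⟨r, YoungDiagram.mem_iff_lt_colLen.1
        (mem_of_armCount (Multiset.count_pos.2 hr)), hr⟩⟩
    have h5 : S ≠ 0 := by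
      intro h6
      have := (hS x₁).2 ⟨r₁, hx₁⟩
      rw [h6] at this
      simp at this
    obtain ⟨h6, h7⟩ := sup_mem h5
    obtain ⟨r, hr⟩ := (hS _).1 h6
    exact ⟨(r, S.sup), hr, fun r₀ x hx => h7 x ((hS x).2 ⟨r₀, hx⟩)⟩
  by_cases h5 : ∃ k, (∃ r', T.InLeg r' (c + 1) k) ∧ a ≤ k
  · classical
    obtain ⟨⟨r', h6⟩, h7⟩ := Nat.find_spec h5
    refine ⟨c, r, a, some (Nat.find h5), r', h3, h4, hright, ?_, by simp⟩
    rintro k hk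
    obtain rfl : Nat.find h5 = k := by simpa using hk
    exact ⟨h6, h7, fun r₀ y hy hay => Nat.find_min' h5 ⟨⟨r₀, hy⟩, hay⟩⟩
  · refine ⟨c, r, a, none, _, h3, h4, hright, by simp, fun _ => ⟨rfl, fun r₀ y hy => ?_⟩⟩
    by_contra h6
    exact h5 ⟨y, ⟨r₀, hy⟩, by omega⟩

theorem BumpData.unique {T : Filling} (hT : T.IsHVT) {c r a : ℕ} {K : Option ℕ} {r' : ℕ}
    (h : BumpData T c r a K r') {c₁ r₁ a₁ : ℕ} {K₁ : Option ℕ} {r'₁ : ℕ}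
    (h₁ : BumpData T c₁ r₁ a₁ K₁ r'₁) : c₁ = c ∧ r₁ = r ∧ a₁ = a ∧ K₁ = K ∧ r'₁ = r' := by
  obtain rfl : c = c₁ := h.armCol.symm.trans h₁.armCol
  obtain rfl : r = r₁ := (h.armRow hT).symm.trans (h₁.armRow hT)
  obtain rfl : a = a₁ := h.sup_eq.symm.trans h₁.sup_eq
  obtain rfl : K = K₁ := h.smallestGE.symm.trans h₁.smallestGE
  refine ⟨rfl, rfl, rfl, rfl, ?_⟩
  cases hK : K with
  | none => rw [(h.none hK).1, (h₁.none hK).1]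
  | some k => exact hT.row_eq (h₁.some k hK).1.inn (h.some k hK).1.inn

theorem mem_shape_attach {T : Filling} {r c : ℕ} {B : Hook} {r₀ c₀ : ℕ} :
    (r₀, c₀) ∈ (T.attach r c B).shape ↔ (r₀, c₀) ∈ T.shape ∨ (r₀ ≤ r ∧ c₀ ≤ c) := by
  simp only [attach, ofFun, YoungDiagram.mem_sup]
  refine or_congr_right ?_
  rw [← YoungDiagram.mem_cells]
  simp [Finset.mem_Iic, Prod.mk_le_mk]

theorem entry_attach_self (T : Filling) (r c : ℕ) (B : Hook) : (T.attach r c B).entry r c = B := by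
  have : (r, c) ∈ (T.attach r c B).shape := mem_shape_attach.2 (Or.inr ⟨le_rfl, le_rfl⟩)
  simp only [attach, ofFun] at this ⊢
  simp [this]

theorem entry_attach_of_ne {T : Filling} {r c r₀ c₀ : ℕ} (B : Hook) (h : ¬(r₀ = r ∧ c₀ = c)) :
    (T.attach r c B).entry r₀ c₀ = T.entry r₀ c₀ := by
  by_cases hm : (r₀, c₀) ∈ (T.attach r c B).shape
  · simp only [attach, ofFun] at hm ⊢
    simp [hm, h]
  · have h1 : (r₀, c₀) ∉ T.shape := fun h1 => hm (mem_shape_attach.2 (Or.inl h1))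
    rw [Filling.entry_outside _ _ _ hm, T.entry_outside _ _ h1]

/-- Attaching an addable cell to column `c + 1`. -/
theorem bumpResult_attach {T : Filling} {c r a r' : ℕ} {M : Finset ℕ} (g : Hook → Hook)
    (hm : (r, c) ∈ T.shape) (hr : r' = T.shape.colLen (c + 1)) (hle : r' ≤ r)
    (hM : ∀ x, x ∈ M ↔ r' = r ∧ T.InLeg r c x ∧ a < x)
    (hg : ∀ x, x ∈ (g (T.entry r c)).extLeg ↔ T.InLeg r c x ∧ ¬(r' = r ∧ a < x))
    (hg' : (g (T.entry r c)).arm = (T.entry r c).arm.erase a)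
    (hcan : (g (T.entry r c)).IsCanon) (hT : T.IsCanon) :
    BumpResult T c r a none r' ((T.modify r c g).attach r' (c + 1) ⟨a, M, 0⟩) ∧
      ((T.modify r c g).attach r' (c + 1) ⟨a, M, 0⟩).IsCanon := by
  have hnew : (r', c + 1) ∉ T.shape := fun h => by
    have := YoungDiagram.mem_iff_lt_colLen.1 h
    omega
  have hsh : ∀ r₀ c₀, (r₀, c₀) ∈ ((T.modify r c g).attach r' (c + 1) ⟨a, M, 0⟩).shape ↔
      (r₀, c₀) ∈ T.shape ∨ (r₀ = r' ∧ c₀ = c + 1) := by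
    intro r₀ c₀
    rw [mem_shape_attach, shape_modify]
    constructor
    · rintro (h | ⟨h1, h2⟩)
      · exact Or.inl h
      · by_cases h3 : r₀ = r' ∧ c₀ = c + 1
        · exact Or.inr h3
        · left
          by_cases h4 : c₀ = c + 1
          · rw [h4]
            exact YoungDiagram.mem_iff_lt_colLen.2 (by omega)
          · exact T.shape.up_left_mem (by omega) (by omega) hm
    · rintro (h | ⟨rfl, rfl⟩)
      · exact Or.inl h
      · exact Or.inr ⟨le_rfl, le_rfl⟩
  refine ⟨⟨hsh, fun r₀ c₀ x => ?_, fun r₀ c₀ x => ?_⟩, fun r₀ c₀ h => ?_⟩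
  · by_cases h1 : r₀ = r' ∧ c₀ = c + 1
    · obtain ⟨rfl, rfl⟩ := h1
      have h2 : ¬T.InLeg r₀ (c + 1) x := fun h => hnew h.1
      rw [InLeg, entry_attach_self, hsh]
      simp only [Hook.extLeg, Finset.mem_insert, hM, h2, true_and, and_true, or_true, false_and,
        false_or]
    · rw [InLeg, entry_attach_of_ne _ h1, hsh]
      by_cases h2 : r₀ = r ∧ c₀ = c
      · obtain ⟨rfl, rfl⟩ := h2
        rw [entry_modify_self hm, hg]
        simp [hm]
      · rw [entry_modify_of_ne _ h2]
        have h3 : ¬(r' = r ∧ r₀ = r ∧ c₀ = c ∧ a < x) := fun h => h2 ⟨h.2.1, h.2.2.1⟩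
        have h4 : ¬(r₀ = r' ∧ c₀ = c + 1 ∧ (x = a ∨ (r' = r ∧ T.InLeg r c x ∧ a < x))) :=
          fun h => h1 ⟨h.1, h.2.1⟩
        rw [or_iff_left h4, or_iff_left h1]
        simp [h3, InLeg]
  · rw [armCount]
    by_cases h1 : r₀ = r' ∧ c₀ = c + 1
    · obtain ⟨rfl, rfl⟩ := h1
      rw [entry_attach_self]
      have : T.armCount r₀ (c + 1) x = 0 := Nat.eq_zero_of_not_pos fun h =>
        hnew (mem_of_armCount h)
      simp [this]
    · rw [entry_attach_of_ne _ h1]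
      by_cases h2 : r₀ = r ∧ c₀ = c
      · obtain ⟨rfl, rfl⟩ := h2
        rw [entry_modify_self hm, hg']
        by_cases h3 : x = a
        · subst h3; simp [armCount]
        · simp [armCount, Multiset.count_erase_of_ne h3, h3]
      · rw [entry_modify_of_ne _ h2]
        have h3 : ¬(r₀ = r ∧ c₀ = c ∧ x = a) := fun h => h2 ⟨h.1, h.2.1⟩
        simp [h3, armCount]
  · by_cases h1 : r₀ = r' ∧ c₀ = c + 1
    · obtain ⟨rfl, rfl⟩ := h1
      rw [entry_attach_self]
      intro x hx
      exact ((hM x).1 hx).2.2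
    · rw [entry_attach_of_ne _ h1]
      rcases (hsh _ _).1 h with h | h
      · exact hT.modify (fun _ => hcan) r₀ c₀ h
      · exact absurd h h1

/-- Modifying a cell of column `c + 1`. -/
theorem bumpResult_modify {T : Filling} {c r a k r' : ℕ} (g g' : Hook → Hook)
    (hm : (r, c) ∈ T.shape) (hm' : (r', c + 1) ∈ T.shape)
    (hg : ∀ x, x ∈ (g (T.entry r c)).extLeg ↔ T.InLeg r c x ∧ ¬(r' = r ∧ a < x))
    (hg' : (g (T.entry r c)).arm = (T.entry r c).arm.erase a)
    (hcan : (g (T.entry r c)).IsCanon) (hT : T.IsCanon)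
    (hk : ∀ x, x ∈ (g' (T.entry r' (c + 1))).extLeg ↔ (T.InLeg r' (c + 1) x ∧ x ≠ k) ∨ x = a ∨
      (r' = r ∧ T.InLeg r c x ∧ a < x))
    (hk' : (g' (T.entry r' (c + 1))).arm = k ::ₘ (T.entry r' (c + 1)).arm)
    (hcan' : (g' (T.entry r' (c + 1))).IsCanon) :
    BumpResult T c r a (some k) r' ((T.modify r c g).modify r' (c + 1) g') ∧
      ((T.modify r c g).modify r' (c + 1) g').IsCanon := by
  refine ⟨⟨fun r₀ c₀ => ?_, fun r₀ c₀ x => ?_, fun r₀ c₀ x => ?_⟩,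
    (hT.modify fun _ => hcan).modify fun _ => ?_⟩
  · simp only [shape_modify]
    exact ⟨Or.inl, fun h => h.elim id fun h => by rw [h.1, h.2]; exact hm'⟩
  · rw [inLeg_modify, inLeg_modify, shape_modify]
    split_ifs with h1 h2
    · obtain ⟨rfl, rfl⟩ := h1
      have h3 : ¬c + 1 = c := by omega
      rw [entry_modify_of_ne _ (by omega), hk]
      simp only [hm', true_and, h3, Option.some.injEq, false_and, and_false, not_false_iff,
        and_true, ne_eq, eq_comm]
    · obtain ⟨rfl, rfl⟩ := h2
      rw [hg]
      simp [hm]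
    · have h3 : ¬(r' = r ∧ r₀ = r ∧ c₀ = c ∧ a < x) := fun h => h2 ⟨h.2.1, h.2.2.1⟩
      have h4 : ¬(r₀ = r' ∧ c₀ = c + 1 ∧ (x = a ∨ (r' = r ∧ T.InLeg r c x ∧ a < x))) :=
        fun h => h1 ⟨h.1, h.2.1⟩
      have h5 : ¬(r₀ = r' ∧ c₀ = c + 1 ∧ some k = some x) := fun h => h1 ⟨h.1, h.2.1⟩
      simp only [h3, h4, h5, or_false, not_false_iff, and_true]
  · rw [armCount_modify (by exact hm'), armCount_modify hm]
    split_ifs with h1 h2 h3 h4 h5 h6 h7 h8 <;>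
      simp_all [entry_modify_of_ne, armCount, eq_comm]
  · rw [entry_modify_of_ne _ (by omega)]
    exact hcan'

theorem IsHVT.corner_eq {T : Filling} (hT : T.IsHVT) {r c k : ℕ} (h : T.InLeg r c k)
    (hk : ∀ y, T.InLeg r c y → k ≤ y) : (T.entry r c).corner = k := by
  have h1 := hk (T.entry r c).corner ⟨h.1, by simp [Hook.extLeg]⟩
  rcases Hook.mem_extLeg.1 h.2 with h2 | h2
  · exact h2.symm
  · have := hT.isCanon r c h.1 k h2
    omega

/-- From here on a bumping is used only through this entrywise description, which treats the cases
of the definition uniformly: the missing `k` is `none`, and the clauses with `r' = r` account for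
the moved leg entries. -/
theorem BumpData.result {T : Filling} (hT : T.IsHVT) {c r a : ℕ} {K : Option ℕ} {r' : ℕ}
    (h : BumpData T c r a K r') : BumpResult T c r a K r' T.bump ∧ T.bump.IsCanon := by
  have hm := h.mem.mem
  have hle := h.row_le hT
  have hcan := hT.isCanon r c hm
  have hne : T.armExcess ≠ 0 := by
    intro h1
    have := armExcess_eq_zero.1 h1 r c a
    have := h.pos
    omega
  have hca : (T.entry r c).corner ≤ a :=
    (hT.cell r c hm).arm_ge a (Multiset.count_pos.1 h.pos)
  have hleg : ∀ x, T.InLeg r c x ↔ x = (T.entry r c).corner ∨ x ∈ (T.entry r c).leg := by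
    intro x
    rw [InLeg, Hook.mem_extLeg]
    simp [hm]
  unfold bump
  rw [if_neg hne]
  simp only [h.armCol, h.armRow hT, h.sup_eq, h.smallestGE]
  cases hK : K with
  | none =>
    obtain ⟨h1, h2⟩ := h.none hK
    simp only [← h1]
    split_ifs with h3
    · exact bumpResult_attach _ hm h1 hle (by simp [h3])
        (fun x => by simp [h3, InLeg, hm, Hook.removeArm, Hook.extLeg]) rfl hcan hT.isCanon
    · have h3 : r' = r := by simpa using h3
      refine bumpResult_attach _ hm h1 hle (fun x => ?_) (fun x => ?_) rfl ?_ hT.isCanon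
      · rw [hleg, Finset.mem_filter]
        have : x = (T.entry r c).corner → ¬a < x := by omega
        tauto
      · rw [hleg]
        simp only [Hook.extLeg, Finset.mem_insert, Finset.mem_sdiff, Finset.mem_filter]
        have : x = (T.entry r c).corner → ¬a < x := by omega
        tauto
      · intro x hx
        exact hcan x (Finset.mem_sdiff.1 hx).1
  | some k =>
    subst hK
    obtain ⟨h1, h2, h2'⟩ := h.some k rfl
    simp only [h.rowOf hT]
    have hn : (insert a ((T.entry r' (c + 1)).extLeg.erase k)).Nonempty := ⟨a, by simp⟩
    split_ifs with h3
    · refine bumpResult_modify _ _ hm h1.1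
        (fun x => by simp [h3, InLeg, hm, Hook.removeArm, Hook.extLeg]) rfl hcan hT.isCanon
        (fun x => ?_) rfl ?_
      · change x ∈ (Hook.ofExtLeg _ _).extLeg ↔ _
        rw [Hook.extLeg_ofExtLeg hn]
        simp [InLeg, h1.1, h3, or_comm, and_comm]
      · exact Hook.isCanon_ofExtLeg hn _
    · have h3 : r' = r := by simpa using h3
      subst h3
      -- In the same row all entries of the right cell are at least `a`, so the smallest one, its
      -- hook entry, is `k`; replacing the hook entry therefore replaces `k`.
      have hcor : (T.entry r' (c + 1)).corner = k := by
        refine hT.corner_eq h1 fun y hy => h2' _ y hy ?_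
        exact hT.row_le (Nat.lt_succ_self c) h.mem hy.inn
      have hcan' := hT.isCanon _ _ h1.1
      refine bumpResult_modify _ _ hm h1.1 (fun x => ?_) rfl ?_ hT.isCanon (fun x => ?_) rfl ?_
      · rw [hleg]
        simp only [Hook.extLeg, Finset.mem_insert, Finset.mem_sdiff, Finset.mem_filter]
        have : x = (T.entry r' c).corner → ¬a < x := by omega
        tauto
      · intro x hx
        exact hcan x (Finset.mem_sdiff.1 hx).1
      · rw [hleg, InLeg, Hook.mem_extLeg]
        simp only [Hook.extLeg, Finset.mem_insert, Finset.mem_union, Finset.mem_filter]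
        have h5 : x = (T.entry r' c).corner → ¬a < x := by omega
        have h6 : x ∈ (T.entry r' (c + 1)).leg → k < x := fun h => hcor ▸ hcan' x h
        have h7 := h1.1
        rw [hcor]
        constructor
        · rintro (h8 | h8 | h8)
          · exact Or.inr (Or.inl h8)
          · exact Or.inl ⟨⟨h7, Or.inr h8⟩, by have := h6 h8; omega⟩
          · exact Or.inr (Or.inr ⟨trivial, Or.inr h8.1, h8.2⟩)
        · rintro (⟨⟨_, h8⟩, h9⟩ | h8 | ⟨_, h8, h9⟩)
          · rcases h8 with h8 | h8
            · exact absurd h8 h9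
            · exact Or.inr (Or.inl h8)
          · exact Or.inl h8
          · rcases h8 with h8 | h8
            · exact absurd h9 (h5 h8)
            · exact Or.inr (Or.inr ⟨h8, h9⟩)
      · intro x hx
        simp only [Finset.mem_union, Finset.mem_filter] at hx ⊢
        rcases hx with hx | hx
        · have := hcan' x hx
          omega
        · exact hx.2

theorem BumpResult.in_cases {T X : Filling} {c r a : ℕ} {K : Option ℕ} {r' : ℕ}
    (h : BumpData T c r a K r') (hX : BumpResult T c r a K r' X) {r₀ c₀ x : ℕ}
    (hx : X.In r₀ c₀ x) : (T.In r₀ c₀ x ∧ ¬(r' = r ∧ r₀ = r ∧ c₀ = c ∧ a < x)) ∨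
      (r₀ = r' ∧ c₀ = c + 1 ∧ (x = a ∨ (r' = r ∧ T.InLeg r c x ∧ a < x))) := by
  rcases hx with hx | hx
  · rcases (hX.leg _ _ _).1 hx with h1 | h1
    · exact Or.inl ⟨h1.1.inn, h1.2.2⟩
    · exact Or.inr h1
  · left
    rw [hX.arm] at hx
    by_cases h1 : r₀ = r' ∧ c₀ = c + 1 ∧ K = some x
    · refine ⟨?_, by omega⟩
      rw [h1.1, h1.2.1]
      exact (h.some x h1.2.2).1.inn
    · rw [if_neg h1] at hx
      have h2 : 0 < T.armCount r₀ c₀ x := by omega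
      refine ⟨Or.inr h2, ?_⟩
      rintro ⟨_, rfl, rfl, h3⟩
      have := h.max _ _ h2
      omega

theorem BumpData.exists_some {T : Filling} {c r a : ℕ} {K : Option ℕ} {r' : ℕ}
    (h : BumpData T c r a K r') (hm : (r', c + 1) ∈ T.shape) : ∃ k, K = Option.some k := by
  cases hK : K with
  | none =>
    have h1 := (h.none hK).1
    have := YoungDiagram.mem_iff_lt_colLen.1 hm
    omega
  | some k => exact ⟨k, rfl⟩

/-- An entry `≥ a` of column `c + 1` below row `r'` would be smaller than `k`, against the
minimality of `k`. -/
theorem BumpData.lt_of_below {T : Filling} (hT : T.IsHVT) {c r a : ℕ} {K : Option ℕ} {r' : ℕ}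
    (h : BumpData T c r a K r') {r₀ x : ℕ} (hr : r₀ < r') (hx : T.In r₀ (c + 1) x) : x < a := by
  have hx' : T.InLeg r₀ (c + 1) x := by
    rcases hx with h1 | h1
    · exact h1
    · have := h.right r₀ (c + 1) x (by omega)
      omega
  cases hK : K with
  | none => exact (h.none hK).2 _ _ hx'
  | some k =>
    obtain ⟨h1, h2, h3⟩ := h.some k hK
    have := hT.col_lt hr hx h1.inn
    by_contra h4
    have := h3 _ _ hx' (by omega)
    omega

/-- The letter `a` takes the place of the least entry `≥ a`, so it fits above the entries below it
and under those above and to the right of `k`. Only the row inequality with the cell on its left is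
at risk, and this is why the leg entries larger than `a` move along when both cells are in the same
row. -/
theorem BumpResult.isLocal {T X : Filling} (hT : T.IsHVT) {c r a : ℕ} {K : Option ℕ} {r' : ℕ}
    (h : BumpData T c r a K r') (hX : BumpResult T c r a K r' X) : X.IsLocal := by
  have hL := hT.isLocal
  have hle := h.row_le hT
  have hleg : ∀ r₀ c₀ x, X.InLeg r₀ c₀ x →
      (T.InLeg r₀ c₀ x ∨ (r₀ = r' ∧ c₀ = c + 1 ∧ (x = a ∨ (r' = r ∧ T.InLeg r c x ∧ a < x)))) := by
    intro r₀ c₀ x hx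
    rcases (hX.leg _ _ _).1 hx with h1 | h1
    · exact Or.inl h1.1
    · exact Or.inr h1
  refine ⟨fun r₀ c₀ x hx => ?_, fun r₀ c₀ x hx => ?_, fun r₀ c₀ x y hx hy => ?_,
    fun r₀ c₀ x y hx hy => ?_⟩
  · rcases hleg _ _ _ hx with h1 | ⟨_, _, rfl | ⟨_, h1, _⟩⟩
    · exact hL.pos _ _ _ h1
    · obtain ⟨y, hy, hy'⟩ := hL.arm _ _ _ h.pos
      have := hL.pos _ _ _ hy
      omega
    · exact hL.pos _ _ _ h1
  · rw [hX.arm] at hx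
    by_cases h1 : r₀ = r' ∧ c₀ = c + 1 ∧ K = some x
    · obtain ⟨rfl, rfl, h2⟩ := h1
      exact ⟨a, (hX.leg _ _ _).2 (Or.inr ⟨rfl, rfl, Or.inl rfl⟩), (h.some x h2).2.1⟩
    · rw [if_neg h1] at hx
      have h2 : 0 < T.armCount r₀ c₀ x := by omega
      have h3 : c₀ ≤ c := by
        by_contra h3
        have := h.right r₀ c₀ x (by omega)
        omega
      obtain ⟨y, hy, hy'⟩ := hL.arm _ _ _ h2
      refine ⟨y, (hX.leg _ _ _).2 (Or.inl ⟨hy, by omega, ?_⟩), hy'⟩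
      rintro ⟨_, rfl, rfl, h4⟩
      have := h.max _ _ h2
      omega
  · rcases BumpResult.in_cases h hX hx with ⟨h1, h2⟩ | ⟨rfl, rfl, h1⟩
    · rcases hleg _ _ _ hy with h3 | ⟨rfl, h3, h4⟩
      · exact hL.row _ _ _ _ h1 h3
      · obtain rfl : c₀ = c := by omega
        -- In a lower row the entries of column `c` are smaller than `a`; in the same row the leg
        -- entries larger than `a` have left and `a` is the largest arm entry.
        have h5 : x ≤ a := by
          by_cases h6 : r₀ = r
          · by_contra h7
            exact h2 ⟨h6, h6, rfl, by omega⟩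
          · exact (hT.col_lt (by omega) h1 h.mem).le
        rcases h4 with h4 | h4 <;> omega
    · rcases hleg _ _ _ hy with h3 | h3
      · have hm := T.shape.up_left_mem le_rfl (by omega : c + 1 ≤ c + 1 + 1) h3.1
        rcases h1 with rfl | ⟨rfl, h1, h4⟩
        · obtain ⟨k, hk⟩ := h.exists_some hm
          obtain ⟨h5, h6, _⟩ := h.some k hk
          exact h6.trans (hL.row _ _ _ _ h5.inn h3)
        · exact hT.row_le (by omega) h1.inn h3.inn
      · omega
  · rcases BumpResult.in_cases h hX hx with ⟨h1, h2⟩ | ⟨rfl, rfl, h1⟩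
    · rcases hleg _ _ _ hy with h3 | ⟨rfl, rfl, h4⟩
      · exact hL.col _ _ _ _ h1 h3
      · have := h.lt_of_below hT (Nat.lt_succ_self r₀) h1
        rcases h4 with h4 | h4 <;> omega
    · rcases hleg _ _ _ hy with h3 | h3
      · rcases h1 with rfl | ⟨rfl, h1, h4⟩
        · obtain ⟨k, hk⟩ := h.exists_some (T.shape.up_left_mem (by omega) le_rfl h3.1)
          obtain ⟨h5, h6, _⟩ := h.some k hk
          exact h6.trans_lt (hL.col _ _ _ _ h5.inn h3)
        -- A moved leg entry is compared with the cell above its new position through the cell above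
        -- its old position.
        · obtain ⟨z, hz⟩ := exists_inLeg
            (T.shape.up_left_mem le_rfl (by omega : c ≤ c + 1) h3.1)
          exact (hL.col _ _ _ _ h1.inn hz).trans_le (hT.row_le (by omega) hz.inn h3.inn)
      · omega

theorem BumpData.isHVT {T : Filling} (hT : T.IsHVT) {c r a : ℕ} {K : Option ℕ} {r' : ℕ}
    (h : BumpData T c r a K r') : T.bump.IsHVT :=
  (BumpResult.isLocal hT h (h.result hT).1).isHVT (h.result hT).2

theorem bump_of_armExcess_eq_zero {T : Filling} (h : T.armExcess = 0) : T.bump = T := by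
  rw [bump, if_pos h]

theorem IsHVT.bump {T : Filling} (hT : T.IsHVT) : T.bump.IsHVT := by
  by_cases h : T.armExcess = 0
  · rwa [bump_of_armExcess_eq_zero h]
  · obtain ⟨c, r, a, K, r', hd⟩ := exists_bumpData h
    exact hd.isHVT hT

/-! ### A bumping preserves the signature of its pair of columns -/

theorem colArm_eq_sum {T : Filling} {c n : ℕ} (hn : T.shape.colLen c ≤ n) (x : ℕ) :
    T.colArm c x = ∑ r ∈ Finset.range n, T.armCount r c x := by
  rw [colArm]
  refine Finset.sum_subset (by simpa using hn) fun r _ hr => ?_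
  by_contra h
  have := YoungDiagram.mem_iff_lt_colLen.1 (mem_of_armCount (Nat.pos_of_ne_zero h))
  simp at hr
  omega

set_option maxHeartbeats 2000000 in
/-- The arithmetic behind the invariance of the signature: `l` and `m` count the letters `i` and
`i + 1` in the extended legs and in the arms of the two columns, before and after the bumping. -/
theorem signature_arith {a i l₀ l₁ m₀ m₁ L₀ L₁ M₀ M₁ l₀' l₁' m₀' m₁' L₀' L₁' M₀' M₁' : ℕ}
    {μ₀ μ₁ κ₀ κ₁ : Prop} [Decidable μ₀] [Decidable μ₁] [Decidable κ₀] [Decidable κ₁]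
    (e1 : l₀' = if μ₀ then 0 else l₀) (e2 : l₁' = if μ₁ then 0 else l₁)
    (e3 : L₀' = if i = a ∨ μ₀ then 1 else if κ₀ then 0 else L₀)
    (e4 : L₁' = if i + 1 = a ∨ μ₁ then 1 else if κ₁ then 0 else L₁)
    (e5 : m₀' + (if i = a then 1 else 0) = m₀) (e6 : m₁' + (if i + 1 = a then 1 else 0) = m₁)
    (e7 : M₀' = M₀ + if κ₀ then 1 else 0) (e8 : M₁' = M₁ + if κ₁ then 1 else 0)
    (f1 : μ₀ → l₀ = 1) (f2 : μ₁ → l₁ = 1) (f3 : l₀ ≤ 1) (f4 : l₁ ≤ 1) (f5 : L₀ ≤ 1) (f6 : L₁ ≤ 1)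
    (f7 : a < i → m₀ = 0) (f8 : a < i + 1 → m₁ = 0) (f9 : M₀ = 0) (f10 : M₁ = 0)
    (f11 : μ₀ → a < i) (f12 : μ₁ → a < i + 1) (hμ : μ₁ → a < i → l₀ = 1 → μ₀)
    (g0 : κ₀ → L₀ = 1 ∧ a ≤ i) (g1 : κ₁ → L₁ = 1 ∧ a ≤ i + 1 ∧ (a ≤ i → L₀ = 0))
    (g2 : κ₀ → ¬κ₁) (g5 : a = i → L₀ = 1 → κ₀) (g6 : a = i + 1 → L₁ = 1 → κ₁)
    (g7 : a = i → L₀ = 0 → L₁ = 1 → κ₁) (g8 : μ₀ → L₀ = 1 → κ₀) (g9 : μ₁ → L₁ = 1 → κ₁)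
    (g10 : μ₁ → L₀ = 0) (g11 : μ₀ → L₀ = 0 → L₁ = 1 → κ₁) (ha : a = i → 0 < m₀)
    (ha' : a = i + 1 → 0 < m₁) :
    l₀ + m₀ - l₁ + (L₀ + M₀ - L₁ - (m₁ + (l₁ - (l₀ + m₀)))) =
      l₀' + m₀' - l₁' + (L₀' + M₀' - L₁' - (m₁' + (l₁' - (l₀' + m₀')))) ∧
    M₁ + (L₁ - (L₀ + M₀)) + (m₁ + (l₁ - (l₀ + m₀)) - (L₀ + M₀ - L₁)) =
      M₁' + (L₁' - (L₀' + M₀')) + (m₁' + (l₁' - (l₀' + m₀')) - (L₀' + M₀' - L₁')) := by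
  -- Lower-case letters refer to column `c`, capitals to column `c + 1`. The propositions `μ₀`, `μ₁`
  -- say that `i`, `i + 1` is a moved leg entry, and `κ₀`, `κ₁` that it is the displaced entry `k`.
  -- Once these and the position of `a` are fixed, the claim is linear arithmetic.
  have h1 : (i = a ∧ i + 1 ≠ a) ∨ (i ≠ a ∧ i + 1 = a) ∨ (i ≠ a ∧ i + 1 ≠ a) := by omega
  subst f9 f10
  by_cases hμ₀ : μ₀ <;> by_cases hμ₁ : μ₁ <;> by_cases hκ₀ : κ₀ <;> by_cases hκ₁ : κ₁ <;>
    simp only [hμ₀, hμ₁, hκ₀, hκ₁, or_true, or_false, if_true, if_false, true_imp_iff,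
      false_imp_iff, not_true, imp_false] at * <;>
    rcases h1 with ⟨h1, h2⟩ | ⟨h1, h2⟩ | ⟨h1, h2⟩ <;>
    simp only [h1, h2, Nat.succ_ne_self, if_true, if_false] at e3 e4 e5 e6 <;>
    subst e1 e2 e3 e4 e7 e8 <;> omega

section Columns

variable {T X : Filling} {c r a : ℕ} {K : Option ℕ} {r' : ℕ}

theorem BumpResult.colArm (h : BumpData T c r a K r') (hX : BumpResult T c r a K r' X)
    (c₀ y : ℕ) : X.colArm c₀ y + (if c₀ = c ∧ y = a then 1 else 0) =
      T.colArm c₀ y + (if c₀ = c + 1 ∧ K = some y then 1 else 0) := by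
  let n := X.shape.colLen c₀ + T.shape.colLen c₀ + r + r' + 1
  have h1 : ∀ (P : Prop) [Decidable P] b, b < n → (if P then 1 else 0) =
      ∑ r₀ ∈ Finset.range n, if r₀ = b ∧ P then 1 else 0 := by
    intro P _ b hb
    by_cases h2 : P
    · simp [h2, hb]
    · simp [h2]
  rw [h1 (c₀ = c ∧ y = a) r (by omega), h1 (c₀ = c + 1 ∧ K = some y) r' (by omega),
    colArm_eq_sum (n := n) (by omega), colArm_eq_sum (n := n) (by omega),
    ← Finset.sum_add_distrib, ← Finset.sum_add_distrib]
  refine Finset.sum_congr rfl fun r₀ _ => ?_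
  rw [hX.arm]
  by_cases h2 : r₀ = r ∧ c₀ = c ∧ y = a
  · rw [if_pos h2]
    obtain ⟨rfl, rfl, rfl⟩ := h2
    have := h.pos
    omega
  · rw [if_neg h2]
    omega

theorem BumpResult.legCount_of_ne (hX : BumpResult T c r a K r' X) {c₀ : ℕ} (h : c₀ ≠ c)
    (h' : c₀ ≠ c + 1) (y : ℕ) : X.legCount c₀ y = T.legCount c₀ y := by
  unfold Filling.legCount
  congr 1
  refine propext (exists_congr fun r₀ => ?_)
  rw [hX.leg]
  exact ⟨fun h1 => h1.elim And.left fun h1 => absurd h1.2.1 h',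
    fun h1 => Or.inl ⟨h1, by omega, by omega⟩⟩

open Classical in
theorem BumpResult.legCount_self (hT : T.IsHVT) (hX : BumpResult T c r a K r' X) (y : ℕ) :
    X.legCount c y = if r' = r ∧ T.InLeg r c y ∧ a < y then 0 else T.legCount c y := by
  split_ifs with h
  · refine legCount_eq_zero.2 fun r₀ h1 => ?_
    rcases (hX.leg _ _ _).1 h1 with ⟨h2, _, h3⟩ | h2
    · exact h3 ⟨h.1, hT.row_eq h2.inn h.2.1.inn, rfl, h.2.2⟩
    · omega
  · unfold Filling.legCount
    congr 1
    refine propext (exists_congr fun r₀ => ?_)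
    rw [hX.leg]
    refine ⟨fun h1 => h1.elim And.left fun h1 => by omega, fun h1 => Or.inl ⟨h1, by omega, ?_⟩⟩
    rintro ⟨h2, rfl, _, h3⟩
    exact h ⟨h2, h1, h3⟩

open Classical in
theorem BumpResult.legCount_succ (hT : T.IsHVT) (h : BumpData T c r a K r')
    (hX : BumpResult T c r a K r' X) (y : ℕ) :
    X.legCount (c + 1) y = if y = a ∨ (r' = r ∧ T.InLeg r c y ∧ a < y) then 1 else
      if K = some y then 0 else T.legCount (c + 1) y := by
  split_ifs with h1 h2
  · exact legCount_eq_one.2 ⟨r', (hX.leg _ _ _).2 (Or.inr ⟨rfl, rfl, h1⟩)⟩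
  · refine legCount_eq_zero.2 fun r₀ h3 => ?_
    rcases (hX.leg _ _ _).1 h3 with ⟨h4, h5, _⟩ | h4
    · exact h5 ⟨hT.row_eq h4.inn (h.some y h2).1.inn, rfl, h2⟩
    · exact h1 h4.2.2
  · unfold Filling.legCount
    congr 1
    refine propext (exists_congr fun r₀ => ?_)
    rw [hX.leg]
    exact ⟨fun h3 => h3.elim And.left fun h3 => absurd h3.2.2 h1,
      fun h3 => Or.inl ⟨h3, fun h4 => h2 h4.2.2, by omega⟩⟩

/-- The uncrowding bumping does not change the combined signature of the two columns that it
affects. -/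
theorem BumpResult.signature (hT : T.IsHVT) (h : BumpData T c r a K r')
    (hX : BumpResult T c r a K r' X) (i : ℕ) :
    colMinus i T c + (colMinus i T (c + 1) - colPlus i T c) =
      colMinus i X c + (colMinus i X (c + 1) - colPlus i X c) ∧
    colPlus i T (c + 1) + (colPlus i T c - colMinus i T (c + 1)) =
      colPlus i X (c + 1) + (colPlus i X c - colMinus i X (c + 1)) := by
  classical
  have hl : ∀ y, T.legCount c y ≤ 1 := T.legCount_le_one c
  have hl' : ∀ y, T.legCount (c + 1) y ≤ 1 := T.legCount_le_one (c + 1)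
  have hm0 : ∀ y, a < y → T.colArm c y = 0 := by
    intro y hy
    refine colArm_eq_zero.2 fun r₀ => Nat.eq_zero_of_not_pos fun h1 => ?_
    have := h.max _ _ h1
    omega
  have hma : 0 < T.colArm c a := by
    rw [hT.colArm_eq h.mem]
    exact h.pos
  have hm1 : ∀ y, T.colArm (c + 1) y = 0 := fun y =>
    colArm_eq_zero.2 fun r₀ => h.right r₀ _ y (by omega)
  have hk : ∀ k, K = some k → T.legCount (c + 1) k = 1 ∧ a ≤ k ∧
      ∀ y, a ≤ y → y < k → T.legCount (c + 1) y = 0 := by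
    intro k hk
    obtain ⟨h1, h2, h3⟩ := h.some k hk
    refine ⟨legCount_eq_one.2 ⟨_, h1⟩, h2, fun y h4 h5 => legCount_eq_zero.2 fun r₀ h6 => ?_⟩
    have := h3 _ _ h6 h4
    omega
  have hk0 : K = none → ∀ y, a ≤ y → T.legCount (c + 1) y = 0 := by
    intro hk y hy
    refine legCount_eq_zero.2 fun r₀ h6 => ?_
    have := (h.none hk).2 _ _ h6
    omega
  have hμ : ∀ y, (r' = r ∧ T.InLeg r c y ∧ a < y) → T.legCount c y = 1 ∧ a < y ∧
      ∀ k, K = some k → y ≤ k := by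
    rintro y ⟨h1, h2, h3⟩
    refine ⟨legCount_eq_one.2 ⟨_, h2⟩, h3, fun k hk => ?_⟩
    subst h1
    exact hT.row_le (Nat.lt_succ_self c) h2.inn (h.some k hk).1.inn
  have hμ' : (r' = r ∧ T.InLeg r c (i + 1) ∧ a < i + 1) → a < i → T.legCount c i = 1 →
      (r' = r ∧ T.InLeg r c i ∧ a < i) := by
    rintro ⟨h1, h2, h3⟩ h4 h5
    obtain ⟨r₀, h6⟩ := legCount_eq_one.1 h5
    rcases hT.succ_row h6.inn h2.inn with rfl | ⟨rfl, _⟩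
    · exact ⟨h1, h6, h4⟩
    · have := hT.col_lt (Nat.lt_succ_self r₀) h6.inn h.mem
      omega
  have e1 := hX.legCount_self hT i
  have e2 := hX.legCount_self hT (i + 1)
  have e3 := hX.legCount_succ hT h i
  have e4 := hX.legCount_succ hT h (i + 1)
  have e5 := hX.colArm h c i
  have e6 := hX.colArm h c (i + 1)
  have e7 := hX.colArm h (c + 1) i
  have e8 := hX.colArm h (c + 1) (i + 1)
  have f1 := hμ i
  have f2 := hμ (i + 1)
  have f3 := hl i
  have f4 := hl (i + 1)
  have f5 := hl' i
  have f6 := hl' (i + 1)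
  have f7 := hm0 i
  have f8 := hm0 (i + 1)
  have f9 := hm1 i
  have f10 := hm1 (i + 1)
  simp only [true_and, Nat.succ_ne_self, Nat.left_eq_add, one_ne_zero, false_and, if_false,
    add_zero] at e5 e6 e7 e8
  have g0 : K = some i → T.legCount (c + 1) i = 1 ∧ a ≤ i := fun h1 => ⟨(hk i h1).1, (hk i h1).2.1⟩
  have g1 : K = some (i + 1) → T.legCount (c + 1) (i + 1) = 1 ∧ a ≤ i + 1 ∧
      (a ≤ i → T.legCount (c + 1) i = 0) := fun h1 =>
    ⟨(hk _ h1).1, (hk _ h1).2.1, fun h2 => (hk _ h1).2.2 i h2 (by omega)⟩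
  have g2 : K = some i → K ≠ some (i + 1) := by
    rintro h1 h2
    rw [h1] at h2
    simp at h2
  -- If the next column has a leg entry `y ≥ a`, then `k` exists and is at most `y`; with a bound
  -- from the other side this pins down `k`, which gives `g5` to `g11`.
  have g3 : ∀ y, a ≤ y → T.legCount (c + 1) y = 1 → ∃ k, K = some k ∧ k ≤ y := by
    intro y h1 h2
    cases hK : K with
    | none => have := hk0 hK y h1; omega
    | some k =>
      refine ⟨k, rfl, ?_⟩
      by_contra h3
      have := (hk k hK).2.2 y h1 (by omega)
      omega
  have g4 : ∀ y, a ≤ y → T.legCount (c + 1) y = 1 → (∀ k, K = some k → y ≤ k) → K = some y := by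
    intro y h1 h2 h3
    obtain ⟨k, h4, h5⟩ := g3 y h1 h2
    have := h3 k h4
    rw [h4]
    congr 1
    omega
  have g5 : a = i → T.legCount (c + 1) i = 1 → K = some i := fun h1 h2 =>
    g4 i h1.le h2 fun k hk' => h1 ▸ (hk k hk').2.1
  have g6 : a = i + 1 → T.legCount (c + 1) (i + 1) = 1 → K = some (i + 1) := fun h1 h2 =>
    g4 _ h1.le h2 fun k hk' => h1 ▸ (hk k hk').2.1
  have g7 : a = i → T.legCount (c + 1) i = 0 → T.legCount (c + 1) (i + 1) = 1 →
      K = some (i + 1) := fun h1 h0 h2 => g4 _ (by omega) h2 fun k hk' => by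
    have h3 := (hk k hk').2.1
    by_contra h4
    obtain rfl : k = i := by omega
    have := (hk k hk').1
    omega
  have g8 : (r' = r ∧ T.InLeg r c i ∧ a < i) → T.legCount (c + 1) i = 1 → K = some i :=
    fun h1 h2 => g4 i h1.2.2.le h2 (f1 h1).2.2
  have g9 : (r' = r ∧ T.InLeg r c (i + 1) ∧ a < i + 1) →
      T.legCount (c + 1) (i + 1) = 1 → K = some (i + 1) :=
    fun h1 h2 => g4 _ h1.2.2.le h2 (f2 h1).2.2
  have g10 : (r' = r ∧ T.InLeg r c (i + 1) ∧ a < i + 1) → T.legCount (c + 1) i = 0 := by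
    intro h1
    by_contra h2
    obtain ⟨k, h3, h4⟩ := g3 i (by omega) (by omega)
    have := (f2 h1).2.2 k h3
    omega
  have g11 : (r' = r ∧ T.InLeg r c i ∧ a < i) → T.legCount (c + 1) i = 0 →
      T.legCount (c + 1) (i + 1) = 1 → K = some (i + 1) :=
    fun h1 h0 h2 => g4 _ (by omega) h2 fun k hk' => by
      have h3 := (f1 h1).2.2 k hk'
      by_contra h4
      obtain rfl : k = i := by omega
      have := (hk k hk').1
      omega
  have hma' : a = i → 0 < T.colArm c i := fun h1 => h1 ▸ hma
  have hma'' : a = i + 1 → 0 < T.colArm c (i + 1) := fun h1 => h1 ▸ hma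
  replace f1 := fun h1 => (f1 h1).1
  replace f2 := fun h1 => (f2 h1).1
  have f11 : (r' = r ∧ T.InLeg r c i ∧ a < i) → a < i := fun h1 => h1.2.2
  have f12 : (r' = r ∧ T.InLeg r c (i + 1) ∧ a < i + 1) → a < i + 1 := fun h1 => h1.2.2
  exact signature_arith e1 e2 e3 e4 e5 e6 e7 e8 f1 f2 f3 f4 f5 f6 f7 f8 f9 f10 f11 f12 hμ' g0 g1
    g2 g5 g6 g7 g8 g9 g10 g11 hma' hma''

end Columns

/-! ### Commutation of one bumping with `f`, case by case -/

section Commute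

variable {T T' X X' : Filling} {i c r a r' : ℕ} {K : Option ℕ}

/-- The conditions of the four rules exclude each other. So it suffices to exhibit some rule by
which the bumped tableaux are related. -/
theorem FStep.unique {Y Y' : Filling} {r c : ℕ} (h : FStep i T r c Y) (h' : FStep i T r c Y')
    (hY : Y.IsCanon) (hY' : Y'.IsCanon) : Y = Y' := by
  cases h <;> cases h' <;> first
    | contradiction
    | exact ArmMove.unique ‹_› ‹_› hY hY'
    | exact LegMove.unique ‹_› ‹_› hY hY'
    | omega

/-- A bumping with the same data commutes with a move in the extended legs. -/
theorem LegMove.bump {r₁ c₁ x r₂ c₂ x' : ℕ} (hm : LegMove T r₁ c₁ x r₂ c₂ x' T')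
    (hX : BumpResult T c r a K r' X) (hX' : BumpResult T' c r a K r' X')
    (h1 : ¬(r₁ = r' ∧ c₁ = c + 1 ∧ (K = some x ∨ x = a ∨ (r' = r ∧ T.InLeg r c x ∧ a < x))))
    (h2 : ¬(r' = r ∧ r₁ = r ∧ c₁ = c ∧ a < x))
    (h3 : ¬(r₂ = r' ∧ c₂ = c + 1 ∧ K = some x'))
    (h4 : ¬(r' = r ∧ r₂ = r ∧ c₂ = c ∧ a < x')) :
    LegMove X r₁ c₁ x r₂ c₂ x' X' where
  shape := by
    ext ⟨r₀, c₀⟩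
    simp only [YoungDiagram.mem_cells, hX.shape, hX'.shape, hm.shape]
  leg r₀ c₀ y := by
    rw [hX'.leg, hX.leg, hm.leg, hm.leg]
    grind (splits := 40)
  arm r₀ c₀ y := by
    rw [hX'.arm, hX.arm, hm.arm]

/-- A bumping with the same data commutes with a move in the arms. -/
theorem ArmMove.bump {r₁ c₁ x r₂ c₂ x' : ℕ} (hm : ArmMove T r₁ c₁ x r₂ c₂ x' T')
    (hX : BumpResult T c r a K r' X) (hX' : BumpResult T' c r a K r' X')
    (h : 0 < T.armCount r c a) (h' : 0 < T.armCount r₁ c₁ x) (h1 : ¬(r₁ = r ∧ c₁ = c ∧ x = a)) :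
    ArmMove X r₁ c₁ x r₂ c₂ x' X' where
  shape := by
    ext ⟨r₀, c₀⟩
    simp only [YoungDiagram.mem_cells, hX.shape, hX'.shape, hm.shape]
  leg r₀ c₀ y := by
    rw [hX'.leg, hX.leg, hm.leg, hm.leg]
  arm r₀ c₀ y := by
    rw [hX'.arm, hX.arm, hm.arm]
    by_cases h2 : r₀ = r ∧ c₀ = c ∧ y = a
    · have h3 : ¬(r₀ = r₁ ∧ c₀ = c₁ ∧ y = x) := by omega
      rw [if_pos h2, if_neg h3]
      obtain ⟨rfl, rfl, rfl⟩ := h2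
      omega
    · rw [if_neg h2]
      by_cases h3 : r₀ = r₁ ∧ c₀ = c₁ ∧ y = x
      · rw [if_pos h3]
        obtain ⟨rfl, rfl, rfl⟩ := h3
        omega
      · rw [if_neg h3]
        omega

open Classical in
/-- The signature of the two columns that a bumping affects, after the bumping. -/
theorem BumpResult.block (hT : T.IsHVT) (h : BumpData T c r a K r')
    (hX : BumpResult T c r a K r' X) (i : ℕ) :
    ∃ m₀ m₁, m₀ + (if i = a then 1 else 0) = T.colArm c i ∧
      m₁ + (if i + 1 = a then 1 else 0) = T.colArm c (i + 1) ∧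
      colPlus i X c = m₁ + ((if r' = r ∧ T.InLeg r c (i + 1) ∧ a < i + 1 then 0 else
        T.legCount c (i + 1)) - ((if r' = r ∧ T.InLeg r c i ∧ a < i then 0 else T.legCount c i)
          + m₀)) ∧
      colMinus i X (c + 1) = (if i = a ∨ (r' = r ∧ T.InLeg r c i ∧ a < i) then 1 else
        if K = some i then 0 else T.legCount (c + 1) i) + (if K = some i then 1 else 0) -
          (if i + 1 = a ∨ (r' = r ∧ T.InLeg r c (i + 1) ∧ a < i + 1) then 1 else
            if K = some (i + 1) then 0 else T.legCount (c + 1) (i + 1)) := by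
  have hm1 : ∀ y, T.colArm (c + 1) y = 0 := fun y =>
    colArm_eq_zero.2 fun r₀ => h.right r₀ _ y (by omega)
  have e5 := hX.colArm h c i
  have e6 := hX.colArm h c (i + 1)
  have e7 := hX.colArm h (c + 1) i
  simp only [true_and, Nat.succ_ne_self, Nat.left_eq_add, one_ne_zero, false_and, if_false,
    add_zero, hm1, zero_add] at e5 e6 e7
  refine ⟨_, _, e5, e6, ?_, ?_⟩
  · rw [colPlus, hX.legCount_self hT, hX.legCount_self hT]
  · rw [colMinus, hX.legCount_succ hT h, hX.legCount_succ hT h, e7]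

/-- The data persist if the letter `a` stays in place and no arm entry appears that would precede it
in the bumping order: further right, or larger than `a` in column `c`. -/
theorem ArmMove.bumpData {r₁ c₁ x r₂ c₂ x' : ℕ} (hm : ArmMove T r₁ c₁ x r₂ c₂ x' T')
    (h : BumpData T c r a K r') (h1 : ¬(r₁ = r ∧ c₁ = c ∧ x = a)) (h2 : c₂ ≤ c)
    (h3 : c₂ = c → x' ≤ a) : BumpData T' c r a K r' where
  pos := by
    rw [hm.arm, if_neg (by omega)]
    have := h.pos
    omega
  max r₀ y hy := by
    by_cases h4 : r₀ = r₂ ∧ c = c₂ ∧ y = x'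
    · have := h3 h4.2.1.symm
      omega
    · rw [hm.arm, if_neg h4] at hy
      exact h.max r₀ y (by omega)
  right r₀ c₀ y hc := by
    rw [hm.arm, h.right r₀ c₀ y hc, if_neg (c := r₀ = r₂ ∧ _) (by omega)]
    omega
  some k hk := by
    simp only [hm.leg]
    exact h.some k hk
  none hK := by
    simp only [hm.leg, hm.shape]
    exact h.none hK

/-- The data persist if `k` stays in place and no smaller candidate `≥ a` appears in column `c + 1`.
-/
theorem LegMove.bumpData {r₁ c₁ x r₂ c₂ x' : ℕ} (hm : LegMove T r₁ c₁ x r₂ c₂ x' T')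
    (h : BumpData T c r a K r') (h1 : ¬(r₁ = r' ∧ c₁ = c + 1 ∧ K = some x))
    (h2 : c₂ = c + 1 → a ≤ x' → ∃ k, K = some k ∧ k ≤ x') : BumpData T' c r a K r' where
  pos := by
    rw [hm.arm]
    exact h.pos
  max r₀ y := by
    rw [hm.arm]
    exact h.max r₀ y
  right r₀ c₀ y := by
    rw [hm.arm]
    exact h.right r₀ c₀ y
  some k hk := by
    obtain ⟨h3, h4, h5⟩ := h.some k hk
    refine ⟨(hm.leg _ _ _).2 (Or.inl ⟨h3, ?_⟩), h4, fun r₀ y hy hy' => ?_⟩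
    · rintro ⟨rfl, rfl, rfl⟩
      exact h1 ⟨rfl, rfl, hk⟩
    · rcases (hm.leg _ _ _).1 hy with hy | ⟨_, h6, rfl⟩
      · exact h5 _ _ hy.1 hy'
      · obtain ⟨k', h7, h8⟩ := h2 h6.symm hy'
        rw [hk] at h7
        cases h7
        exact h8
  none hK := by
    rw [hm.shape]
    refine ⟨(h.none hK).1, fun r₀ y hy => ?_⟩
    rcases (hm.leg _ _ _).1 hy with hy | ⟨_, h6, rfl⟩
    · exact (h.none hK).2 _ _ hy.1
    · by_contra h7
      obtain ⟨k', h8, _⟩ := h2 h6.symm (by omega)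
      simp [hK] at h8

/-- The bumping and `f i` commute when they do not interact: `f i` acts in the same way before and
after the bumping, and the data of the bumping do not change. -/
theorem FStep.bump {r₁ c₁ : ℕ} (hT : T.IsHVT) (hT' : T'.IsHVT) (h : BumpData T c r a K r')
    (hX : BumpResult T c r a K r' X) (hs : FStep i T r₁ c₁ T') (h0 : T.In r₁ c₁ i)
    (hp : 0 < colMinus i T c₁)
    (hu : X.In (r₁ + 1) c₁ (i + 1) ↔ T.In (r₁ + 1) c₁ (i + 1))
    (hl : X.InLeg r₁ (c₁ + 1) i ↔ T.InLeg r₁ (c₁ + 1) i)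
    (ha : X.armCount r₁ c₁ i = T.armCount r₁ c₁ i)
    (hc : 0 < T.armCount r₁ c₁ i → c₁ ≤ c ∧ (c₁ = c → i + 1 ≤ a))
    (hK : c₁ = c + 1 → a ≤ i + 1 → ∃ k, K = some k ∧ k ≤ i + 1)
    (hK' : ¬(r₁ = r' ∧ c₁ = c + 1 ∧ K = some (i + 1)))
    (hμ : ¬(r' = r ∧ r₁ = r ∧ c₁ = c ∧ a < i + 1))
    (hleft : ¬T.In (r₁ + 1) c₁ (i + 1) → T.InLeg r₁ (c₁ + 1) i →
      ¬(r₁ = r' ∧ c₁ + 1 = c + 1 ∧ (K = some i ∨ i = a ∨ (r' = r ∧ T.InLeg r c i ∧ a < i))) ∧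
      ¬(r' = r ∧ r₁ = r ∧ c₁ + 1 = c ∧ a < i))
    (hleg : T.armCount r₁ c₁ i = 0 →
      ¬(r₁ = r' ∧ c₁ = c + 1 ∧ (K = some i ∨ i = a ∨ (r' = r ∧ T.InLeg r c i ∧ a < i)))) :
    FStep i X r₁ c₁ T'.bump := by
  cases hs with
  | up h1 hm =>
    have h2 := (hT.up_facts h0 hp h1).1
    obtain ⟨h3, h4⟩ := hc h2
    have h5 : ¬(r₁ = r ∧ c₁ = c ∧ i = a) := by omega
    have hd := hm.bumpData h h5 h3 h4
    exact .up (hu.2 h1) (hm.bump hX (hd.result hT').1 h.pos h2 h5)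
  | left h1 h2 hm =>
    obtain ⟨h3, h4⟩ := hleft h1 h2
    have hd := hm.bumpData h (fun h5 => h3 ⟨h5.1, h5.2.1, Or.inl h5.2.2⟩) hK
    exact .left (fun h5 => h1 (hu.1 h5)) (hl.2 h2)
      (hm.bump hX (hd.result hT').1 h3 h4 hK' hμ)
  | arm h1 h2 h3 hm =>
    obtain ⟨h4, h5⟩ := hc h3
    have h6 : ¬(r₁ = r ∧ c₁ = c ∧ i = a) := by omega
    have hd := hm.bumpData h h6 h4 h5
    exact .arm (fun h5 => h1 (hu.1 h5)) (fun h5 => h2 (hl.1 h5)) (by omega)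
      (hm.bump hX (hd.result hT').1 h.pos h3 h6)
  | leg h1 h2 h3 hm =>
    have h4 := hleg h3
    have hd := hm.bumpData h (fun h5 => h4 ⟨h5.1, h5.2.1, Or.inl h5.2.2⟩) hK
    exact .leg (fun h5 => h1 (hu.1 h5)) (fun h5 => h2 (hl.1 h5)) (by omega)
      (hm.bump hX (hd.result hT').1 h4 (by omega) hK' hμ)

theorem FStep.bump_away {r₁ c₁ : ℕ} (hT : T.IsHVT) (hT' : T'.IsHVT) (h : BumpData T c r a K r')
    (hX : BumpResult T c r a K r' X) (hs : FStep i T r₁ c₁ T') (h0 : T.In r₁ c₁ i)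
    (hp : 0 < colMinus i T c₁) (hc : c₁ ≠ c) (hc' : c₁ ≠ c + 1) :
    X.In r₁ c₁ i ∧ FStep i X r₁ c₁ T'.bump := by
  have hleg : ∀ r₀ y, X.InLeg r₀ c₁ y ↔ T.InLeg r₀ c₁ y := fun r₀ y => by
    rw [hX.leg]
    simp [hc, hc']
  have harm : ∀ r₀ y, X.armCount r₀ c₁ y = T.armCount r₀ c₁ y := fun r₀ y => by
    rw [hX.arm]
    simp [hc, hc']
  have hin : ∀ r₀ y, X.In r₀ c₁ y ↔ T.In r₀ c₁ y := fun r₀ y => by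
    rw [Filling.In, Filling.In, hleg, harm]
  -- In column `c - 1` the rule (S) looks at column `c`, from which leg entries larger than `a` may
  -- have disappeared; the row inequality `i ≤ a` shows that `i` is not among them.
  have hia : r₁ = r → c₁ + 1 = c → ¬a < i := by
    rintro rfl rfl
    have := hT.row_le (Nat.lt_succ_self c₁) h0 h.mem
    omega
  refine ⟨(hin _ _).2 h0, hs.bump hT hT' h hX h0 hp (hin _ _) ?_ (harm _ _) ?_
    (by omega) (by omega) (by omega) ?_ (by omega)⟩
  · rw [hX.leg]
    constructor
    · rintro (h1 | h1)
      · exact h1.1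
      · omega
    · exact fun h1 => Or.inl ⟨h1, by omega, by omega⟩
  · intro h1
    refine ⟨?_, by omega⟩
    by_contra h2
    have := h.right r₁ c₁ i (by omega)
    omega
  · exact fun _ _ => ⟨by omega, by omega⟩

theorem BumpData.exists_le (h : BumpData T c r a K r') {r₀ y : ℕ} (hy : T.InLeg r₀ (c + 1) y)
    (ha : a ≤ y) : ∃ k, K = Option.some k ∧ k ≤ y := by
  cases hK : K with
  | none =>
    have := (h.none hK).2 _ _ hy
    omega
  | some k => exact ⟨k, rfl, (h.some k hK).2.2 _ _ hy ha⟩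

theorem BumpData.le_of_in (hT : T.IsHVT) (h : BumpData T c r a K r') (hr : r' = r) {x k : ℕ}
    (hx : T.In r c x) (hK : K = Option.some k) : x ≤ k := by
  subst hr
  exact hT.row_le (Nat.lt_succ_self c) hx (h.some k hK).1.inn

theorem BumpData.colArm_pos (hT : T.IsHVT) (h : BumpData T c r a K r') : 0 < T.colArm c a := by
  rw [hT.colArm_eq h.mem]
  exact h.pos

theorem BumpData.colArm_eq_zero (h : BumpData T c r a K r') {x : ℕ} (hx : a < x) :
    T.colArm c x = 0 := by
  refine Filling.colArm_eq_zero.2 fun r₀ => Nat.eq_zero_of_not_pos fun h1 => ?_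
  have := h.max _ _ h1
  omega

theorem BumpData.inLeg_of_in (h : BumpData T c r a K r') {r₀ c₀ y : ℕ} (hc : c < c₀)
    (hy : T.In r₀ c₀ y) : T.InLeg r₀ c₀ y := by
  rcases hy with hy | hy
  · exact hy
  · have := h.right r₀ c₀ y hc
    omega

/-- If the bumped entry `i` of the next column disappears, and `i + 1` lies in the same cell, then
`i + 1` is the bumped entry instead. -/
theorem LegMove.bumpData_succ {r₂ c₂ x' : ℕ} (hT : T.IsHVT) (h : BumpData T c r a (some i) r')
    (hm : LegMove T r' (c + 1) i r₂ c₂ x' T') (hc : c₂ = c + 1 → i + 1 ≤ x')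
    (hi : T'.InLeg r' (c + 1) (i + 1)) : BumpData T' c r a (some (i + 1)) r' where
  pos := by
    rw [hm.arm]
    exact h.pos
  max r₀ y := by
    rw [hm.arm]
    exact h.max r₀ y
  right r₀ c₀ y := by
    rw [hm.arm]
    exact h.right r₀ c₀ y
  some k hk := by
    cases hk
    obtain ⟨h1, h2, h3⟩ := h.some i rfl
    refine ⟨hi, by omega, fun r₀ y hy hy' => ?_⟩
    rcases (hm.leg _ _ _).1 hy with ⟨hy, h4⟩ | ⟨_, h6, rfl⟩
    · have := h3 _ _ hy hy'
      by_contra h5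
      obtain rfl : y = i := by omega
      exact h4 ⟨hT.row_eq hy.inn h1.inn, rfl, rfl⟩
    · exact hc h6.symm
  none hK := by cases hK

/-- The data of the bumping after a change of the bumped arm entry `i` into `i + 1`. -/
theorem ArmMove.bumpData_succ {r₁ : ℕ} {K' : Option ℕ} {r'' : ℕ} (h : BumpData T c r i K r')
    (hm : ArmMove T r c i r₁ c (i + 1) T')
    (hs : ∀ k, K' = some k → T.InLeg r'' (c + 1) k ∧ i + 1 ≤ k ∧
      ∀ r₀ y, T.InLeg r₀ (c + 1) y → i + 1 ≤ y → k ≤ y)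
    (hn : K' = none → r'' = T.shape.colLen (c + 1) ∧ ∀ r₀ y, T.InLeg r₀ (c + 1) y → y < i + 1) :
    BumpData T' c r₁ (i + 1) K' r'' where
  pos := by
    rw [hm.arm, if_pos (c := r₁ = r₁ ∧ _) ⟨rfl, rfl, rfl⟩]
    omega
  max r₀ y hy := by
    by_cases h4 : r₀ = r₁ ∧ c = c ∧ y = i + 1
    · omega
    · rw [hm.arm, if_neg h4] at hy
      have := h.max r₀ y (by omega)
      omega
  right r₀ c₀ y hc := by
    rw [hm.arm, h.right r₀ c₀ y hc, if_neg (c := r₀ = r₁ ∧ _) (by omega)]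
    omega
  some k hk := by
    simp only [hm.leg]
    exact hs k hk
  none hK := by
    simp only [hm.leg, hm.shape]
    exact hn hK

/-- The bumping and `f i` commute when `f i` acts in the column to the right of the bumped
letter. -/
theorem FStep.bump_right {r₁ : ℕ} (hT : T.IsHVT) (hT' : T'.IsHVT) (h : BumpData T c r a K r')
    (hX : BumpResult T c r a K r' X) (hs : FStep i T r₁ (c + 1) T') (h0 : T.In r₁ (c + 1) i)
    (hp : 0 < colMinus i T (c + 1)) (hq : colPlus i T c < colMinus i T (c + 1)) :
    colPlus i X c < colMinus i X (c + 1) ∧ X.In r₁ (c + 1) i ∧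
      FStep i X r₁ (c + 1) T'.bump := by
  classical
  have ha0 : T.armCount r₁ (c + 1) i = 0 := h.right _ _ _ (by omega)
  obtain ⟨h1, h2⟩ := hT.leg_facts h0 hp ha0
  have h2' : ∀ r₀, ¬T.In r₀ (c + 1) (i + 1) := fun r₀ h3 => h2 _ (h.inLeg_of_in (by omega) h3)
  have hL0 : T.legCount (c + 1) i = 1 := legCount_eq_one.2 ⟨_, h1⟩
  have hL1 : T.legCount (c + 1) (i + 1) = 0 := legCount_eq_zero.2 h2
  have hM0 : T.colArm (c + 1) i = 0 := colArm_eq_zero.2 fun r₀ => h.right _ _ _ (by omega)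
  have hq' : T.colArm c (i + 1) = 0 ∧
      T.legCount c (i + 1) ≤ T.legCount c i + T.colArm c i := by
    rw [colPlus, colMinus, hL0, hL1, hM0] at hq
    omega
  have ha1 : a ≠ i + 1 := by
    rintro rfl
    have := h.colArm_pos hT
    omega
  have hk : ∀ y, y = i → a ≤ y → ∃ k, K = some k ∧ k ≤ i := by
    rintro y rfl
    exact h.exists_le h1
  have hμ1 : ¬(r' = r ∧ T.InLeg r c (i + 1) ∧ a < i + 1) := by
    rintro ⟨h3, h4, h5⟩
    obtain ⟨k, h6, h7⟩ := hk i rfl (by omega)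
    have := h.le_of_in hT h3 h4.inn h6
    omega
  have hK1 : K ≠ some (i + 1) := fun h3 => h2 _ (h.some _ h3).1
  have hup : ∀ r₀, ¬X.In r₀ (c + 1) (i + 1) := by
    intro r₀ h3
    rcases hX.in_cases h h3 with h3 | ⟨_, _, h3 | h3⟩
    · exact h2' _ h3.1
    · exact ha1 h3.symm
    · exact hμ1 h3
  have hleft : X.InLeg r₁ (c + 2) i ↔ T.InLeg r₁ (c + 2) i := by
    rw [hX.leg]
    exact ⟨fun h3 => h3.elim And.left fun h3 => by omega, fun h3 =>
      Or.inl ⟨h3, by omega, by omega⟩⟩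
  obtain ⟨m₀, m₁, e1, e2, e3, e4⟩ := hX.block hT h i
  rw [if_neg hμ1] at e3
  rw [if_neg (not_or.2 ⟨fun h3 => ha1 h3.symm, hμ1⟩), if_neg hK1, hL1] at e4
  -- If `k = i`, the selected letter has been displaced into the arm of its cell. Changing it there
  -- after the bumping agrees with changing it in the leg before and then displacing `i + 1`.
  by_cases hKi : K = some i
  · subst hKi
    obtain ⟨h3, h4, h5⟩ := h.some i rfl
    obtain rfl : r₁ = r' := hT.row_eq h1.inn h3.inn
    simp only [if_true] at e4
    have hin : 0 < X.armCount r₁ (c + 1) i := by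
      rw [hX.arm]
      simp
    refine ⟨?_, Or.inr hin, ?_⟩
    · rw [e3, e4]
      by_cases h6 : i = a ∨ (r₁ = r ∧ T.InLeg r c i ∧ a < i)
      · rw [if_pos h6]
        have := T.legCount_le_one c (i + 1)
        omega
      · rw [if_neg h6, if_neg (c := r₁ = r ∧ _) fun h7 => h6 (Or.inr h7)]
        rw [if_neg fun h7 => h6 (Or.inl h7)] at e1
        omega
    · cases hs with
      | up h6 => exact absurd h6 (h2' _)
      | left h6 h7 hm =>
        have hd := hm.bumpData h (by omega) fun _ _ => ⟨i, rfl, by omega⟩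
        exact .left (hup _) (hleft.2 h7) (hm.bump hX (hd.result hT').1 (by omega) (by omega)
          (fun h8 => hK1 h8.2.2) (by omega))
      | arm _ _ h6 => omega
      | leg h6 h7 h8 hm =>
        have hd := hm.bumpData_succ hT h (fun _ => le_rfl)
          ((hm.leg _ _ _).2 (Or.inr ⟨rfl, rfl, rfl⟩))
        have hX' := (hd.result hT').1
        refine .arm (hup _) (fun h9 => h7 (hleft.1 h9)) hin
          ⟨?_, fun r₀ c₀ y => ?_, fun r₀ c₀ y => ?_⟩
        · ext ⟨r₀, c₀⟩
          simp only [YoungDiagram.mem_cells, hX.shape, hX'.shape, hm.shape]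
        · rw [hX'.leg, hX.leg, hm.leg, hm.leg]
          have := h2 r₀
          grind (splits := 40)
        · rw [hX'.arm, hX.arm, hm.arm]
          grind
  · have hk' : ∀ y, y = i → a ≤ y → ∃ k, K = some k ∧ k < i := by
      rintro y rfl h3
      obtain ⟨k, h4, h5⟩ := hk _ rfl h3
      refine ⟨k, h4, lt_of_le_of_ne h5 ?_⟩
      rintro rfl
      exact hKi h4
    have ha2 : i ≠ a := by
      rintro rfl
      obtain ⟨k, h4, h5⟩ := hk' _ rfl le_rfl
      have := (h.some k h4).2.1
      omega
    have hμ0 : ¬(r' = r ∧ T.InLeg r c i ∧ a < i) := by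
      rintro ⟨h3, h4, h5⟩
      obtain ⟨k, h6, h7⟩ := hk' _ rfl h5.le
      have := h.le_of_in hT h3 h4.inn h6
      omega
    have harm : X.armCount r₁ (c + 1) i = T.armCount r₁ (c + 1) i := by
      rw [hX.arm]
      simp [hKi]
    refine ⟨?_, Or.inl ((hX.leg _ _ _).2 (Or.inl ⟨h1, fun h3 => hKi h3.2.2, by omega⟩)), ?_⟩
    · rw [e3, e4, if_neg hKi, if_neg hKi, if_neg hμ0, if_neg (c := i = a ∨ _) (by tauto), hL0]
      rw [if_neg ha2] at e1
      omega
    · refine hs.bump hT hT' h hX h0 hp (iff_of_false (hup _) (h2' _)) hleft harm (by omega) ?_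
        (fun h3 => hK1 h3.2.2) (by omega) (fun _ _ => ⟨by omega, by omega⟩) ?_
      · intro _ h3
        obtain ⟨k, h4, h5⟩ := hk i rfl (by omega)
        exact ⟨k, h4, by omega⟩
      · rintro - ⟨_, _, h3⟩
        tauto

/-- Since `i < a`, the bumping moves no letter `i`; it can only affect the pairing through `a = i +
1`, and then the selection still stays in column `c`. So this is a case without interaction. -/
theorem FStep.bump_of_lt {r₁ : ℕ} (hT : T.IsHVT) (hT' : T'.IsHVT) (h : BumpData T c r a K r')
    (hX : BumpResult T c r a K r' X) (hs : FStep i T r₁ c T') (h0 : T.In r₁ c i)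
    (hp : 0 < colMinus i T c) (hq : colMinus i T (c + 1) ≤ colPlus i T c) (hia : i < a) :
    ¬colPlus i X c < colMinus i X (c + 1) ∧ X.In r₁ c i ∧ FStep i X r₁ c T'.bump := by
  classical
  have hk : ∀ k, K = some k → a ≤ k := fun k hk => (h.some k hk).2.1
  have hKi : K ≠ some i := fun h1 => by
    have := hk i h1
    omega
  have harm : X.armCount r₁ c i = T.armCount r₁ c i := by
    rw [hX.arm, if_neg (by omega), if_neg (by omega)]
    omega
  have hM0 : T.colArm (c + 1) i = 0 := colArm_eq_zero.2 fun r₀ => h.right _ _ _ (by omega)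
  refine ⟨?_, ?_, ?_⟩
  · obtain ⟨m₀, m₁, e1, e2, e3, e4⟩ := hX.block hT h i
    rw [if_neg (by omega), if_neg (by omega)] at e3
    rw [if_neg (c := i = a ∨ _) (by omega), if_neg hKi, if_neg hKi] at e4
    rw [if_neg (by omega)] at e1
    by_cases h1 : i + 1 = a
    · rw [if_pos (Or.inl h1)] at e4
      have := T.legCount_le_one (c + 1) i
      omega
    · rw [if_neg (c := i + 1 = a ∨ _) (by omega), if_neg (c := K = some (i + 1)) fun h2 => by
        have := hk _ h2
        omega] at e4
      rw [if_neg h1] at e2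
      rw [colMinus, colPlus] at hq
      omega
  · rcases h0 with h0 | h0
    · exact Or.inl ((hX.leg _ _ _).2 (Or.inl ⟨h0, by omega, by omega⟩))
    · exact Or.inr (by omega)
  · refine hs.bump hT hT' h hX h0 hp ⟨fun h1 => ?_, fun h1 => ?_⟩ ?_ harm
      (fun _ => ⟨le_rfl, fun _ => hia⟩) (by omega) (by omega) (by omega)
      (fun _ _ => ⟨?_, by omega⟩) (by omega)
    · rcases hX.in_cases h h1 with h1 | h1
      · exact h1.1
      · omega
    · exact Or.inl ((hX.leg _ _ _).2 (Or.inl ⟨(hT.up_facts h0 hp h1).2.1, by omega, by omega⟩))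
    · rw [hX.leg]
      exact ⟨fun h1 => h1.elim And.left fun h1 => by omega, fun h1 =>
        Or.inl ⟨h1, fun h2 => hKi h2.2.2, by omega⟩⟩
    · rintro ⟨_, _, h1 | h1⟩
      · exact hKi h1
      · omega

/-- An arm letter `i` displaces an equal letter of the next column into an arm there. Afterwards `f
i` acts on that arm letter in column `c + 1`; before the bumping it acts in column `c`, and then the
displaced letter is `i + 1`. -/
theorem FStep.bump_of_eq_of_eq {r₁ : ℕ} (hT : T.IsHVT) (hT' : T'.IsHVT)
    (h : BumpData T c r i (some i) r') (hX : BumpResult T c r i (some i) r' X)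
    (hs : FStep i T r₁ c T') (h0 : T.In r₁ c i)
    (hp : 0 < colMinus i T c) (hq : colMinus i T (c + 1) ≤ colPlus i T c) :
    colPlus i X c < colMinus i X (c + 1) ∧ X.In r' (c + 1) i ∧
      FStep i X r' (c + 1) T'.bump := by
  classical
  obtain rfl : r₁ = r := hT.row_eq h0 h.mem
  obtain ⟨hk, -, hk'⟩ := h.some i rfl
  have hm1 : T.colArm c (i + 1) = 0 := h.colArm_eq_zero (by omega)
  have hM0 : T.colArm (c + 1) i = 0 := colArm_eq_zero.2 fun r₀ => h.right _ _ _ (by omega)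
  have hL0 : T.legCount (c + 1) i = 1 := legCount_eq_one.2 ⟨_, hk⟩
  have hμ : ∀ x, r' = r₁ → T.In r₁ c x → x ≤ i := fun x h1 h2 => h.le_of_in hT h1 h2 rfl
  -- Column `c` has an unpaired `i` and no `i + 1` in its arms, so it offers no unpaired plus; the
  -- leg letter `i` of column `c + 1` must be paired inside its own column.
  have hL1 : T.legCount (c + 1) (i + 1) = 1 := by
    have := T.legCount_le_one (c + 1) (i + 1)
    rw [colMinus, colPlus, hm1, hM0, hL0] at hq
    rw [colMinus] at hp
    omega
  obtain ⟨r₂, h1⟩ := legCount_eq_one.1 hL1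
  have hin : 0 < X.armCount r' (c + 1) i := by
    rw [hX.arm]
    simp
  have hstep : ∀ Y, ArmMove X r' (c + 1) i r₂ (c + 1) (i + 1) Y → FStep i X r' (c + 1) Y := by
    intro Y hY
    have hup : ∀ r₀, X.In r₀ (c + 1) (i + 1) → r₀ = r₂ := by
      intro r₀ h3
      rcases hX.in_cases h h3 with h3 | ⟨_, _, h3 | h3⟩
      · exact hT.row_eq h3.1 h1.inn
      · omega
      · have := hμ _ h3.1 h3.2.1.inn
        omega
    have hX1 : X.InLeg r₂ (c + 1) (i + 1) :=
      (hX.leg _ _ _).2 (Or.inl ⟨h1, by simp, by omega⟩)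
    rcases hT.succ_row hk.inn h1.inn with rfl | ⟨rfl, h2⟩
    · refine .arm (fun h3 => ?_) (fun h3 => ?_) hin hY
      · have := hup _ h3
        omega
      · rcases (hX.leg _ _ _).1 h3 with h3 | h3
        · have := hT.row_le (Nat.lt_succ_self _) h1.inn h3.1.inn
          omega
        · omega
    · exact .up hX1.inn hY
  refine ⟨?_, Or.inr hin, hstep _ ?_⟩
  · obtain ⟨m₀, m₁, e1, e2, e3, e4⟩ := hX.block hT h i
    rw [if_neg (fun h3 => by have := hμ _ h3.1 h3.2.1.inn; omega), if_neg (by omega)] at e3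
    rw [if_neg (c := i + 1 = i ∨ _) (fun h3 => by
      rcases h3 with h3 | h3
      · omega
      · have := hμ _ h3.1 h3.2.1.inn
        omega), hL1] at e4
    simp only [true_or, if_true, Option.some.injEq, Nat.left_eq_add, one_ne_zero, if_false] at e1 e4
    rw [colMinus] at hp
    omega
  have harm : ∀ r₃, ArmMove T r₁ c i r₃ c (i + 1) T' →
      ArmMove X r' (c + 1) i r₂ (c + 1) (i + 1) T'.bump := by
    intro r₃ hm
    have hd := hm.bumpData_succ (K' := some (i + 1)) (r'' := r₂) h (fun k h3 => by
      cases h3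
      exact ⟨h1, le_rfl, fun _ _ _ h4 => h4⟩) (by simp)
    have hX' := (hd.result hT').1
    have hμ' : ∀ x, r₂ = r₃ → T.InLeg r₃ c x → x ≤ i + 1 := by
      rintro x rfl h3
      exact hT.row_le (Nat.lt_succ_self c) h3.inn h1.inn
    refine ⟨?_, fun r₀ c₀ y => ?_, fun r₀ c₀ y => ?_⟩
    · ext ⟨r₀, c₀⟩
      simp only [YoungDiagram.mem_cells, hX.shape, hX'.shape, hm.shape]
      have h3 := hk.1
      have h4 := h1.1
      grind
    · rw [hX'.leg, hX.leg, hm.leg, hm.leg]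
      have h3 := hμ' y
      have h4 := fun h5 h6 => hμ y h5 (Or.inl h6)
      grind (splits := 40)
    · rw [hX'.arm, hX.arm, hm.arm]
      have h3 := h.pos
      grind
  cases hs with
  | up h3 hm => exact harm _ hm
  | arm _ _ _ hm => exact harm _ hm
  | leg _ _ h3 =>
    have := h.pos
    omega
  -- Rule (S) first carries `i + 1` to the leg on the left. As `r' = r` and `i + 1 > a`, the bumping
  -- moves it back as a leg entry, while the other `i + 1` is displaced into the arm.
  | left h3 h4 hm =>
    obtain ⟨h5, h6, h7, h8⟩ := hT.left_facts h0 hq h3 h4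
    obtain rfl : r₁ = r₂ := hT.row_eq h5.inn h1.inn
    obtain rfl : r₁ = r' := hT.row_eq h4.inn hk.inn
    have hd := hm.bumpData_succ hT h (by omega)
      ((hm.leg _ _ _).2 (Or.inl ⟨h5, by omega⟩))
    have hX' := (hd.result hT').1
    refine ⟨?_, fun r₀ c₀ y => ?_, fun r₀ c₀ y => ?_⟩
    · ext ⟨r₀, c₀⟩
      simp only [YoungDiagram.mem_cells, hX.shape, hX'.shape, hm.shape]
    · rw [hX'.leg, hX.leg, hm.leg, hm.leg]
      have h9 := fun h6 => hμ y rfl (Or.inl h6)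
      have h10 : ¬T.InLeg r₁ c (i + 1) := fun h10 => h6 h10.inn
      grind (splits := 40)
    · rw [hX'.arm, hX.arm, hm.arm]
      grind

/-- The bumped letter is `i`, and column `c + 1` has no `i` in its legs. If an `i + 1` moves along
with it, the two end up paired in one cell and `f i` on the bumped tableau uses rule (S) to send `i
+ 1` back. Otherwise `f i` changes the newly arrived `i` into `i + 1`, which is what bumping `i + 1`
produces. -/
theorem FStep.bump_of_eq_of_ne {r₁ : ℕ} (hT : T.IsHVT) (hT' : T'.IsHVT)
    (h : BumpData T c r i K r') (hX : BumpResult T c r i K r' X)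
    (hs : FStep i T r₁ c T') (h0 : T.In r₁ c i)
    (hp : 0 < colMinus i T c) (hK : K ≠ some i) :
    ∃ r₂ c₂, c₂ = (if colPlus i X c < colMinus i X (c + 1) then c + 1 else c) ∧ X.In r₂ c₂ i ∧
      FStep i X r₂ c₂ T'.bump := by
  classical
  obtain rfl : r₁ = r := hT.row_eq h0 h.mem
  have hk : ∀ k, K = some k → i + 1 ≤ k := by
    intro k h1
    have h2 := (h.some k h1).2.1
    by_contra h3
    obtain rfl : k = i := by omega
    exact hK h1
  have hi : ∀ r₀, ¬T.InLeg r₀ (c + 1) i := by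
    intro r₀ h1
    obtain ⟨k, h2, h3⟩ := h.exists_le h1 le_rfl
    have := hk k h2
    omega
  have hm1 : T.colArm c (i + 1) = 0 := h.colArm_eq_zero (by omega)
  have hL0 : T.legCount (c + 1) i = 0 := legCount_eq_zero.2 hi
  have hL1 : K ≠ some (i + 1) → T.legCount (c + 1) (i + 1) = 0 := fun h1 =>
    legCount_eq_zero.2 fun r₀ h2 => by
      obtain ⟨k, h3, h4⟩ := h.exists_le h2 (by omega)
      have := hk k h3
      obtain rfl : k = i + 1 := by omega
      exact h1 h3
  have hd : ∀ r₃, ArmMove T r₁ c i r₃ c (i + 1) T' → BumpData T' c r₃ (i + 1) K r' :=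
    fun r₃ hm => hm.bumpData_succ h (fun k h1 => ⟨(h.some k h1).1, hk k h1, fun r₀ y h2 h3 =>
      (h.some k h1).2.2 r₀ y h2 (by omega)⟩) fun h1 => ⟨(h.none h1).1, fun r₀ y h2 => by
        have := (h.none h1).2 r₀ y h2
        omega⟩
  obtain ⟨m₀, m₁, e1, e2, e3, e4⟩ := hX.block hT h i
  rw [if_neg (by omega)] at e2
  rw [if_neg (c := r' = r₁ ∧ T.InLeg r₁ c i ∧ i < i) (by omega)] at e3
  simp only [true_or, if_true, hK, if_false, add_zero] at e1 e4
  by_cases hμ : r' = r₁ ∧ T.InLeg r₁ c (i + 1) ∧ i < i + 1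
  · rw [if_pos (Or.inr hμ)] at e4
    obtain ⟨rfl, h1, -⟩ := hμ
    have hXi : X.InLeg r' (c + 1) i :=
      (hX.leg _ _ _).2 (Or.inr ⟨rfl, rfl, Or.inl rfl⟩)
    have hXr : X.In r' c i := by
      have h2 : X.armCount r' c i = T.armCount r' c i - 1 := by
        rw [hX.arm]
        simp
      rcases h0 with h0 | h0
      · exact Or.inl ((hX.leg _ _ _).2 (Or.inl ⟨h0, by omega, by omega⟩))
      · by_cases h3 : T.InLeg r' c i
        · exact Or.inl ((hX.leg _ _ _).2 (Or.inl ⟨h3, by omega, by omega⟩))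
        · refine Or.inr ?_
          rw [hT.colMinus_eq (Or.inr h0), hT.legCount_eq (Or.inr h0), if_neg h3,
            legCount_eq_one.2 ⟨_, h1⟩] at hp
          omega
    refine ⟨r', c, ?_, hXr, ?_⟩
    · rw [if_neg (by omega)]
    have hup : ¬T.In (r' + 1) c (i + 1) := fun h2 => by
      have := hT.row_eq h2 h1.inn
      omega
    cases hs with
    | up h2 => exact absurd h2 hup
    | left _ h2 => exact absurd h2 (hi _)
    | leg _ _ h2 =>
      have := h.pos
      omega
    | arm _ _ h2 hm =>
      have hX' := ((hd _ hm).result hT').1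
      refine .left (fun h3 => ?_) hXi ⟨?_, fun r₀ c₀ y => ?_, fun r₀ c₀ y => ?_⟩
      · rcases hX.in_cases h h3 with h3 | h3
        · exact hup h3.1
        · omega
      · ext ⟨r₀, c₀⟩
        simp only [YoungDiagram.mem_cells, hX.shape, hX'.shape, hm.shape]
      · rw [hX'.leg, hX.leg, hm.leg, hm.leg]
        have h3 := hi r₀
        have h4 := hk y
        grind (splits := 40)
      · rw [hX'.arm, hX.arm, hm.arm]
        have h3 := h.pos
        grind
  · rw [if_neg hμ] at e3
    rw [if_neg (c := i + 1 = i ∨ _) (fun h3 => by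
      rcases h3 with h3 | h3
      · omega
      · exact hμ h3)] at e4
    have hXi : X.InLeg r' (c + 1) i :=
      (hX.leg _ _ _).2 (Or.inr ⟨rfl, rfl, Or.inl rfl⟩)
    have hX0 : X.armCount r' (c + 1) i = 0 := by
      rw [hX.arm, h.right _ _ _ (by omega), if_neg (c := _ ∧ _ ∧ K = some i) fun h1 => hK h1.2.2]
      omega
    refine ⟨r', c + 1, ?_, hXi.inn, ?_⟩
    · rw [if_pos]
      have h2 : (if K = some (i + 1) then 0 else T.legCount (c + 1) (i + 1)) = 0 := by
        split_ifs with h2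
        · rfl
        · exact hL1 h2
      rw [h2] at e4
      rw [colMinus] at hp
      omega
    have hstep : ∀ Y, LegMove X r' (c + 1) i r' (c + 1) (i + 1) Y → FStep i X r' (c + 1) Y := by
      intro Y hY
      refine .leg (fun h1 => ?_) (fun h1 => ?_) hX0 hY
      · rcases hX.in_cases h h1 with h1 | h1
        · obtain ⟨h2, -⟩ := h1
          obtain ⟨k, h3, h4⟩ := h.exists_le (h.inLeg_of_in (by omega) h2) (by omega)
          have := hT.col_lt (Nat.lt_succ_self r') (h.some k h3).1.inn h2
          have := hk k h3
          omega
        · omega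
      · rcases (hX.leg _ _ _).1 h1 with ⟨h1, -⟩ | h1
        · have h2 : (r', c + 1) ∈ T.shape := T.shape.up_left_mem le_rfl (by omega) h1.1
          obtain ⟨k, h3⟩ := h.exists_some h2
          have := hT.row_le (Nat.lt_succ_self _) (h.some k h3).1.inn h1.inn
          have := hk k h3
          omega
        · omega
    -- After rule (M) the letter to be bumped sits one row higher, where no leg entries move along;
    -- the second alternative records that in the old row none would have moved either, all its leg
    -- entries being at most `i`.
    have harm : ∀ r₃, ArmMove T r₁ c i r₃ c (i + 1) T' → (r₃ = r₁ ∨ (r₃ = r₁ + 1 ∧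
        ∀ x, T.InLeg r₁ c x → x ≤ i)) →
        LegMove X r' (c + 1) i r' (c + 1) (i + 1) T'.bump := by
      intro r₃ hm hr₃
      have hX' := ((hd _ hm).result hT').1
      have hle := h.row_le hT
      refine ⟨?_, fun r₀ c₀ y => ?_, fun r₀ c₀ y => ?_⟩
      · ext ⟨r₀, c₀⟩
        simp only [YoungDiagram.mem_cells, hX.shape, hX'.shape, hm.shape]
      · rw [hX'.leg, hX.leg, hm.leg, hm.leg]
        have h3 := hi r₀
        have h4 := hk y
        rcases hr₃ with rfl | ⟨rfl, h5⟩
        · grind (splits := 40)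
        · have h6 := h5 y
          grind (splits := 40)
      · rw [hX'.arm, hX.arm, hm.arm]
        have h3 := h.pos
        grind
    cases hs with
    | up h2 hm => exact hstep _ (harm _ hm (Or.inr ⟨rfl, fun x hx => by
        have := hT.col_lt (Nat.lt_succ_self r₁) hx.inn h2
        omega⟩))
    | left _ h2 => exact absurd h2 (hi _)
    | leg _ _ h2 =>
      have := h.pos
      omega
    | arm _ _ h2 hm => exact hstep _ (harm _ hm (Or.inl rfl))

/-- As `i > a`, the selected `i` is a leg entry, in row `r` or higher. It takes part in the bumping
only if `r' = r` and it lies in row `r`; then it moves to column `c + 1` and `f i` follows it there.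
If in addition `k = i`, rule (S) before the bumping corresponds to a change in the arm after it. -/
theorem FStep.bump_of_gt {r₁ : ℕ} (hT : T.IsHVT) (hT' : T'.IsHVT) (h : BumpData T c r a K r')
    (hX : BumpResult T c r a K r' X) (hs : FStep i T r₁ c T') (h0 : T.In r₁ c i)
    (hp : 0 < colMinus i T c) (hq : colMinus i T (c + 1) ≤ colPlus i T c) (hia : a < i) :
    ∃ r₂ c₂, c₂ = (if colPlus i X c < colMinus i X (c + 1) then c + 1 else c) ∧ X.In r₂ c₂ i ∧
      FStep i X r₂ c₂ T'.bump := by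
  classical
  have ha0 : T.armCount r₁ c i = 0 := Nat.eq_zero_of_not_pos fun h1 => by
    have := h.max _ _ h1
    omega
  have ha1 : ∀ r₀, T.armCount r₀ c (i + 1) = 0 := fun r₀ => Nat.eq_zero_of_not_pos fun h1 => by
    have := h.max _ _ h1
    omega
  obtain ⟨h1, h2⟩ := hT.leg_facts h0 hp ha0
  have h2' : ∀ r₀, ¬T.In r₀ c (i + 1) := by
    rintro r₀ (h3 | h3)
    · exact h2 _ h3
    · have := ha1 r₀
      omega
  have hl0 : T.legCount c i = 1 := legCount_eq_one.2 ⟨_, h1⟩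
  have hl1 : T.legCount c (i + 1) = 0 := legCount_eq_zero.2 h2
  have hm0 : T.colArm c i = 0 := h.colArm_eq_zero hia
  have hm1 : T.colArm c (i + 1) = 0 := h.colArm_eq_zero (by omega)
  have hM0 : T.colArm (c + 1) i = 0 := colArm_eq_zero.2 fun r₀ => h.right _ _ _ (by omega)
  have hLL : T.legCount (c + 1) i ≤ T.legCount (c + 1) (i + 1) := by
    rw [colMinus, colPlus, hl0, hl1, hm0, hm1, hM0] at hq
    omega
  have hle := h.row_le hT
  have hr : r ≤ r₁ := by
    by_contra h3
    have := hT.col_lt (by omega : r₁ < r) h0 h.mem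
    omega
  obtain ⟨m₀, m₁, e1, e2, e3, e4⟩ := hX.block hT h i
  rw [if_neg (by omega)] at e1 e2
  rw [if_neg (c := r' = r ∧ T.InLeg r c (i + 1) ∧ _) (fun h3 => h2 _ h3.2.1), hl1] at e3
  rw [if_neg (c := i + 1 = a ∨ _) (fun h3 => by
    rcases h3 with h3 | h3
    · omega
    · exact h2 _ h3.2.1)] at e4
  have hμ0 : (r' = r ∧ T.InLeg r c i ∧ a < i) ↔ r' = r ∧ r = r₁ := by
    constructor
    · exact fun h3 => ⟨h3.1, hT.row_eq h3.2.1.inn h0⟩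
    · rintro ⟨rfl, rfl⟩
      exact ⟨rfl, h1, hia⟩
  simp only [hμ0] at e3 e4
  by_cases hμ : r' = r ∧ r = r₁
  · obtain ⟨rfl, rfl⟩ := hμ
    simp only [and_self, or_true, if_true] at e3 e4
    have hXi : X.InLeg r' (c + 1) i :=
      (hX.leg _ _ _).2 (Or.inr ⟨rfl, rfl, Or.inr ⟨rfl, h1, hia⟩⟩)
    have hk : ∀ k, K = some k → i ≤ k := fun k h3 => h.le_of_in hT rfl h0 h3
    have hmem : ∀ r₀ y, T.InLeg r₀ (c + 1) y → a ≤ y → ∃ k, K = some k ∧ k ≤ y :=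
      fun r₀ y h3 h4 => h.exists_le h3 h4
    have hin1 : ∀ r₀, X.In r₀ (c + 1) (i + 1) → T.InLeg r₀ (c + 1) (i + 1) := by
      intro r₀ h3
      rcases hX.in_cases h h3 with h3 | ⟨_, _, h3 | h3⟩
      · exact h.inLeg_of_in (by omega) h3.1
      · omega
      · exact absurd h3.2.1 (h2 _)
    by_cases hKi : K = some i
    · subst hKi
      obtain ⟨h3, h4, h5⟩ := h.some i rfl
      simp only [if_true, Option.some.injEq, Nat.left_eq_add, one_ne_zero, if_false] at e4
      have hin : 0 < X.armCount r' (c + 1) i := by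
        rw [hX.arm]
        simp
      refine ⟨r', c + 1, ?_, hXi.inn, ?_⟩
      · rw [if_pos]
        have := T.legCount_le_one (c + 1) (i + 1)
        omega
      cases hs with
      | up h6 => exact absurd h6 (h2' _)
      | arm _ h6 => exact absurd h3 h6
      | leg _ h6 => exact absurd h3 h6
      | left h6 h7 hm =>
        have h8 := (hT.left_facts h0 hq h6 h7).1
        have hd := hm.bumpData_succ hT h (by omega) ((hm.leg _ _ _).2 (Or.inl ⟨h8, by omega⟩))
        have hX' := (hd.result hT').1
        refine .arm (fun h9 => ?_) (fun h9 => ?_) hin ⟨?_, fun r₀ c₀ y => ?_, fun r₀ c₀ y => ?_⟩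
        · have := hT.row_eq (hin1 _ h9).inn h8.inn
          omega
        · rcases (hX.leg _ _ _).1 h9 with h9 | h9
          · have := hT.row_le (Nat.lt_succ_self _) h8.inn h9.1.inn
            omega
          · omega
        · ext ⟨r₀, c₀⟩
          simp only [YoungDiagram.mem_cells, hX.shape, hX'.shape, hm.shape]
        · rw [hX'.leg, hX.leg, hm.leg, hm.leg]
          have h9 : ¬T.InLeg r' c (i + 1) := h2 _
          grind (splits := 40)
        · rw [hX'.arm, hX.arm, hm.arm]
          grind
    · have hk' : ∀ k, K = some k → i + 1 ≤ k := by
        intro k h3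
        have := hk k h3
        by_contra h4
        obtain rfl : k = i := by omega
        exact hKi h3
      have hi : ∀ r₀, ¬T.InLeg r₀ (c + 1) i := by
        intro r₀ h3
        obtain ⟨k, h4, h5⟩ := hmem _ _ h3 hia.le
        have := hk' k h4
        omega
      have hL1 : (if K = some (i + 1) then 0 else T.legCount (c + 1) (i + 1)) = 0 := by
        split_ifs with h3
        · rfl
        · refine legCount_eq_zero.2 fun r₀ h4 => ?_
          obtain ⟨k, h5, h6⟩ := hmem _ _ h4 (by omega)
          have := hk' k h5
          obtain rfl : k = i + 1 := by omega
          exact h3 h5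
      rw [hL1, if_neg hKi] at e4
      have hX0 : X.armCount r' (c + 1) i = 0 := by
        rw [hX.arm, h.right _ _ _ (by omega), if_neg (c := _ ∧ _ ∧ K = some i)
          fun h1 => hKi h1.2.2]
        omega
      refine ⟨r', c + 1, ?_, hXi.inn, ?_⟩
      · rw [if_pos]
        omega
      cases hs with
      | up h6 => exact absurd h6 (h2' _)
      | arm _ _ h6 => omega
      | left _ h6 => exact absurd h6 (hi _)
      | leg h6 h7 h8 hm =>
        have hd := hm.bumpData h (by omega) (by omega)
        have hX' := (hd.result hT').1
        refine .leg (fun h9 => ?_) (fun h9 => ?_) hX0 ⟨?_, fun r₀ c₀ y => ?_, fun r₀ c₀ y => ?_⟩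
        · have h10 := hin1 _ h9
          obtain ⟨k, h11, h12⟩ := hmem _ _ h10 (by omega)
          have := hT.col_lt (Nat.lt_succ_self r') (h.some k h11).1.inn h10.inn
          have := hk' k h11
          omega
        · rcases (hX.leg _ _ _).1 h9 with ⟨h9, -⟩ | h9
          · have h10 : (r', c + 1) ∈ T.shape := T.shape.up_left_mem le_rfl (by omega) h9.1
            obtain ⟨k, h11⟩ := h.exists_some h10
            have := hT.row_le (Nat.lt_succ_self _) (h.some k h11).1.inn h9.inn
            have := hk' k h11
            omega
          · omega
        · ext ⟨r₀, c₀⟩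
          simp only [YoungDiagram.mem_cells, hX.shape, hX'.shape, hm.shape]
        · rw [hX'.leg, hX.leg, hm.leg, hm.leg]
          have h9 : ¬T.InLeg r' c (i + 1) := h2 _
          have h10 := hi r₀
          grind (splits := 40)
        · rw [hX'.arm, hX.arm, hm.arm]
  · have hXi : X.InLeg r₁ c i := (hX.leg _ _ _).2 (Or.inl ⟨h1, by omega, by omega⟩)
    refine ⟨r₁, c, ?_, hXi.inn, ?_⟩
    · rw [if_neg]
      rw [if_neg (c := i = a ∨ _) (by omega)] at e4
      rw [if_neg hμ] at e3
      have h3 := T.legCount_le_one (c + 1) i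
      have h4 := T.legCount_le_one (c + 1) (i + 1)
      by_cases hKi : K = some i
      · simp only [hKi, if_true, Option.some.injEq, Nat.left_eq_add, one_ne_zero, if_false] at e4
        have : T.legCount (c + 1) i = 1 := legCount_eq_one.2 ⟨_, (h.some i hKi).1⟩
        omega
      · rw [if_neg hKi, if_neg hKi] at e4
        by_cases hK1 : K = some (i + 1)
        · rw [if_pos hK1] at e4
          have : T.legCount (c + 1) i = 0 := legCount_eq_zero.2 fun r₀ h5 => by
            have := (h.some _ hK1).2.2 _ _ h5 hia.le
            omega
          omega
        · rw [if_neg hK1] at e4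
          omega
    · refine hs.bump hT hT' h hX h0 hp (iff_of_false (fun h3 => ?_) (h2' _)) ?_ ?_ (by omega)
        (by omega) (by omega) (by omega) (fun _ _ => ⟨by omega, by omega⟩) (by omega)
      · rcases hX.in_cases h h3 with h3 | h3
        · exact h2' _ h3.1
        · omega
      · rw [hX.leg]
        constructor
        · rintro (h3 | ⟨h3, _, h4 | h4⟩)
          · exact h3.1
          · omega
          · exact absurd (hμ0.1 h4) hμ
        · exact fun h3 => Or.inl ⟨h3, by omega, by omega⟩
      · rw [hX.arm, if_neg (by omega), if_neg (by omega)]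
        omega

end Commute

/-! ### Arm excess and rightmost arm column -/

section Excess

variable {T T' X : Filling} {i : ℕ}

theorem exists_armCount_bound (T : Filling) : ∃ N, ∀ r c x, 0 < T.armCount r c x → x < N := by
  refine ⟨T.shape.cells.sup (fun p => (T.entry p.1 p.2).arm.sup) + 1, fun r c x hx => ?_⟩
  have h1 : (r, c) ∈ T.shape.cells := mem_of_armCount hx
  have h2 : x ≤ (T.entry r c).arm.sup := Multiset.le_sup (Multiset.count_pos.1 hx)
  have h3 := Finset.le_sup (f := fun p : ℕ × ℕ => (T.entry p.1 p.2).arm.sup) h1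
  simp only at h3
  omega

theorem armExcess_eq_sum {S : Finset (ℕ × ℕ)} {N : ℕ} (hS : T.shape.cells ⊆ S)
    (hN : ∀ r c x, 0 < T.armCount r c x → x < N) :
    T.armExcess = ∑ p ∈ S, ∑ x ∈ Finset.range N, T.armCount p.1 p.2 x := by
  rw [armExcess]
  refine (Finset.sum_congr rfl fun p _ => ?_).trans (Finset.sum_subset hS fun p _ hp => ?_)
  · refine (Multiset.sum_count_eq_card fun x hx => ?_).symm
    exact Finset.mem_range.2 (hN p.1 p.2 x (Multiset.count_pos.2 hx))
  · refine Finset.sum_eq_zero fun x _ => Nat.eq_zero_of_not_pos fun h => hp ?_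
    exact mem_of_armCount h

/-- The additive form avoids truncated subtraction. The propositions `P₁` and `P₂` switch the
removal and the creation of a letter on or off, so that one statement covers moves in arms, moves in
legs, and bumpings with or without `k`. -/
theorem armExcess_add {r₁ c₁ x₁ r₂ c₂ x₂ : ℕ} {P₁ P₂ : Prop} [Decidable P₁] [Decidable P₂]
    (h : ∀ r c x, T'.armCount r c x + (if (r = r₁ ∧ c = c₁ ∧ x = x₁) ∧ P₁ then 1 else 0) =
      T.armCount r c x + (if (r = r₂ ∧ c = c₂ ∧ x = x₂) ∧ P₂ then 1 else 0)) :
    T'.armExcess + (if P₁ then 1 else 0) = T.armExcess + (if P₂ then 1 else 0) := by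
  obtain ⟨N, hN⟩ := T.exists_armCount_bound
  obtain ⟨N', hN'⟩ := T'.exists_armCount_bound
  let M := N + N' + x₁ + x₂ + 1
  let S := T.shape.cells ∪ T'.shape.cells ∪ {(r₁, c₁), (r₂, c₂)}
  have hsum : ∀ (P : Prop) [Decidable P] (r c x : ℕ), (r, c) ∈ S → x < M →
      (if P then 1 else 0) = ∑ p ∈ S, ∑ y ∈ Finset.range M,
        if (p.1 = r ∧ p.2 = c ∧ y = x) ∧ P then 1 else 0 := by
    intro P _ r c x h1 h2
    by_cases hP : P
    · rw [if_pos hP, Finset.sum_eq_single_of_mem (r, c) h1,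
        Finset.sum_eq_single_of_mem x (Finset.mem_range.2 h2)]
      · simp [hP]
      · intro y _ hy
        simp [hy]
      · rintro ⟨r₀, c₀⟩ _ hp
        refine Finset.sum_eq_zero fun y _ => if_neg fun h3 => hp ?_
        rw [← h3.1.1, ← h3.1.2.1]
    · simp [hP]
  rw [armExcess_eq_sum (T := T) (S := S) (N := M) (by grind)
      fun r c x hx => by have := hN r c x hx; omega,
    armExcess_eq_sum (T := T') (S := S) (N := M) (by grind)
      fun r c x hx => by have := hN' r c x hx; omega,
    hsum P₁ r₁ c₁ x₁ (by simp [S]) (by omega), hsum P₂ r₂ c₂ x₂ (by simp [S]) (by omega)]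
  simp only [← Finset.sum_add_distrib, h]

theorem ArmMove.armExcess {r₁ c₁ x₁ r₂ c₂ x₂ : ℕ} (hm : ArmMove T r₁ c₁ x₁ r₂ c₂ x₂ T')
    (h : 0 < T.armCount r₁ c₁ x₁) : T'.armExcess = T.armExcess := by
  have := armExcess_add (T := T) (T' := T') (r₁ := r₁) (c₁ := c₁) (x₁ := x₁) (r₂ := r₂) (c₂ := c₂)
    (x₂ := x₂) (P₁ := True) (P₂ := True) fun r c x => by
      rw [hm.arm]
      by_cases h1 : r = r₁ ∧ c = c₁ ∧ x = x₁
      · simp only [and_true, if_pos h1]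
        obtain ⟨rfl, rfl, rfl⟩ := h1
        omega
      · simp only [and_true, if_neg h1]
        omega
  simpa using this

theorem LegMove.armExcess {r₁ c₁ x₁ r₂ c₂ x₂ : ℕ} (hm : LegMove T r₁ c₁ x₁ r₂ c₂ x₂ T') :
    T'.armExcess = T.armExcess := by
  have := armExcess_add (T := T) (T' := T') (r₁ := r₁) (c₁ := c₁) (x₁ := x₁) (r₂ := r₂) (c₂ := c₂)
    (x₂ := x₂) (P₁ := False) (P₂ := False) fun r c x => by
      rw [hm.arm]
      simp
  simpa using this

theorem BumpResult.armExcess {c r a : ℕ} {K : Option ℕ} {r' : ℕ} (h : BumpData T c r a K r')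
    (hX : BumpResult T c r a K r' X) :
    X.armExcess + 1 = T.armExcess + (if K = none then 0 else 1) := by
  have := armExcess_add (T := T) (T' := X) (r₁ := r) (c₁ := c) (x₁ := a) (r₂ := r') (c₂ := c + 1)
    (x₂ := K.getD 0) (P₁ := True) (P₂ := K ≠ none) fun r₀ c₀ x => by
      have h2 : (r₀ = r' ∧ c₀ = c + 1 ∧ K = some x) ↔
          (r₀ = r' ∧ c₀ = c + 1 ∧ x = K.getD 0) ∧ K ≠ none := by
        cases K <;> simp [eq_comm]
      rw [hX.arm]
      simp only [h2, and_true]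
      by_cases h1 : r₀ = r ∧ c₀ = c ∧ x = a
      · simp only [if_pos h1]
        obtain ⟨rfl, rfl, rfl⟩ := h1
        have := h.pos
        omega
      · simp only [if_neg h1]
        omega
  simpa using this

theorem armCol_congr (h : ∀ c, (∃ r x, 0 < T.armCount r c x) ↔ ∃ r x, 0 < T'.armCount r c x) :
    T.armCol = T'.armCol := by
  have h1 : T.armCells.image Prod.snd = T'.armCells.image Prod.snd := by
    ext c
    simp only [Finset.mem_image, Prod.exists, exists_eq_right, mem_armCells]
    exact h c
  have h2 : ∀ Y : Filling, Y.armCol = (Y.armCells.image Prod.snd).sup id := fun Y => by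
    rw [Finset.sup_image]
    rfl
  rw [h2, h2, h1]

theorem ArmMove.armCol {r₁ c₁ x₁ r₂ x₂ : ℕ} (hm : ArmMove T r₁ c₁ x₁ r₂ c₁ x₂ T')
    (h : 0 < T.armCount r₁ c₁ x₁) : T'.armCol = T.armCol := by
  refine armCol_congr fun c => ?_
  by_cases hc : c = c₁
  · subst hc
    refine iff_of_true ⟨r₂, x₂, ?_⟩ ⟨_, _, h⟩
    rw [hm.arm, if_pos (c := r₂ = r₂ ∧ _) ⟨rfl, rfl, rfl⟩]
    omega
  · simp [hm.arm, hc]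

theorem LegMove.armCol {r₁ c₁ x₁ r₂ c₂ x₂ : ℕ} (hm : LegMove T r₁ c₁ x₁ r₂ c₂ x₂ T') :
    T'.armCol = T.armCol :=
  armCol_congr fun c => by simp only [hm.arm]

/-- These are the quantities that control the number of uncrowding steps and the recorded numbers.
Moves in arms stay inside one column, so they do not change which columns have nonempty arms. -/
theorem IsHVT.f_invariants (hT : T.IsHVT) (hf : T.f i = some T') :
    T'.IsHVT ∧ T'.shape = T.shape ∧ T'.armExcess = T.armExcess ∧ T'.armCol = T.armCol := by
  obtain ⟨r, c, -, h0, hp, hq, hs, hT'⟩ := hT.f_cases hf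
  refine ⟨hT', hs.shape, ?_⟩
  cases hs with
  | up h hm => exact ⟨hm.armExcess (hT.up_facts h0 hp h).1, hm.armCol (hT.up_facts h0 hp h).1⟩
  | left _ _ hm => exact ⟨hm.armExcess, hm.armCol⟩
  | arm _ _ h hm => exact ⟨hm.armExcess h, hm.armCol h⟩
  | leg _ _ _ hm => exact ⟨hm.armExcess, hm.armCol⟩

end Excess

/-! ### One bumping intertwines with the crystal operators -/

section Signature

variable {T T' X : Filling} {i c r a r' : ℕ} {K : Option ℕ}

theorem BumpResult.colMinus_of_ne (h : BumpData T c r a K r') (hX : BumpResult T c r a K r' X)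
    {j : ℕ} (h1 : j ≠ c) (h2 : j ≠ c + 1) : colMinus i T j = colMinus i X j := by
  have e1 := hX.colArm h j i
  simp only [h1, h2, false_and, if_false, add_zero] at e1
  rw [colMinus, colMinus, hX.legCount_of_ne h1 h2, hX.legCount_of_ne h1 h2, e1]

theorem BumpResult.colPlus_of_ne (h : BumpData T c r a K r') (hX : BumpResult T c r a K r' X)
    {j : ℕ} (h1 : j ≠ c) (h2 : j ≠ c + 1) : colPlus i T j = colPlus i X j := by
  have e1 := hX.colArm h j i
  have e2 := hX.colArm h j (i + 1)
  simp only [h1, h2, false_and, if_false, add_zero] at e1 e2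
  rw [colPlus, colPlus, hX.legCount_of_ne h1 h2, hX.legCount_of_ne h1 h2, e1, e2]

/-- The uncrowding bumping commutes with `f i`. -/
theorem IsHVT.bump_f (hT : T.IsHVT) (hf : T.f i = some T') : T.bump.f i = some T'.bump := by
  obtain ⟨hT', -, hex, -⟩ := hT.f_invariants hf
  by_cases h0 : T.armExcess = 0
  · rwa [bump_of_armExcess_eq_zero h0, bump_of_armExcess_eq_zero (hex.trans h0)]
  obtain ⟨c, r, a, K, r', h⟩ := exists_bumpData h0
  obtain ⟨hX, -⟩ := h.result hT
  have hXT := h.isHVT hT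
  generalize T.bump = X at hX hXT ⊢
  -- Large enough to contain all columns of both tableaux and the two columns of the block.
  let n := T.shape.rowLen 0 + X.shape.rowLen 0 + c + 2
  obtain ⟨hP, hQ⟩ := hX.signature hT h i
  suffices hmain : ∃ r₂ c₂, lastMinus (colMinus i X) (colPlus i X) n = some c₂ ∧ X.In r₂ c₂ i ∧
      FStep i X r₂ c₂ T'.bump by
    obtain ⟨r₂, c₂, h1, h2, h3⟩ := hmain
    obtain ⟨r₃, Y, h4, -, -, h5, h6, h7⟩ := hXT.f_spec (by omega) h1
    obtain rfl : r₂ = r₃ := hXT.row_eq h2 h4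
    rw [h7, h5.unique h3 h6.isCanon hT'.bump.isCanon]
  obtain ⟨-, hb⟩ := lastMinus_block (by omega : c + 2 ≤ n)
    (fun j h1 h2 => hX.colMinus_of_ne (i := i) h h1 h2)
    (fun j h1 h2 => hX.colPlus_of_ne (i := i) h h1 h2) hP hQ
  have hspec : ∀ c₁, lastMinus (colMinus i T) (colPlus i T) n = some c₁ → ∃ r₁, T.In r₁ c₁ i ∧
      0 < colMinus i T c₁ ∧ colMinus i T (c₁ + 1) ≤ colPlus i T c₁ ∧ FStep i T r₁ c₁ T' := by
    intro c₁ h1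
    obtain ⟨r₁, Y, h2, h3, h4, h5, -, h6⟩ := hT.f_spec (by omega) h1
    obtain rfl : T' = Y := by simpa [hf] using h6
    exact ⟨r₁, h2, h3, h4, h5⟩
  rcases hb with ⟨h1, -⟩ | ⟨c₁, h1, h2, h3, h4⟩ | ⟨h1, h2⟩
  · simp [hT.f_eq_none (by omega) h1] at hf
  · obtain ⟨r₁, h5, h6, h7, h8⟩ := hspec _ h3
    exact ⟨r₁, c₁, h4, h8.bump_away hT hT' h hX h5 h6 h1 h2⟩
  obtain ⟨r₁, h5, h6, h7, h8⟩ := hspec _ h1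
  by_cases h9 : colPlus i T c < colMinus i T (c + 1)
  · rw [if_pos h9] at h5 h6 h8
    obtain ⟨h10, h11, h12⟩ := h8.bump_right hT hT' h hX h5 h6 h9
    rw [if_pos h10] at h2
    exact ⟨_, _, h2, h11, h12⟩
  · rw [if_neg h9] at h5 h6 h7 h8
    rcases lt_trichotomy i a with h10 | rfl | h10
    · obtain ⟨h11, h12⟩ := h8.bump_of_lt hT hT' h hX h5 h6 h7 h10
      rw [if_neg h11] at h2
      exact ⟨_, _, h2, h12⟩
    · by_cases hK : K = some i
      · subst hK
        obtain ⟨h11, h12⟩ := h8.bump_of_eq_of_eq hT hT' h hX h5 h6 h7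
        rw [if_pos h11] at h2
        exact ⟨_, _, h2, h12⟩
      · obtain ⟨r₂, c₂, h11, h12⟩ := h8.bump_of_eq_of_ne hT hT' h hX h5 h6 hK
        exact ⟨r₂, c₂, h11 ▸ h2, h12⟩
    · obtain ⟨r₂, c₂, h11, h12⟩ := h8.bump_of_gt hT hT' h hX h5 h6 h7 h10
      exact ⟨r₂, c₂, h11 ▸ h2, h12⟩

/-- Both statements come from the block comparison: for `f i` no column is selected on either side,
and for `e i` the final number of unpaired pluses is the same. -/
theorem IsHVT.bump_eq_none (hT : T.IsHVT) :
    (T.f i = none → T.bump.f i = none) ∧ (T.e i = none → T.bump.e i = none) := by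
  by_cases h0 : T.armExcess = 0
  · rw [bump_of_armExcess_eq_zero h0]
    exact ⟨id, id⟩
  obtain ⟨c, r, a, K, r', h⟩ := exists_bumpData h0
  obtain ⟨hX, -⟩ := h.result hT
  have hXT := h.isHVT hT
  generalize T.bump = X at hX hXT ⊢
  let n := T.shape.rowLen 0 + X.shape.rowLen 0 + c + 2
  obtain ⟨hP, hQ⟩ := hX.signature hT h i
  obtain ⟨hb, hb'⟩ := lastMinus_block (by omega : c + 2 ≤ n)
    (fun j h1 h2 => hX.colMinus_of_ne (i := i) h h1 h2)
    (fun j h1 h2 => hX.colPlus_of_ne (i := i) h h1 h2) hP hQ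
  constructor
  · intro hf
    have h1 : ∀ c₁, lastMinus (colMinus i T) (colPlus i T) n ≠ some c₁ := fun c₁ h1 => by
      obtain ⟨r, -, h2⟩ := hT.f_eq_some (by omega) h1
      simp [hf] at h2
    rcases hb' with h2 | ⟨c₁, -, -, h2, -⟩ | ⟨h2, -⟩
    · exact hXT.f_eq_none (by omega) h2.2
    · exact absurd h2 (h1 _)
    · exact absurd h2 (h1 _)
  · intro he
    refine hXT.e_eq_none (n := n) (by omega) (firstPlus_eq_none.2 ?_)
    rw [← hb]
    refine firstPlus_eq_none.1 ?_
    cases h1 : firstPlus (colMinus i T) (colPlus i T) n with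
    | none => rfl
    | some c₁ =>
      obtain ⟨r, -, h2⟩ := hT.e_eq_some (by omega) h1
      simp [he] at h2

end Signature

/-! ### Insertion and uncrowding intertwine with the crystal operators -/

section Iterate

variable {T T' : Filling} {i : ℕ}

theorem IsHVT.iterate_bump (hT : T.IsHVT) (d : ℕ) : (Filling.bump^[d] T).IsHVT := by
  induction d with
  | zero => exact hT
  | succ d ih =>
    rw [Function.iterate_succ_apply']
    exact ih.bump

theorem IsHVT.insertion (hT : T.IsHVT) : T.insertion.IsHVT := hT.iterate_bump _

theorem IsHVT.iterate_bump_f (hT : T.IsHVT) (hf : T.f i = some T') (d : ℕ) :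
    (Filling.bump^[d] T).f i = some (Filling.bump^[d] T') := by
  induction d with
  | zero => exact hf
  | succ d ih =>
    rw [Function.iterate_succ_apply', Function.iterate_succ_apply']
    exact (hT.iterate_bump d).bump_f ih

theorem IsHVT.iterate_bump_eq_none (hT : T.IsHVT) (d : ℕ) :
    (T.f i = none → (Filling.bump^[d] T).f i = none) ∧
      (T.e i = none → (Filling.bump^[d] T).e i = none) := by
  induction d with
  | zero => exact ⟨id, id⟩
  | succ d ih =>
    rw [Function.iterate_succ_apply']
    have := (hT.iterate_bump d).bump_eq_none (i := i)
    exact ⟨this.1 ∘ ih.1, this.2 ∘ ih.2⟩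

/-- The uncrowding insertion commutes with `f i`. -/
theorem IsHVT.insertion_f (hT : T.IsHVT) (hi : 1 ≤ i) (hf : T.f i = some T') :
    T.insertion.f i = some T'.insertion := by
  have hsh : ∀ d, (Filling.bump^[d] T').shape = (Filling.bump^[d] T).shape := fun d =>
    ((hT.iterate_bump d).f_invariants (hT.iterate_bump_f hf d)).2.1
  -- The stopping condition involves equality of tableaux, so injectivity of `f i` is needed to
  -- transfer it back from `T'` to `T`; `e i` provides the inverse.
  have heq : ∀ d, Filling.bump^[d + 1] T = Filling.bump^[d] T ↔
      Filling.bump^[d + 1] T' = Filling.bump^[d] T' := by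
    intro d
    have h1 := hT.iterate_bump_f hf d
    have h2 := hT.iterate_bump_f hf (d + 1)
    constructor
    · intro h
      rw [h, h1] at h2
      exact (Option.some.inj h2).symm
    · intro h
      have h3 := (hT.iterate_bump d).e_of_f hi h1
      have h4 := (hT.iterate_bump (d + 1)).e_of_f hi h2
      rw [h, h3] at h4
      exact (Option.some.inj h4).symm
  have hset : {d : ℕ | (Filling.bump^[d + 1] T').shape ≠ (Filling.bump^[d] T').shape ∨
      Filling.bump^[d + 1] T' = Filling.bump^[d] T'} =
      {d : ℕ | (Filling.bump^[d + 1] T).shape ≠ (Filling.bump^[d] T).shape ∨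
      Filling.bump^[d + 1] T = Filling.bump^[d] T} := by
    ext d
    simp only [Set.mem_ofPred_eq, hsh, heq]
  rw [Filling.insertion, Filling.insertion, hset]
  exact hT.iterate_bump_f hf _

theorem IsHVT.iterate_uncrowdStep_isHVT (hT : T.IsHVT) (S : SkewFilling) (d : ℕ) :
    (uncrowdStep^[d] (T, S)).1.IsHVT := by
  induction d with
  | zero => exact hT
  | succ d ih =>
    rw [Function.iterate_succ_apply']
    exact ih.insertion

theorem IsHVT.iterate_uncrowdStep_f (hT : T.IsHVT) (hi : 1 ≤ i) (hf : T.f i = some T')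
    (S : SkewFilling) (d : ℕ) :
    (uncrowdStep^[d] (T, S)).1.f i = some (uncrowdStep^[d] (T', S)).1 ∧
      (uncrowdStep^[d] (T, S)).2 = (uncrowdStep^[d] (T', S)).2 := by
  induction d with
  | zero => exact ⟨hf, rfl⟩
  | succ d ih =>
    rw [Function.iterate_succ_apply', Function.iterate_succ_apply']
    have h1 := hT.iterate_uncrowdStep_isHVT S d
    have h2 := h1.insertion_f hi ih.1
    refine ⟨h2, ?_⟩
    rw [uncrowdStep, uncrowdStep, ih.2, (h1.insertion.f_invariants h2).2.1,
      (h1.f_invariants ih.1).2.2.2]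

theorem IsHVT.iterate_uncrowdStep_eq_none (hT : T.IsHVT) (S : SkewFilling) (d : ℕ) :
    (T.f i = none → (uncrowdStep^[d] (T, S)).1.f i = none) ∧
      (T.e i = none → (uncrowdStep^[d] (T, S)).1.e i = none) := by
  induction d with
  | zero => exact ⟨id, id⟩
  | succ d ih =>
    rw [Function.iterate_succ_apply']
    have := (hT.iterate_uncrowdStep_isHVT S d).iterate_bump_eq_none (i := i)
    exact ⟨fun h => (this _).1 (ih.1 h), fun h => (this _).2 (ih.2 h)⟩

theorem IsHVT.isHVT_P (hT : T.IsHVT) : T.P.IsHVT := hT.iterate_uncrowdStep_isHVT _ _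

theorem IsHVT.P_f (hT : T.IsHVT) (hi : 1 ≤ i) (hf : T.f i = some T') :
    T.P.f i = some T'.P ∧ T.Q = T'.Q := by
  obtain ⟨-, h1, h2, -⟩ := hT.f_invariants hf
  rw [P, P, Q, Q, uncrowd, uncrowd, h1, h2]
  exact hT.iterate_uncrowdStep_f hi hf _ _

/-- The statement for `f i` is applied to `T'`, from which `f i` leads back to `T`, and then
inverted for the insertion tableaux. -/
theorem IsHVT.P_e (hT : T.IsHVT) (hi : 1 ≤ i) (he : T.e i = some T') :
    T.P.e i = some T'.P ∧ T.Q = T'.Q := by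
  obtain ⟨_, _, -, -, -, -, -, hT'⟩ := hT.e_cases hi he
  obtain ⟨h1, h2⟩ := hT'.P_f hi (hT.f_of_e hi he)
  exact ⟨hT'.isHVT_P.e_of_f hi h1, h2.symm⟩

end Iterate

/-! ### Insertion paths -/

/-- `X` arises from `T` by uncrowding bumpings up to the first one that changes the shape. -/
inductive Inserts : Filling → Filling → Prop
  | last {T : Filling} {c r a r' : ℕ} (h : BumpData T c r a none r') : Inserts T T.bump
  | step {T X : Filling} {c r a k r' : ℕ} (h : BumpData T c r a (some k) r')
      (hX : Inserts T.bump X) : Inserts T X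

section Inserts

variable {T X : Filling} {c r a r' : ℕ} {K : Option ℕ}

theorem BumpData.shape_eq {k : ℕ} (hT : T.IsHVT) (h : BumpData T c r a (Option.some k) r') :
    T.bump.shape = T.shape := by
  ext ⟨r₀, c₀⟩
  rw [YoungDiagram.mem_cells, YoungDiagram.mem_cells, (h.result hT).1.shape, or_iff_left_iff_imp]
  rintro ⟨rfl, rfl⟩
  exact (h.some k rfl).1.1

/-- All arms to the right of column `c` were empty, so the displaced `k` is now the only arm entry
there, and the next bumping starts from it. -/
theorem BumpData.next {k : ℕ} (hT : T.IsHVT) (h : BumpData T c r a (Option.some k) r') :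
    ∃ K' r'', BumpData T.bump (c + 1) r' k K' r'' := by
  have hX := (h.result hT).1
  have hr := fun r₀ x => h.right r₀ (c + 1) x (by omega)
  have h1 : 0 < T.bump.armCount r' (c + 1) k := by
    rw [hX.arm]
    simp
  have h2 : T.bump.armExcess ≠ 0 := fun h2 => by
    rw [armExcess_eq_zero.1 h2] at h1
    omega
  have h3 : ∀ r₀ c₀ x, c < c₀ → 0 < T.bump.armCount r₀ c₀ x → r₀ = r' ∧ c₀ = c + 1 ∧ x = k := by
    intro r₀ c₀ x h3 h4
    by_contra h5
    rw [hX.arm, h.right r₀ c₀ x h3, if_neg (c := r₀ = r' ∧ c₀ = c + 1 ∧ _)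
      (fun h6 => h5 ⟨h6.1, h6.2.1, (Option.some.inj h6.2.2).symm⟩)] at h4
    omega
  obtain ⟨c₁, r₁, a₁, K', r'', h4⟩ := exists_bumpData h2
  have h5 : c < c₁ := by
    by_contra h5
    have := h4.right r' (c + 1) k (by omega)
    omega
  obtain ⟨rfl, rfl, rfl⟩ := h3 _ _ _ h5 h4.pos
  exact ⟨K', r'', h4⟩

theorem sInf_succ {S : Set ℕ} (h : 0 ∉ S) (hS : {d | d + 1 ∈ S}.Nonempty) :
    sInf S = sInf {d | d + 1 ∈ S} + 1 := by
  have h1 : sInf {d | d + 1 ∈ S} + 1 ∈ S := Nat.sInf_mem hS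
  refine le_antisymm (Nat.sInf_le h1) ?_
  have h2 := Nat.sInf_mem ⟨_, h1⟩
  obtain ⟨d, hd⟩ : ∃ d, sInf S = d + 1 := by
    refine Nat.exists_eq_succ_of_ne_zero fun h3 => h ?_
    rwa [h3] at h2
  rw [hd] at h2 ⊢
  exact Nat.succ_le_succ (Nat.sInf_le h2)

/-- As long as the shape does not change, each bumping advances the starting column by one. This
column stays inside the diagram, so the number `n` of remaining columns bounds the process, and the
infimum in the definition of the insertion is attained. -/
theorem IsHVT.inserts (hT : T.IsHVT) (h : T.armExcess ≠ 0) :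
    {d : ℕ | (Filling.bump^[d + 1] T).shape ≠ (Filling.bump^[d] T).shape ∨
      Filling.bump^[d + 1] T = Filling.bump^[d] T}.Nonempty ∧ Inserts T T.insertion := by
  obtain ⟨n, hn⟩ : ∃ n, T.shape.rowLen 0 ≤ n + T.armCol := ⟨T.shape.rowLen 0, by omega⟩
  induction n generalizing T with
  | zero =>
    obtain ⟨c, r, a, K, r', h1⟩ := exists_bumpData h
    have := h1.armCol
    have := YoungDiagram.mem_iff_lt_rowLen.1
      (T.shape.up_left_mem (Nat.zero_le r) le_rfl h1.mem.mem)
    omega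
  | succ n ih =>
    obtain ⟨c, r, a, K, r', h1⟩ := exists_bumpData h
    have hc := h1.armCol
    have hX := (h1.result hT).1
    cases K with
    | none =>
      have h2 : 0 ∈ {d : ℕ | (Filling.bump^[d + 1] T).shape ≠ (Filling.bump^[d] T).shape ∨
          Filling.bump^[d + 1] T = Filling.bump^[d] T} := by
        refine Or.inl fun h2 => ?_
        have h3 : (r', c + 1) ∈ T.bump.shape := (hX.shape _ _).2 (Or.inr ⟨rfl, rfl⟩)
        rw [show T.bump.shape = T.shape from h2, (h1.none rfl).1,
          YoungDiagram.mem_iff_lt_colLen] at h3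
        omega
      refine ⟨⟨0, h2⟩, ?_⟩
      rw [Filling.insertion, Nat.sInf_eq_zero.2 (Or.inl h2)]
      exact .last h1
    | some k =>
      obtain ⟨K', r'', h2⟩ := h1.next hT
      have hc' := h2.armCol
      obtain ⟨h3, h4⟩ := ih hT.bump (fun h3 => by
        have := h2.pos
        rw [armExcess_eq_zero.1 h3] at this
        omega) (by rw [h1.shape_eq hT]; omega)
      have h5 : 0 ∉ {d : ℕ | (Filling.bump^[d + 1] T).shape ≠ (Filling.bump^[d] T).shape ∨
          Filling.bump^[d + 1] T = Filling.bump^[d] T} := by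
        rintro (h5 | h5)
        · exact h5 (h1.shape_eq hT)
        · have h6 : T.bump = T := h5
          rw [h6] at hc'
          omega
      obtain ⟨d, hd⟩ := h3
      refine ⟨⟨d + 1, hd⟩, ?_⟩
      have h6 : T.insertion = T.bump.insertion := by
        rw [Filling.insertion, sInf_succ h5 ⟨d, hd⟩]
        rfl
      rw [h6]
      exact .step h1 h4

end Inserts

/-! ### Trails of insertions -/

/-- There are entries `b ≤ x₁ ≤ x₂ ≤ …` of extended legs in the columns `c + 1, c + 2, …, c'`. -/
inductive Trail (Z : Filling) (c' : ℕ) : ℕ → ℕ → Prop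
  | nil (b : ℕ) : Trail Z c' c' b
  | cons {c b r x : ℕ} (hx : Z.InLeg r (c + 1) x) (hb : b ≤ x) (h : Trail Z c' (c + 1) x) :
      Trail Z c' c b

section Trail

variable {Z Z' T X : Filling} {c' c b : ℕ}

theorem Trail.mono (h : Trail Z c' c b) {b' : ℕ} (hb : b' ≤ b) : Trail Z c' c b' := by
  cases h with
  | nil => exact .nil _
  | cons hx hb' h => exact .cons hx (hb.trans hb') h

theorem Trail.le (h : Trail Z c' c b) : c ≤ c' := by
  induction h with
  | nil => exact le_rfl
  | cons _ _ _ ih => omega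

theorem Trail.truncate (h : Trail Z c' c b) {c₀ : ℕ} (h₁ : c ≤ c₀) (h₂ : c₀ ≤ c') :
    Trail Z c₀ c b := by
  induction h with
  | nil =>
    obtain rfl := le_antisymm h₁ h₂
    exact .nil _
  | @cons c b r x hx hb h ih =>
    rcases h₁.eq_or_lt with rfl | h₁
    · exact .nil _
    · exact .cons hx hb (ih h₁)

theorem Trail.congr (h : Trail Z c' c b)
    (hZ : ∀ r c₀ x, c < c₀ → (Z.InLeg r c₀ x → Z'.InLeg r c₀ x)) : Trail Z' c' c b := by
  induction h with
  | nil => exact .nil _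
  | cons hx hb h ih =>
    exact .cons (hZ _ _ _ (Nat.lt_succ_self _) hx) hb (ih fun r c₀ x h1 => hZ r c₀ x (by omega))

/-- The effect of the uncrowding insertion: a new cell in column `c'`, one arm entry less, and a
trail of extended leg entries from the old arm entry to the new cell. -/
theorem Inserts.spec (h : Inserts T X) (hT : T.IsHVT) {c r a : ℕ} {K : Option ℕ} {r' : ℕ}
    (hd : BumpData T c r a K r') : ∃ r₁ c₁, (r₁, c₁) ∉ T.shape ∧ c < c₁ ∧
      (∀ p, p ∈ X.shape ↔ p ∈ T.shape ∨ p = (r₁, c₁)) ∧ X.armExcess + 1 = T.armExcess ∧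
      (∀ r₀ c₀ x, X.armCount r₀ c₀ x = if c < c₀ then 0 else
        T.armCount r₀ c₀ x - (if r₀ = r ∧ c₀ = c ∧ x = a then 1 else 0)) ∧
      (∀ r₀ c₀ x, c₀ ≤ c → (c₀ = c → x ≤ a) → T.InLeg r₀ c₀ x → X.InLeg r₀ c₀ x) ∧ Trail X c₁ c a ∧
      ∀ c₀, Trail T c₀ c a → c₀ < c₁ := by
  induction h generalizing c r a K r' with
  | @last T c₂ r₂ a₂ r₂' h =>
    obtain ⟨rfl, rfl, rfl, rfl, rfl⟩ := h.unique hT hd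
    have hX := (hd.result hT).1
    refine ⟨r', c + 1, ?_, Nat.lt_succ_self c, ?_, ?_, ?_, ?_, ?_, ?_⟩
    · rw [YoungDiagram.mem_iff_lt_colLen, (hd.none rfl).1]
      omega
    · rintro ⟨r₀, c₀⟩
      rw [hX.shape, Prod.mk.injEq]
    · simpa using hX.armExcess hd
    · intro r₀ c₀ x
      rw [hX.arm, if_neg (c := r₀ = r' ∧ c₀ = c + 1 ∧ none = some x) (by simp)]
      by_cases h1 : c < c₀
      · rw [if_pos h1, hd.right _ _ _ h1]
        omega
      · rw [if_neg h1]
        omega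
    · exact fun r₀ c₀ x h1 h2 h3 => (hX.leg _ _ _).2 (Or.inl ⟨h3, by omega, by omega⟩)
    · exact .cons ((hX.leg _ _ _).2 (Or.inr ⟨rfl, rfl, Or.inl rfl⟩)) le_rfl (.nil _)
    · intro c₀ h1
      cases h1 with
      | nil => exact Nat.lt_succ_self c
      | cons hx hb _ =>
        have := (hd.none rfl).2 _ _ hx
        omega
  | @step T X c₂ r₂ a₂ k r₂' h hI ih =>
    obtain ⟨rfl, rfl, rfl, rfl, rfl⟩ := h.unique hT hd
    have hX := (hd.result hT).1
    obtain ⟨K', r'', hd'⟩ := hd.next hT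
    obtain ⟨r₁, c₁, h1, h2, h3, h4, h5, h6, h7, h8⟩ := ih hT.bump hd'
    rw [hd.shape_eq hT] at h1
    rw [hd.shape_eq hT] at h3
    obtain ⟨h9, h10, h11⟩ := hd.some k rfl
    -- The later bumpings of this insertion start with `k ≥ a` in column `c + 1`, so the `a` just
    -- placed there survives and begins the trail.
    have h12 : X.InLeg r' (c + 1) a :=
      h6 r' _ a le_rfl (fun _ => h10) ((hX.leg _ _ _).2 (Or.inr ⟨rfl, rfl, Or.inl rfl⟩))
    refine ⟨r₁, c₁, h1, by omega, h3, ?_, ?_, ?_, .cons h12 le_rfl (h7.mono h10), ?_⟩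
    · have := hX.armExcess hd
      simp only [reduceCtorEq, if_false] at this
      omega
    · intro r₀ c₀ x
      have h13 : (r₀ = r' ∧ c₀ = c + 1 ∧ some k = some x) ↔ (r₀ = r' ∧ c₀ = c + 1 ∧ x = k) := by
        rw [Option.some.injEq, eq_comm (a := k)]
      rw [h5, hX.arm, if_congr h13 rfl rfl]
      by_cases h14 : c < c₀
      · rw [if_pos h14, hd.right _ _ _ h14]
        split_ifs <;> omega
      · rw [if_neg h14, if_neg (c := c + 1 < c₀) (by omega),
          if_neg (c := r₀ = r' ∧ c₀ = c + 1 ∧ x = k) (by omega)]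
        omega
    · intro r₀ c₀ x h13 h14 h15
      exact h6 _ _ _ (by omega) (by omega)
        ((hX.leg _ _ _).2 (Or.inl ⟨h15, by omega, by omega⟩))
    · intro c₀ h13
      cases h13 with
      | nil => omega
      | @cons _ _ r₃ x hx hb h14 =>
        -- The first entry `x` of the given trail is a candidate for displacement, so `k ≤ x` and
        -- the rest of the trail can be started from `k`. It lies to the right of column `c + 1`,
        -- where this bumping changes nothing.
        refine h8 _ ((h14.mono (h11 _ _ hx hb)).congr fun r₀ c₃ y h15 h16 => ?_)
        exact (hX.leg _ _ _).2 (Or.inl ⟨h16, by omega, by omega⟩)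

end Trail

/-! ### The recording tableau -/

/-- The invariant of the uncrowding map. The recorded number in a new cell is less than the distance
of its column from the rightmost column with nonzero arm excess, or equal to it; in the latter case
the next insertion has to end further to the right. -/
structure UncrowdInvariant (μ : YoungDiagram) (X : Filling × SkewFilling) : Prop where
  isHVT : X.1.IsHVT
  flagged : X.2.IsColumnFlaggedIncreasing
  inner : X.2.inner = μ
  outer : X.2.outer = X.1.shape
  trail : ∀ c r a K r', BumpData X.1 c r a K r' → ∀ r₀ c₀, (r₀, c₀) ∈ X.2.outer →
    (r₀, c₀) ∉ X.2.inner → X.2.entry r₀ c₀ + c < c₀ ∨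
      (X.2.entry r₀ c₀ + c = c₀ ∧ Trail X.1 c₀ c a)

theorem UncrowdInvariant.empty {T : Filling} (hT : T.IsHVT) :
    UncrowdInvariant T.shape (T, SkewFilling.empty T.shape) where
  isHVT := hT
  flagged := {
    le := le_rfl
    colLen_zero := rfl
    pos := fun _ _ h h' => absurd h h'
    flag := fun _ _ h h' => absurd h h'
    row := fun _ _ _ hc h h' => absurd (T.shape.up_left_mem le_rfl hc.le h') h
    col := fun _ _ _ hr h h' => absurd (T.shape.up_left_mem hr.le le_rfl h') h }
  inner := rfl
  outer := rfl
  trail _ _ _ _ _ _ _ _ h h' := absurd h h'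

/-- The invariant bounds each old entry by its column minus `c`, and the new entry equals its column
minus `c`, so rows increase. For columns, equality at an old cell comes with a trail to its column,
which the new cell has to pass. The number of rows is unchanged because new cells lie in positive
columns. -/
theorem UncrowdInvariant.step {μ : YoungDiagram} {X : Filling × SkewFilling}
    (h : UncrowdInvariant μ X) (hex : X.1.armExcess ≠ 0) :
    UncrowdInvariant μ (uncrowdStep X) ∧ (uncrowdStep X).1.armExcess + 1 = X.1.armExcess := by
  obtain ⟨T, S⟩ := X
  obtain ⟨hT, hS, hin, hout, htr⟩ := h
  simp only at hT hS hin hout htr hex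
  obtain ⟨c, r, a, K, r', hd⟩ := exists_bumpData hex
  obtain ⟨r₁, c₁, h1, h2, h3, h4, h5, -, h7, h8⟩ := (hT.inserts hex).2.spec hT hd
  have htr' := htr _ _ _ _ _ hd
  refine ⟨?_, h4⟩
  have hnot : (r₁, c₁) ∉ S.inner := fun h => h1 (hout ▸ hS.le h)
  have hold : ∀ r₀ c₀, (r₀, c₀) ∈ S.outer → (S.append T.insertion.shape
      fun _ c' => c' - T.armCol).entry r₀ c₀ = S.entry r₀ c₀ := by
    intro r₀ c₀ h
    simp only [SkewFilling.append, h, if_true]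
    split_ifs with h9
    · rfl
    · refine (S.entry_outside _ _ fun h10 => h9 ⟨(h3 _).2 (Or.inl ?_), h10.2⟩).symm
      rwa [← hout]
  have hnew : (S.append T.insertion.shape fun _ c' => c' - T.armCol).entry r₁ c₁ = c₁ - c := by
    rw [← hd.armCol]
    simp only [SkewFilling.append]
    rw [if_pos ⟨(h3 _).2 (Or.inr rfl), hnot⟩, if_neg (by rwa [hout])]
  have hcase : ∀ r₀ c₀, (r₀, c₀) ∈ T.insertion.shape →
      (r₀, c₀) ∈ S.outer ∨ (r₀ = r₁ ∧ c₀ = c₁) := by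
    intro r₀ c₀ h
    rw [hout, ← Prod.mk.injEq]
    exact (h3 _).1 h
  have hle : ∀ r₀ c₀, (r₀, c₀) ∈ S.outer → (r₀, c₀) ∉ S.inner → S.entry r₀ c₀ + c ≤ c₀ := by
    intro r₀ c₀ h9 h10
    rcases htr' r₀ c₀ h9 h10 with h11 | h11 <;> omega
  refine ⟨hT.insertion, ⟨?_, ?_, ?_, ?_, ?_, ?_⟩, hin, rfl, ?_⟩
  · intro p hp
    exact (h3 p).2 (Or.inl (hout ▸ hS.le hp))
  · refine hS.colLen_zero.trans (eq_of_forall_lt_iff fun n => ?_)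
    change n < S.outer.colLen 0 ↔ n < T.insertion.shape.colLen 0
    rw [← YoungDiagram.mem_iff_lt_colLen, ← YoungDiagram.mem_iff_lt_colLen, h3, hout,
      Prod.mk.injEq]
    exact ⟨Or.inl, fun h => h.elim id fun h => by omega⟩
  · intro r₀ c₀ h9 h10
    rcases hcase _ _ h9 with h11 | ⟨rfl, rfl⟩
    · change 0 < (S.append _ _).entry r₀ c₀
      rw [hold _ _ h11]
      exact hS.pos _ _ h11 h10
    · change 0 < (S.append _ _).entry r₀ c₀
      rw [hnew]
      omega
  · intro r₀ c₀ h9 h10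
    change (S.append _ _).entry r₀ c₀ ≤ c₀
    rcases hcase _ _ h9 with h11 | ⟨rfl, rfl⟩
    · rw [hold _ _ h11]
      exact hS.flag _ _ h11 h10
    · rw [hnew]
      omega
  · intro r₀ c₀ c₂ h9 h10 h11
    change (S.append _ _).entry r₀ c₀ < (S.append _ _).entry r₀ c₂
    rcases hcase _ _ h11 with h12 | ⟨rfl, rfl⟩
    · rw [hold _ _ h12, hold _ _ (S.outer.up_left_mem le_rfl h9.le h12)]
      exact hS.row _ _ _ h9 h10 h12
    · rcases hcase _ _ (T.insertion.shape.up_left_mem le_rfl h9.le h11) with h12 | h12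
      · rw [hold _ _ h12, hnew]
        have := hle _ _ h12 h10
        omega
      · omega
  · intro r₀ r₂ c₀ h9 h10 h11
    change (S.append _ _).entry r₀ c₀ < (S.append _ _).entry r₂ c₀
    rcases hcase _ _ h11 with h12 | ⟨rfl, rfl⟩
    · rw [hold _ _ h12, hold _ _ (S.outer.up_left_mem h9.le le_rfl h12)]
      exact hS.col _ _ _ h9 h10 h12
    · rcases hcase _ _ (T.insertion.shape.up_left_mem h9.le le_rfl h11) with h12 | h12
      · rw [hold _ _ h12, hnew]
        -- The old cell is in the same column as the new one: either its entry is strictly smaller,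
        -- or the insertion would have ended further to the right.
        rcases htr' _ _ h12 h10 with h13 | ⟨_, h13⟩
        · omega
        · exact absurd (h8 _ h13) (lt_irrefl _)
      · omega
  · intro c₂ r₂ a₂ K₂ r₂' hd₂ r₀ c₀ h9 h10
    change (S.append _ _).entry r₀ c₀ + c₂ < c₀ ∨ ((S.append _ _).entry r₀ c₀ + c₂ = c₀ ∧ _)
    have h11 : c₂ ≤ c := by
      by_contra h11
      have h12 := hd₂.pos
      change 0 < T.insertion.armCount r₂ c₂ a₂ at h12
      rw [h5, if_pos (by omega)] at h12
      omega
    have h12 : c₂ = c → a₂ ≤ a := by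
      rintro rfl
      have h12 := hd₂.pos
      change 0 < T.insertion.armCount r₂ c₂ a₂ at h12
      rw [h5, if_neg (lt_irrefl _)] at h12
      exact hd.max r₂ a₂ (by omega)
    rcases hcase _ _ h9 with h13 | ⟨rfl, rfl⟩
    · rw [hold _ _ h13]
      -- If the next insertion starts in the same column, its arm entry is at most `a`, and the
      -- trail just created, cut off at the old cell's column, replaces the old one. If it starts
      -- further left, the inequality becomes strict and no trail is needed.
      rcases h11.eq_or_lt with rfl | h11
      · rcases htr' _ _ h13 h10 with h14 | ⟨h14, h15⟩
        · exact Or.inl h14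
        · exact Or.inr ⟨h14, (h7.mono (h12 rfl)).truncate h15.le (h8 _ h15).le⟩
      · have := hle _ _ h13 h10
        omega
    · rw [hnew]
      rcases h11.eq_or_lt with rfl | h11
      · exact Or.inr ⟨by omega, h7.mono (h12 rfl)⟩
      · omega

theorem UncrowdInvariant.iterate {μ : YoungDiagram} {X : Filling × SkewFilling}
    (h : UncrowdInvariant μ X) {d n : ℕ} (hd : X.1.armExcess = n + d) :
    UncrowdInvariant μ (uncrowdStep^[d] X) ∧ (uncrowdStep^[d] X).1.armExcess = n := by
  induction d generalizing X with
  | zero => exact ⟨h, hd⟩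
  | succ d ih =>
    obtain ⟨h1, h2⟩ := h.step (by omega)
    exact ih h1 (by omega)

theorem IsHVT.uncrowd {T : Filling} (hT : T.IsHVT) :
    UncrowdInvariant T.shape T.uncrowd ∧ T.uncrowd.1.armExcess = 0 :=
  (UncrowdInvariant.empty hT).iterate (zero_add _).symm

end Filling

end HookValued

theorem mainTheorem1 (T : HookValued.Filling) (hT : T.IsHVT) :
    (T.P.IsSVT ∧ T.Q.IsColumnFlaggedIncreasing ∧
      T.Q.inner = T.shape ∧ T.Q.outer = T.P.shape) ∧
    ∀ i : ℕ, 1 ≤ i →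
      (∀ T' : HookValued.Filling, T.f i = some T' →
        T'.IsHVT ∧ T'.shape = T.shape ∧ T.P.f i = some T'.P ∧ T.Q = T'.Q) ∧
      (∀ T' : HookValued.Filling, T.e i = some T' →
        T'.IsHVT ∧ T'.shape = T.shape ∧ T.P.e i = some T'.P ∧ T.Q = T'.Q) ∧
      (T.f i = none → T.P.f i = none) ∧
      (T.e i = none → T.P.e i = none) := by
  obtain ⟨h1, h2⟩ := hT.uncrowd
  refine ⟨⟨⟨h1.isHVT, h2⟩, h1.flagged, h1.inner, h1.outer⟩, fun i hi => ⟨fun T' hf => ?_,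
    fun T' he => ?_, ?_, ?_⟩⟩
  · obtain ⟨h3, h4, -⟩ := hT.f_invariants hf
    exact ⟨h3, h4, hT.P_f hi hf⟩
  · obtain ⟨_, _, -, -, -, -, h4, h3⟩ := hT.e_cases hi he
    exact ⟨h3, h4.shape, hT.P_e hi he⟩
  · exact (hT.iterate_uncrowdStep_eq_none _ _).1
  · exact (hT.iterate_uncrowdStep_eq_none _ _).2
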